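/- Let $a<b$, $\Omega=(a,b)$, $T>0$, $\beta\in\mathbb R$, and let $V\in L^\infty(\Omega)$ be real-valued. For $m\ge 1$ let $H^m_{\rm per}(\Omega)=\{\phi\in H^m(\Omega):\phi^{(k)}(a)=\phi^{(k)}(b),\ k=0,\dots,m-1\}$. Let $\psi\in C([0,T];H^2_{\rm per}(\Omega))\cap C^1([0,T];L^2(\Omega))$ be a solution of the one-dimensional Gross–Pitaevskii equation $$ i\,\partial_t\psi=-\partial_{xx}\psi+V\psi+\beta|\psi|^2\psi\quad\text{in }\Omega,\ 0<t\le T,\qquad \psi(\cdot,0)=\psi_0, $$ where $\psi_0$ denotes the continuous representative on $[a,b]$. For a positive even integer $N$ put $h=(b-a)/N$, $x_j=a+jh$ $(0\le j\le N)$, $\mathcal T_N=\{-\frac N2,\dots,\frac N2-1\}$, $\mu_l=\frac{2\pi l}{b-a}$, and for $u\in L^2(\Omega)$ and $v=(v_0,\dots,v_N)\in\mathbb C^{N+1}$ put $$\widehat u_l=\frac1{b-a}\int_a^b u(x)e^{-i\mu_l(x-a)}\,dx,\qquad \widetilde v_l=\frac1N\sum_{j=0}^{N-1}v_je^{-i\mu_l(x_j-a)},\qquad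 (I_Nv)(x)=\sum_{l\in\mathcal T_N}\widetilde v_l\,e^{i\mu_l(x-a)}.$$ For a time step $\tau>0$, the Lie–Trotter time-splitting extended Fourier pseudospectral (LTeFP) method computes $\widetilde\psi^n=(\widetilde\psi^n_0,\dots,\widetilde\psi^n_N)$ by $\widetilde\psi^0_j=\psi_0(x_j)$ and, for $n\ge0$, $$\psi^{(1)}(x)=e^{-i\tau V(x)}\,I_N\!\left(\widetilde\psi^n e^{-i\tau\beta|\widetilde\psi^n|^2}\right)(x),\qquad \widetilde\psi^{n+1}_j=\sum_{l\in\mathcal T_N}e^{-i\tau\mu_l^2}\,\widehat{(\psi^{(1)})}_l\,e^{i\mu_l(x_j-a)},\quad 0\le j\le N.$$ **Theorem 3.1.** There exist $h_0>0$ and $C>0$, independent of $h$, $\tau$ and $n$, such that whenever $0<h<h_0$ and $0<\tau\le h^2/\pi$, with $t_n=n\tau$, $$\|\psi(\cdot,t_n)-I_N\widetilde\psi^n\|_{L^2}\le C(\tau+h^2),\qquad \|\psi(\cdot,t_n)-I_N\widetilde\psi^n\|_{H^1}\le C(\sqrt\tau+h),\qquad 0\le n\le T/\tau.$$ If, in addition,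 $V\in W^{1,4}(\Omega)\cap H^1_{\rm per}(\Omega)$ and $\psi\in C([0,T];H^3_{\rm per}(\Omega))\cap C^1([0,T];H^1(\Omega))$, then, with the same $h_0$ and some constant $C'>0$ independent of $h$, $\tau$ and $n$, under the same conditions on $h$ and $\tau$, $$\|\psi(\cdot,t_n)-I_N\widetilde\psi^n\|_{H^1}\le C'(\tau+h^2),\qquad 0\le n\le T/\tau.$$ -/

import Mathlib

open Set MeasureTheory Filter Topology
open scoped ContDiff

noncomputable section

namespace GPE

/-! ## Function spaces on the interval `(a, b)` -/

/-- Lebesgue measure on `Ω = (a, b)`. -/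
abbrev vol (a b : ℝ) : Measure ℝ := volume.restrict (Ioo a b)

/-- The complex space `L²(Ω)`. -/
abbrev L2 (a b : ℝ) : Type := Lp ℂ 2 (vol a b)

/-- `v` is the `k`-th weak derivative of `u` on `(a, b)`; it is used below for functions `u`, `v`
in some `L^p(a, b)` with `p ≥ 1`, so that all the integrals converge. -/
def HasWeakDeriv {E : Type} [NormedAddCommGroup E] [NormedSpace ℝ E]
    (a b : ℝ) (k : ℕ) (u v : ℝ → E) : Prop :=
  ∀ φ : ℝ → ℝ, ContDiff ℝ ∞ φ → HasCompactSupport φ → tsupport φ ⊆ Ioo a b →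
    ∫ x in Ioo a b, iteratedDeriv k φ x • u x = (-1 : ℝ) ^ k • ∫ x in Ioo a b, φ x • v x

/-- `u ∈ W^{m,p}(a, b)`: the weak derivatives of order `0, …, m` exist in `L^p(a, b)`. -/
def MemW {E : Type} [NormedAddCommGroup E] [NormedSpace ℝ E]
    (a b : ℝ) (m : ℕ) (p : ENNReal) (u : ℝ → E) : Prop :=
  ∃ g : ℕ → ℝ → E, g 0 = u ∧ ∀ k ≤ m, MemLp (g k) p (vol a b) ∧ HasWeakDeriv a b k u (g k)

/-- `u ∈ H^m_per(a, b)`: `u ∈ H^m(a, b)` and `u^{(k)}(a) = u^{(k)}(b)` for `k = 0, …, m - 1`, where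
the boundary values are those of the continuous representative of `u^{(k)}` on `[a, b]`. -/
def MemHper {E : Type} [NormedAddCommGroup E] [NormedSpace ℝ E]
    (a b : ℝ) (m : ℕ) (u : ℝ → E) : Prop :=
  ∃ g : ℕ → ℝ → E, g 0 = u ∧
    (∀ k ≤ m, MemLp (g k) 2 (vol a b) ∧ HasWeakDeriv a b k u (g k)) ∧
    ∀ k < m, ∃ w : ℝ → E, ContinuousOn w (Icc a b) ∧ w a = w b ∧ g k =ᵐ[vol a b] w

lemma integrable_test_smul {a b : ℝ} {φ : ℝ → ℝ} (hφ : ContDiff ℝ ∞ φ)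
    (hc : HasCompactSupport φ) (k : ℕ) (u : L2 a b) :
    Integrable (fun x => iteratedDeriv k φ x • u x) (vol a b) := by
  have hcont : Continuous (iteratedDeriv k φ) :=
    hφ.continuous_iteratedDeriv k (by exact_mod_cast le_top)
  have hcs : HasCompactSupport (iteratedDeriv k φ) := by
    rw [iteratedDeriv_eq_equiv_comp]
    exact (hc.iteratedFDeriv k).comp_left (map_zero _)
  obtain ⟨C, hC⟩ := hcs.exists_bound_of_continuous hcont
  have : IsFiniteMeasure (vol a b) := ⟨by simp [vol]⟩
  exact ((Lp.memLp u).integrable (by norm_num)).bdd_smul C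
    hcont.aestronglyMeasurable (Eventually.of_forall hC)

/-- The Sobolev space `H^m(a, b)`. An element is recorded as the family
`(u, u', …, u^{(m)})` of its weak derivatives; the norm is
`‖u‖_{H^m} = (∑_{k ≤ m} ‖u^{(k)}‖²_{L²})^{1/2}`. -/
def H (a b : ℝ) (m : ℕ) : Submodule ℝ (PiLp 2 (fun _ : Fin (m + 1) => L2 a b)) where
  carrier := {f | ∀ k : Fin (m + 1), HasWeakDeriv a b k (f 0) (f k)}
  zero_mem' := by
    intro k φ _ _ _
    have h0 : ∀ g : ℝ → ℝ, ∫ x in Ioo a b, g x • (0 : L2 a b) x = 0 := fun g => by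
      rw [← integral_zero ℝ ℂ (μ := vol a b)]
      refine integral_congr_ae ?_
      filter_upwards [Lp.coeFn_zero ℂ 2 (vol a b)] with x hx
      rw [hx, Pi.zero_apply, smul_zero]
    simp only [PiLp.zero_apply, h0, smul_zero]
  add_mem' := by
    intro f g hf hg k φ h1 h2 h3
    have hadd : ∀ (j : ℕ) (u v : L2 a b), ∫ x in Ioo a b, iteratedDeriv j φ x • (u + v) x =
        (∫ x in Ioo a b, iteratedDeriv j φ x • u x) +
          ∫ x in Ioo a b, iteratedDeriv j φ x • v x := fun j u v => by
      rw [← integral_add (integrable_test_smul h1 h2 j u) (integrable_test_smul h1 h2 j v)]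
      refine integral_congr_ae ?_
      filter_upwards [Lp.coeFn_add u v] with x hx
      simp only [hx, Pi.add_apply, smul_add]
    have e := hadd k (f 0) (g 0)
    have e' := hadd 0 (f k) (g k)
    simp only [iteratedDeriv_zero] at e'
    simp only [PiLp.add_apply]
    rw [e, e', hf k φ h1 h2 h3, hg k φ h1 h2 h3, smul_add]
  smul_mem' := by
    intro c f hf k φ h1 h2 h3
    have hsm : ∀ (g : ℝ → ℝ) (u : L2 a b), ∫ x in Ioo a b, g x • (c • u) x =
        c • ∫ x in Ioo a b, g x • u x := fun g u => by
      rw [← integral_smul]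
      refine integral_congr_ae ?_
      filter_upwards [Lp.coeFn_smul c u] with x hx
      simp only [hx, Pi.smul_apply, smul_comm c]
    simp only [PiLp.smul_apply, hsm]
    rw [hf k φ h1 h2 h3, smul_comm]

/-- The underlying `L²` function of an element of `H^m(a, b)`. -/
def toL2 {a b : ℝ} {m : ℕ} (u : H a b m) : L2 a b := u.1 0

/-- `ψ ∈ C([0,T]; H^m_per(a, b))`. -/
def ContHper (a b T : ℝ) (m : ℕ) (ψ : ℝ → L2 a b) : Prop :=
  ∃ u : ℝ → H a b m, ContinuousOn u (Icc 0 T) ∧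
    ∀ t ∈ Icc 0 T, toL2 (u t) = ψ t ∧ MemHper a b m (ψ t)

/-- `ψ ∈ C¹([0,T]; H^m(a, b))`. -/
def ContDiffH (a b T : ℝ) (m : ℕ) (ψ : ℝ → L2 a b) : Prop :=
  ∃ u : ℝ → H a b m, ContDiffOn ℝ 1 u (Icc 0 T) ∧ ∀ t ∈ Icc 0 T, toL2 (u t) = ψ t

/-! ## The Gross-Pitaevskii equation -/

/-- `i ∂ₜψ = -∂ₓₓψ + V ψ + β |ψ|² ψ` as an identity in `L²(a, b)` for every `t ∈ (0, T]`. -/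
def SolvesGPE (a b T β : ℝ) (V : ℝ → ℝ) (ψ : ℝ → L2 a b) : Prop :=
  ∀ t ∈ Ioc 0 T, ∃ w : L2 a b, HasWeakDeriv a b 2 (ψ t) w ∧
    ∀ᵐ x ∂(vol a b), Complex.I * (derivWithin ψ (Icc 0 T) t : L2 a b) x =
      -w x + (V x : ℂ) * ψ t x + (β : ℂ) * ((‖ψ t x‖ ^ 2 : ℝ) : ℂ) * ψ t x

/-! ## The Lie-Trotter extended Fourier pseudospectral scheme -/

/-- The mesh size `h = (b - a) / N`. -/
def mesh (a b : ℝ) (N : ℕ) : ℝ := (b - a) / N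

/-- The grid point `x_j = a + j h`. -/
def gridPt (a b : ℝ) (N j : ℕ) : ℝ := a + j * mesh a b N

/-- The index set `{-N/2, …, N/2 - 1}`. -/
def modes (N : ℕ) : Finset ℤ := Finset.Ico (-((N : ℤ) / 2)) ((N : ℤ) / 2)

/-- The frequency `μ_l = 2 π l / (b - a)`. -/
def freq (a b : ℝ) (l : ℤ) : ℝ := 2 * Real.pi * l / (b - a)

/-- `e^{i μ_l (x - a)}`. -/
def mode (a b : ℝ) (l : ℤ) (x : ℝ) : ℂ :=
  Complex.exp (Complex.I * ((freq a b l * (x - a) : ℝ) : ℂ))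

/-- The Fourier coefficient `(b - a)⁻¹ ∫_a^b u(x) e^{-i μ_l (x - a)} dx`. -/
def fourierCoef (a b : ℝ) (u : ℝ → ℂ) (l : ℤ) : ℂ :=
  ((b - a : ℝ) : ℂ)⁻¹ *
    ∫ x in a..b, u x * Complex.exp (-Complex.I * ((freq a b l * (x - a) : ℝ) : ℂ))

/-- The discrete Fourier coefficient `N⁻¹ ∑_{j < N} v_j e^{-i μ_l (x_j - a)}` of a grid function
`v = (v_0, …, v_N)`. -/
def discreteCoef (a b : ℝ) (N : ℕ) (v : Fin (N + 1) → ℂ) (l : ℤ) : ℂ :=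
  (N : ℂ)⁻¹ * ∑ j : Fin N, v j.castSucc *
    Complex.exp (-Complex.I * ((freq a b l * (gridPt a b N j - a) : ℝ) : ℂ))

/-- The Fourier interpolant `I_N v`. -/
def interp (a b : ℝ) (N : ℕ) (v : Fin (N + 1) → ℂ) (x : ℝ) : ℂ :=
  ∑ l ∈ modes N, discreteCoef a b N v l * mode a b l x

/-- `ψ^{(1)} = e^{-iτV} I_N (v e^{-iτβ|v|²})`. -/
def stage (a b β : ℝ) (V : ℝ → ℝ) (τ : ℝ) (N : ℕ) (v : Fin (N + 1) → ℂ) (x : ℝ) : ℂ :=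
  Complex.exp (-Complex.I * ((τ * V x : ℝ) : ℂ)) *
    interp a b N
      (fun j => v j * Complex.exp (-Complex.I * ((τ * (β * ‖v j‖ ^ 2) : ℝ) : ℂ))) x

/-- One time step of the scheme. -/
def step (a b β : ℝ) (V : ℝ → ℝ) (τ : ℝ) (N : ℕ) (v : Fin (N + 1) → ℂ) : Fin (N + 1) → ℂ :=
  fun j => ∑ l ∈ modes N, Complex.exp (-Complex.I * ((τ * freq a b l ^ 2 : ℝ) : ℂ)) *
    fourierCoef a b (stage a b β V τ N v) l * mode a b l (gridPt a b N j)

/-- The numerical solution after `n` steps, started from the grid values of `ψ₀`. -/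
def numSol (a b β : ℝ) (V : ℝ → ℝ) (ψ₀ : ℝ → ℂ) (τ : ℝ) (N : ℕ) : ℕ → Fin (N + 1) → ℂ
  | 0 => fun j => ψ₀ (gridPt a b N j)
  | n + 1 => step a b β V τ N (numSol a b β V ψ₀ τ N n)

lemma memLp_interp (a b : ℝ) (N : ℕ) (v : Fin (N + 1) → ℂ) :
    MemLp (interp a b N v) 2 (vol a b) := by
  have hc : Continuous (interp a b N v) := by
    unfold interp mode
    fun_prop
  obtain ⟨C, hC⟩ := (isCompact_Icc (a := a) (b := b)).exists_bound_of_continuousOn hc.continuousOn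
  have : IsFiniteMeasure (vol a b) := ⟨by simp [vol]⟩
  refine MemLp.of_bound hc.aestronglyMeasurable C ?_
  filter_upwards [ae_restrict_mem measurableSet_Ioo] with x hx
  exact hC x (Ioo_subset_Icc_self hx)

/-- The Fourier interpolant as an element of `L²(a, b)`. -/
def interpL2 (a b : ℝ) (N : ℕ) (v : Fin (N + 1) → ℂ) : L2 a b := (memLp_interp a b N v).toLp

/-- The error `ψ(·, t_n) - I_N ψ̃ⁿ`, `t_n = n τ`, as an element of `L²(a, b)`. -/
def err (a b β : ℝ) (V : ℝ → ℝ) (ψ : ℝ → L2 a b) (ψ₀ : ℝ → ℂ) (τ : ℝ) (N n : ℕ) : L2 a b :=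
  ψ (n * τ) - interpL2 a b N (numSol a b β V ψ₀ τ N n)

/-- `f ∈ H^m(a, b)` and `‖f‖_{H^m} ≤ r`. -/
def HNormLE (a b : ℝ) (m : ℕ) (f : L2 a b) (r : ℝ) : Prop :=
  ∃ e : H a b m, toL2 e = f ∧ ‖e‖ ≤ r

end GPE

end

/-! The error is followed coefficient by coefficient on `modes N`. For the Fourier coefficients `c`
of the solution the equation reads `c' = -i (μ² c + F)`, where `F` collects the coefficients of `Vψ
+ β|ψ|²ψ`. The free part is solved exactly by the scheme, so by Duhamel's formula everything depends
on how `∫_0^τ e^{iσμ²} F(t+σ) dσ` is treated. Freezing `F` at `t` costs `O(τ²)`, because `ψ` is `C¹`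
in time with values in `L²` and `F` inherits its Lipschitz bound (`sn_duhamel_le`). The scheme
replaces the integral by `τ F(t)`, up to a defect `τ · O(error + h² + τ)`. The remaining discrepancy
`-i (∫_0^τ e^{iσμ²} dσ - τ) F(t)` is only `O(τ)` at high frequencies: with `V` merely bounded, `F`
has no spatial derivatives to spare. Summed naively it would destroy convergence.

Oscillation rescues it. The condition `τ ≤ h²/π` means `τμ² ≤ π` on the modes, so the discrepancy
can be written `(1 - e^{-iτμ²}) ρ F` with `|ρ| ≤ 2τ` (`exists_filter`). Over successive time steps
this telescopes, up to the slow variation of `F`: with `z = e^{-iτμ²}` the modified error `E - zρF`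
obeys a recursion with sources of size `τ(τ + h²)`, and a discrete Gronwall argument concludes
(`sn_recursion_le`).

In space, `V` is multiplied inside an exact Fourier integral, so it is never sampled and Bessel's
inequality suffices. The cubic flow is interpolated. The exact solution is first truncated to
`lowModes N`; the cube of the truncation still has all its frequencies in `modes N`, so grid and
integral give the same coefficients (`coef_cub_low`). The rest is Lipschitz continuity of the cubic,
in `L²` and in the grid norm, which coincide on trigonometric polynomials (`IsAveraging.l2_trig`).
`IsAveraging` axiomatises what Lebesgue and grid averages share, so each estimate is proved once.
The initial interpolation error is pure aliasing, `O(h²)`.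

The Lipschitz constants require a sup bound for the numerical solution. Passing from `ℓ²` to `ℓ¹`
costs `√N`, and `√N (τ + h²) = O(h)`, so for `h < h₀` a strong induction keeps that bound below `M +
1` (`FourierFlow.l2_error`).

The first `H¹` bound follows from `|μ| ≤ π/h` and `τ/h ≤ √τ`. For the second the argument is
repeated with weight `μ` (`SmoothFlow.h1_error`), derivatives of products being replaced by
increments over one mesh width: `|μ| ≤ (2/h) |e^{iμh} - 1|` on the modes, and translation by `h`
preserves both averages. The `H¹` bound of the numerical solution comes free from the `L²` estimate,
so `h₀` does not change. -/

namespace GPE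

/-! ## Finite `ℓ²` seminorms of coefficient families -/

/-- The `ℓ²` norm of the restriction of `c` to `S`. -/
noncomputable def sn (S : Finset ℤ) (c : ℤ → ℂ) : ℝ := Real.sqrt (∑ l ∈ S, ‖c l‖ ^ 2)

lemma sn_nonneg (S : Finset ℤ) (c : ℤ → ℂ) : 0 ≤ sn S c := Real.sqrt_nonneg _

lemma sn_sq (S : Finset ℤ) (c : ℤ → ℂ) : sn S c ^ 2 = ∑ l ∈ S, ‖c l‖ ^ 2 :=
  Real.sq_sqrt (Finset.sum_nonneg fun _ _ => sq_nonneg _)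

lemma sn_eq_norm (S : Finset ℤ) (c : ℤ → ℂ) :
    sn S c = ‖(WithLp.toLp 2 (fun l : S => c l) : EuclideanSpace ℂ S)‖ := by
  rw [EuclideanSpace.norm_eq, sn, ← Finset.sum_coe_sort S (fun l => ‖c l‖ ^ 2)]

lemma sn_add_le (S : Finset ℤ) (c d : ℤ → ℂ) : sn S (fun l => c l + d l) ≤ sn S c + sn S d := by
  rw [sn_eq_norm, sn_eq_norm, sn_eq_norm]
  exact norm_add_le (WithLp.toLp 2 (fun l : S => c l) : EuclideanSpace ℂ S)
    (WithLp.toLp 2 (fun l : S => d l))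

lemma sn_mono {S : Finset ℤ} {c d : ℤ → ℂ} {κ : ℝ} (hκ : 0 ≤ κ)
    (h : ∀ l ∈ S, ‖c l‖ ≤ κ * ‖d l‖) : sn S c ≤ κ * sn S d := by
  refine Real.sqrt_le_iff.2 ⟨mul_nonneg hκ (sn_nonneg _ _), ?_⟩
  rw [mul_pow, sn_sq, Finset.mul_sum]
  refine Finset.sum_le_sum fun l hl => ?_
  rw [← mul_pow]
  exact pow_le_pow_left₀ (norm_nonneg _) (h l hl) 2

lemma sn_congr_norm {S : Finset ℤ} {c d : ℤ → ℂ} (h : ∀ l ∈ S, ‖c l‖ = ‖d l‖) : sn S c = sn S d := by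
  unfold sn
  rw [Finset.sum_congr rfl fun l hl => by rw [h l hl]]

lemma sn_congr {S : Finset ℤ} {c d : ℤ → ℂ} (h : ∀ l ∈ S, c l = d l) : sn S c = sn S d :=
  sn_congr_norm fun l hl => by rw [h l hl]

lemma sn_const_mul (S : Finset ℤ) (κ : ℂ) (c : ℤ → ℂ) : sn S (fun l => κ * c l) = ‖κ‖ * sn S c := by
  unfold sn
  simp_rw [norm_mul, mul_pow, ← Finset.mul_sum]
  rw [Real.sqrt_mul (sq_nonneg _), Real.sqrt_sq (norm_nonneg _)]

lemma sn_sub_le (S : Finset ℤ) (c d : ℤ → ℂ) : sn S (fun l => c l - d l) ≤ sn S c + sn S d := by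
  have h := sn_add_le S c (fun l => -d l)
  have h2 : sn S (fun l => -d l) = sn S d := sn_congr_norm fun l _ => norm_neg _
  simpa only [sub_eq_add_neg, h2] using h

lemma sn_sq_le_tsum (S : Finset ℤ) {c : ℤ → ℂ} (hc : Summable fun l => ‖c l‖ ^ 2) :
    sn S c ^ 2 ≤ ∑' l, ‖c l‖ ^ 2 := by
  rw [sn_sq]
  exact hc.sum_le_tsum _ fun _ _ => sq_nonneg _

lemma sn_le_of_tsum (S : Finset ℤ) {c : ℤ → ℂ} (hc : Summable fun l => ‖c l‖ ^ 2) {M : ℝ}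
    (hM : 0 ≤ M) (h : ∑' l, ‖c l‖ ^ 2 ≤ M ^ 2) : sn S c ≤ M :=
  le_of_sq_le_sq ((sn_sq_le_tsum S hc).trans h) hM
where
  le_of_sq_le_sq {x y : ℝ} (h : x ^ 2 ≤ y ^ 2) (hy : 0 ≤ y) : x ≤ y := by nlinarith [abs_nonneg x, sq_abs x]

lemma sum_norm_mul_le_sn_mul_sn (S : Finset ℤ) (w : ℤ → ℝ) (c : ℤ → ℂ) :
    ∑ l ∈ S, |w l| * ‖c l‖ ≤ Real.sqrt (∑ l ∈ S, w l ^ 2) * sn S c := by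
  have := Real.sum_mul_le_sqrt_mul_sqrt S (fun l => |w l|) (fun l => ‖c l‖)
  simpa [sn] using this

/-! ## The quadratic mean of a function -/

/-- The `L²(ν)` norm. -/
noncomputable def l2 (ν : Measure ℝ) (g : ℝ → ℂ) : ℝ := (eLpNorm g 2 ν).toReal

lemma l2_nonneg (ν : Measure ℝ) (g : ℝ → ℂ) : 0 ≤ l2 ν g := ENNReal.toReal_nonneg

lemma l2_mono {ν : Measure ℝ} {g k : ℝ → ℂ} {κ : ℝ} (hκ : 0 ≤ κ) (hk : MemLp k 2 ν)
    (h : ∀ᵐ x ∂ν, ‖g x‖ ≤ κ * ‖k x‖) : l2 ν g ≤ κ * l2 ν k := by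
  have := eLpNorm_le_mul_eLpNorm_of_ae_le_mul h 2
  have h2 := ENNReal.toReal_mono (ENNReal.mul_ne_top ENNReal.ofReal_ne_top hk.2.ne) this
  rwa [ENNReal.toReal_mul, ENNReal.toReal_ofReal hκ] at h2

lemma l2_mono_add {ν : Measure ℝ} {g k₁ k₂ : ℝ → ℂ} {κ₁ κ₂ : ℝ} (h₁ : 0 ≤ κ₁) (h₂ : 0 ≤ κ₂)
    (hk₁ : MemLp k₁ 2 ν) (hk₂ : MemLp k₂ 2 ν)
    (h : ∀ᵐ x ∂ν, ‖g x‖ ≤ κ₁ * ‖k₁ x‖ + κ₂ * ‖k₂ x‖) : l2 ν g ≤ κ₁ * l2 ν k₁ + κ₂ * l2 ν k₂ := by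
  have e : ∀ (κ : ℝ) (k : ℝ → ℂ), 0 ≤ κ → MemLp k 2 ν →
      (eLpNorm (fun x => κ * ‖k x‖) 2 ν) = ENNReal.ofReal κ * eLpNorm k 2 ν := fun κ k hκ hk => by
    have := eLpNorm_const_smul κ (fun x => ‖k x‖) 2 ν
    rw [eLpNorm_norm] at this
    simpa [Pi.smul_def, Real.enorm_eq_ofReal hκ] using this
  have m : ∀ (κ : ℝ) (k : ℝ → ℂ), MemLp k 2 ν → MemLp (fun x => κ * ‖k x‖) 2 ν :=
    fun κ k hk => hk.norm.const_mul κ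
  have h3 : eLpNorm g 2 ν ≤ ENNReal.ofReal κ₁ * eLpNorm k₁ 2 ν + ENNReal.ofReal κ₂ * eLpNorm k₂ 2 ν := by
    rw [← e κ₁ k₁ h₁ hk₁, ← e κ₂ k₂ h₂ hk₂]
    refine (eLpNorm_mono_ae_real h).trans ?_
    exact eLpNorm_add_le (m κ₁ k₁ hk₁).1 (m κ₂ k₂ hk₂).1 (by norm_num)
  have t₁ : ENNReal.ofReal κ₁ * eLpNorm k₁ 2 ν ≠ ⊤ := ENNReal.mul_ne_top ENNReal.ofReal_ne_top hk₁.2.ne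
  have t₂ : ENNReal.ofReal κ₂ * eLpNorm k₂ 2 ν ≠ ⊤ := ENNReal.mul_ne_top ENNReal.ofReal_ne_top hk₂.2.ne
  have h4 := ENNReal.toReal_mono (ENNReal.add_ne_top.2 ⟨t₁, t₂⟩) h3
  rwa [ENNReal.toReal_add t₁ t₂, ENNReal.toReal_mul, ENNReal.toReal_mul, ENNReal.toReal_ofReal h₁,
    ENNReal.toReal_ofReal h₂] at h4

lemma l2_le_of_bound {ν : Measure ℝ} [IsProbabilityMeasure ν] {g : ℝ → ℂ} {C : ℝ} (hC : 0 ≤ C)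
    (h : ∀ᵐ x ∂ν, ‖g x‖ ≤ C) : l2 ν g ≤ C := by
  have := l2_mono (k := fun _ => 1) hC (memLp_const (1 : ℂ)) (by simpa using h)
  simpa [l2, eLpNorm_const _ two_ne_zero (IsProbabilityMeasure.ne_zero ν)] using this

lemma l2_sq_eq_norm {ν : Measure ℝ} {g : ℝ → ℂ} (hg : MemLp g 2 ν) : l2 ν g = ‖hg.toLp‖ := by
  rw [Lp.norm_toLp, l2]

lemma l2_sq {ν : Measure ℝ} {g : ℝ → ℂ} (hg : MemLp g 2 ν) : l2 ν g ^ 2 = ∫ x, ‖g x‖ ^ 2 ∂ν := by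
  rw [l2, hg.eLpNorm_eq_integral_rpow_norm (by norm_num) (by norm_num), ENNReal.toReal_ofReal
    (by positivity)]
  simp only [ENNReal.toReal_ofNat, Real.rpow_ofNat]
  rw [← Real.rpow_natCast, ← Real.rpow_mul (integral_nonneg fun _ => sq_nonneg _)]
  norm_num

/-! ## Fourier modes -/

variable {a b : ℝ}

lemma mode_add (a b : ℝ) (l m : ℤ) (x : ℝ) : mode a b (l + m) x = mode a b l x * mode a b m x := by
  unfold mode freq
  rw [← Complex.exp_add]
  congr 1
  push_cast
  ring

@[simp] lemma mode_zero (a b x : ℝ) : mode a b 0 x = 1 := by simp [mode, freq]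

@[simp] lemma norm_mode (a b : ℝ) (l : ℤ) (x : ℝ) : ‖mode a b l x‖ = 1 := by
  rw [mode, mul_comm]
  exact Complex.norm_exp_ofReal_mul_I _

lemma freq_neg (a b : ℝ) (l : ℤ) : freq a b (-l) = -freq a b l := by
  unfold freq; push_cast; ring

lemma mode_neg (a b : ℝ) (l : ℤ) (x : ℝ) : mode a b (-l) x = star (mode a b l x) := by
  simp only [mode, freq_neg]
  rw [Complex.star_def, ← Complex.exp_conj]
  simp

lemma continuous_mode (a b : ℝ) (l : ℤ) : Continuous (mode a b l) := by
  unfold mode; fun_prop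

lemma mode_shift (a b : ℝ) (l : ℤ) (x y : ℝ) :
    mode a b l (x + y) = Complex.exp (Complex.I * ((freq a b l * y : ℝ) : ℂ)) * mode a b l x := by
  unfold mode
  rw [← Complex.exp_add]
  congr 1
  push_cast
  ring

lemma mode_periodic (hab : a < b) (l : ℤ) : Function.Periodic (mode a b l) (b - a) := by
  intro x
  rw [mode_shift, freq, div_mul_cancel₀ _ (sub_pos.2 hab).ne']
  have : Complex.exp (Complex.I * ((2 * Real.pi * l : ℝ) : ℂ)) = 1 := by
    rw [Complex.exp_eq_one_iff]
    exact ⟨l, by push_cast; ring⟩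
  rw [this, one_mul]

lemma hasDerivAt_mode (a b : ℝ) (l : ℤ) (x : ℝ) :
    HasDerivAt (mode a b l) (Complex.I * freq a b l * mode a b l x) x := by
  unfold mode
  have h : HasDerivAt (fun y : ℝ => Complex.I * ((freq a b l * (y - a) : ℝ) : ℂ))
      (Complex.I * ((freq a b l * 1 : ℝ) : ℂ)) x :=
    (((hasDerivAt_id x).sub_const a).const_mul (freq a b l)).ofReal_comp.const_mul Complex.I
  convert h.cexp using 1
  push_cast
  ring

lemma exp_neg_freq_eq_mode (a b : ℝ) (l : ℤ) (x : ℝ) :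
    Complex.exp (-Complex.I * ((freq a b l * (x - a) : ℝ) : ℂ)) = mode a b (-l) x := by
  rw [mode, freq_neg]
  congr 1
  push_cast
  ring

/-! ## Averages over a period: Lebesgue measure and grid points -/

/-- The normalised Lebesgue measure on `(a, b)`. -/
noncomputable def avgVol (a b : ℝ) : Measure ℝ := (ENNReal.ofReal (b - a))⁻¹ • vol a b

/-- The uniform measure on the grid points `x_0, …, x_{N-1}`. -/
noncomputable def avgGrid (a b : ℝ) (N : ℕ) : Measure ℝ :=
  (N : ENNReal)⁻¹ • ∑ j ∈ Finset.range N, Measure.dirac (gridPt a b N j)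

/-- The Fourier coefficient with respect to the measure `ν`. -/
noncomputable def coef (a b : ℝ) (ν : Measure ℝ) (g : ℝ → ℂ) (l : ℤ) : ℂ :=
  ∫ x, g x * mode a b (-l) x ∂ν

/-- A probability measure for which the modes `e^{iμ_l(x-a)}`, `0 < |l| < N`, have mean zero and
which averages periodic functions invariantly under the shift by the mesh size. -/
structure IsAveraging (a b : ℝ) (N : ℕ) (ν : Measure ℝ) : Prop where
  prob : IsProbabilityMeasure ν
  orth : ∀ l : ℤ, l ≠ 0 → |l| < N → ∫ x, mode a b l x ∂ν = 0
  shift : ∀ g : ℝ → ℂ, Continuous g → Function.Periodic g (b - a) →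
    ∫ x, g (x + mesh a b N) ∂ν = ∫ x, g x ∂ν

lemma avgVol_prob (hab : a < b) : IsProbabilityMeasure (avgVol a b) := by
  constructor
  have h : ENNReal.ofReal (b - a) ≠ 0 := by simpa using hab
  simp [avgVol, vol, ENNReal.inv_mul_cancel h ENNReal.ofReal_ne_top]

lemma ae_avgVol_iff {p : ℝ → Prop} :
    (∀ᵐ x ∂avgVol a b, p x) ↔ ∀ᵐ x ∂vol a b, p x := by
  unfold avgVol
  rw [Measure.ae_ennreal_smul_measure_iff]
  -- The scaling factor is never zero, so null sets are unchanged.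
  simp

lemma memLp_avgVol (hab : a < b) {g : ℝ → ℂ} {p : ENNReal} (hg : MemLp g p (vol a b)) :
    MemLp g p (avgVol a b) :=
  hg.smul_measure (by simpa using hab)

lemma integral_avgVol (hab : a < b) (g : ℝ → ℂ) :
    ∫ x, g x ∂avgVol a b = ((b - a : ℝ) : ℂ)⁻¹ * ∫ x in a..b, g x := by
  rw [avgVol, integral_smul_measure, intervalIntegral.integral_of_le hab.le,
    ← integral_Ioc_eq_integral_Ioo, ENNReal.toReal_inv, ENNReal.toReal_ofReal (sub_pos.2 hab).le]
  simp [Complex.real_smul]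

lemma fourierCoef_eq_coef (hab : a < b) (g : ℝ → ℂ) (l : ℤ) :
    fourierCoef a b g l = coef a b (avgVol a b) g l := by
  rw [fourierCoef, coef, integral_avgVol hab]
  simp_rw [exp_neg_freq_eq_mode]

lemma integral_avgGrid (N : ℕ) (g : ℝ → ℂ) :
    ∫ x, g x ∂avgGrid a b N = (N : ℂ)⁻¹ * ∑ j ∈ Finset.range N, g (gridPt a b N j) := by
  rw [avgGrid, integral_smul_measure, integral_finsetSum_measure]
  · simp [Complex.real_smul]
  · intro j _
    exact integrable_dirac (by simp)

/-- The discrete transform does not see the last entry `v_N`, so any function on the line with the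
right values at the first `N` nodes may stand for `v`. This turns discrete coefficients into
integrals against `avgGrid`. -/
lemma discreteCoef_eq_coef {N : ℕ} (v : Fin (N + 1) → ℂ) (g : ℝ → ℂ)
    (h : ∀ j : Fin N, v j.castSucc = g (gridPt a b N j)) (l : ℤ) :
    discreteCoef a b N v l = coef a b (avgGrid a b N) g l := by
  rw [discreteCoef, coef, integral_avgGrid, ← Fin.sum_univ_eq_sum_range
    (fun j => g (gridPt a b N j) * mode a b (-l) (gridPt a b N j))]
  congr 1
  refine Finset.sum_congr rfl fun j _ => ?_
  rw [h, exp_neg_freq_eq_mode]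

lemma mesh_pos (hab : a < b) {N : ℕ} (hN : 0 < N) : 0 < mesh a b N :=
  div_pos (sub_pos.2 hab) (by exact_mod_cast hN)

lemma gridPt_succ (a b : ℝ) (N j : ℕ) : gridPt a b N (j + 1) = gridPt a b N j + mesh a b N := by
  unfold gridPt; push_cast; ring

lemma gridPt_self (a b : ℝ) {N : ℕ} (hN : 0 < N) : gridPt a b N N = a + (b - a) := by
  have : (N : ℝ) ≠ 0 := by exact_mod_cast hN.ne'
  unfold gridPt mesh; field_simp

lemma mode_gridPt (hab : a < b) {N : ℕ} (hN : 0 < N) (l : ℤ) (j : ℕ) :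
    mode a b l (gridPt a b N j) = Complex.exp (2 * Real.pi * Complex.I * (l / N)) ^ j := by
  have : (N : ℂ) ≠ 0 := by exact_mod_cast hN.ne'
  have h2 : (b : ℂ) - a ≠ 0 := by exact_mod_cast (sub_pos.2 hab).ne'
  rw [mode, ← Complex.exp_nat_mul]
  congr 1
  unfold freq gridPt mesh
  push_cast
  field_simp
  ring

/-- A geometric sum over the powers of an `N`-th root of unity. Frequencies congruent modulo `N` are
indistinguishable on the grid, which is the source of aliasing. -/
lemma integral_mode_avgGrid (hab : a < b) {N : ℕ} (hN : 0 < N) (l : ℤ) :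
    ∫ x, mode a b l x ∂avgGrid a b N = if (N : ℤ) ∣ l then 1 else 0 := by
  have hN' : (N : ℂ) ≠ 0 := by exact_mod_cast hN.ne'
  rw [integral_avgGrid]
  simp_rw [mode_gridPt hab hN]
  have hz : Complex.exp (2 * Real.pi * Complex.I * (l / N)) = 1 ↔ (N : ℤ) ∣ l := by
    rw [Complex.exp_eq_one_iff]
    constructor
    · rintro ⟨n, hn⟩
      refine ⟨n, ?_⟩
      have h2 : (2 * Real.pi * Complex.I : ℂ) ≠ 0 := Complex.two_pi_I_ne_zero
      have : (l / N : ℂ) = n := by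
        apply mul_left_cancel₀ h2
        rw [hn]; ring
      rw [div_eq_iff hN'] at this
      have h3 : (l : ℂ) = ((N * n : ℤ) : ℂ) := by rw [this]; push_cast; ring
      exact_mod_cast h3
    · rintro ⟨n, rfl⟩
      refine ⟨n, ?_⟩
      push_cast
      field_simp
  split_ifs with h
  · rw [hz.2 h]
    simp [hN']
  · have h1 : Complex.exp (2 * Real.pi * Complex.I * (l / N)) ≠ 1 := fun h' => h (hz.1 h')
    have h2 : Complex.exp (2 * Real.pi * Complex.I * (l / N)) ^ N = 1 := by
      rw [← Complex.exp_nat_mul, Complex.exp_eq_one_iff]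
      exact ⟨l, by field_simp⟩
    rw [geom_sum_eq h1, h2]
    simp

lemma isAveraging_avgGrid (hab : a < b) {N : ℕ} (hN : 0 < N) :
    IsAveraging a b N (avgGrid a b N) where
  prob := by
    constructor
    have h : (N : ENNReal) ≠ 0 := by exact_mod_cast hN.ne'
    simp [avgGrid, ENNReal.inv_mul_cancel h (ENNReal.natCast_ne_top N)]
  orth l hl hlN := by
    rw [integral_mode_avgGrid hab hN, if_neg]
    intro h
    exact hl (Int.eq_zero_of_abs_lt_dvd h hlN)
  -- Translation by `h` moves each node to the next; the surplus node `x_N = b` is sent back to `x_0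
  -- = a` by periodicity.
  shift g _ hp := by
    rw [integral_avgGrid, integral_avgGrid]
    simp_rw [← gridPt_succ]
    congr 1
    have h := Finset.sum_range_succ (fun j => g (gridPt a b N j)) N
    rw [Finset.sum_range_succ', gridPt_self a b hN, hp a] at h
    have : gridPt a b N 0 = a := by simp [gridPt]
    rw [this] at h
    exact add_right_cancel h

lemma isAveraging_avgVol (hab : a < b) (N : ℕ) : IsAveraging a b N (avgVol a b) where
  prob := avgVol_prob hab
  orth l hl _ := by
    rw [integral_avgVol hab]
    have hf : freq a b l ≠ 0 := by
      unfold freq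
      have := (sub_pos.2 hab).ne'
      have := Real.pi_ne_zero
      positivity
    have hc : (Complex.I * freq a b l : ℂ) ≠ 0 :=
      mul_ne_zero Complex.I_ne_zero (by exact_mod_cast hf)
    have : ∫ x in a..b, Complex.I * freq a b l * mode a b l x = mode a b l b - mode a b l a :=
      intervalIntegral.integral_eq_sub_of_hasDerivAt (fun x _ => hasDerivAt_mode a b l x)
        ((continuous_const.mul (continuous_mode a b l)).intervalIntegrable _ _)
    rw [intervalIntegral.integral_const_mul] at this
    have hp := mode_periodic hab l a
    rw [add_sub_cancel] at hp
    rw [hp, sub_self] at this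
    rw [(mul_eq_zero.1 this).resolve_left hc, mul_zero]
  shift g _ hp := by
    rw [integral_avgVol hab, integral_avgVol hab,
      intervalIntegral.integral_comp_add_right (fun x => g x)]
    have := hp.intervalIntegral_add_eq (a + mesh a b N) a
    rw [add_sub_cancel, show a + mesh a b N + (b - a) = b + mesh a b N by ring] at this
    rw [this]

end GPE

/-! ### Bessel's inequality, trigonometric polynomials, increments and Fourier series. -/

namespace GPE

variable {a b : ℝ} {N : ℕ} {ν : Measure ℝ}

/-- Makes the modes orthonormal for every averaging measure: the product of one mode with the
conjugate of another has frequency in the range where `IsAveraging.orth` applies. -/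
lemma abs_sub_lt_of_mem_modes {l m : ℤ} (hl : l ∈ modes N) (hm : m ∈ modes N) : |l - m| < N := by
  unfold modes at hl hm
  rw [Finset.mem_Ico] at hl hm
  rw [abs_lt]
  omega

lemma memLp_mul_mode {g : ℝ → ℂ} {p : ENNReal} (hg : MemLp g p ν) (l : ℤ) :
    MemLp (fun x => g x * mode a b l x) p ν := by
  refine hg.of_le (hg.1.mul (continuous_mode a b l).aestronglyMeasurable) ?_
  exact Eventually.of_forall fun x => by simp

lemma integrable_mul_mode [IsFiniteMeasure ν] {g : ℝ → ℂ} (hg : MemLp g 2 ν) (l : ℤ) :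
    Integrable (fun x => g x * mode a b l x) ν :=
  (memLp_mul_mode hg l).integrable (by norm_num)

lemma coef_add [IsFiniteMeasure ν] {g k : ℝ → ℂ} (hg : MemLp g 2 ν) (hk : MemLp k 2 ν) (l : ℤ) :
    coef a b ν (fun x => g x + k x) l = coef a b ν g l + coef a b ν k l := by
  unfold coef
  rw [← integral_add (integrable_mul_mode hg _) (integrable_mul_mode hk _)]
  simp_rw [add_mul]

lemma coef_sub [IsFiniteMeasure ν] {g k : ℝ → ℂ} (hg : MemLp g 2 ν) (hk : MemLp k 2 ν) (l : ℤ) :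
    coef a b ν (fun x => g x - k x) l = coef a b ν g l - coef a b ν k l := by
  unfold coef
  rw [← integral_sub (integrable_mul_mode hg _) (integrable_mul_mode hk _)]
  simp_rw [sub_mul]

lemma coef_const_mul (κ : ℂ) (g : ℝ → ℂ) (l : ℤ) :
    coef a b ν (fun x => κ * g x) l = κ * coef a b ν g l := by
  unfold coef
  rw [← integral_const_mul]
  simp_rw [mul_assoc]

lemma coef_congr_ae {g k : ℝ → ℂ} (h : g =ᵐ[ν] k) (l : ℤ) : coef a b ν g l = coef a b ν k l :=
  integral_congr_ae (h.mono fun x hx => by simp only [hx])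

/-- The trigonometric polynomial with coefficients `d` on `S`. -/
noncomputable def trig (a b : ℝ) (S : Finset ℤ) (d : ℤ → ℂ) (x : ℝ) : ℂ :=
  ∑ l ∈ S, d l * mode a b l x

lemma continuous_trig (a b : ℝ) (S : Finset ℤ) (d : ℤ → ℂ) : Continuous (trig a b S d) :=
  continuous_finsetSum _ fun l _ => continuous_const.mul (continuous_mode a b l)

lemma periodic_trig (hab : a < b) (S : Finset ℤ) (d : ℤ → ℂ) :
    Function.Periodic (trig a b S d) (b - a) := fun x =>
  Finset.sum_congr rfl fun l _ => by rw [mode_periodic hab l x]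

lemma norm_trig_le (S : Finset ℤ) (d : ℤ → ℂ) (x : ℝ) : ‖trig a b S d x‖ ≤ ∑ l ∈ S, ‖d l‖ :=
  (norm_sum_le _ _).trans (Finset.sum_le_sum fun l _ => by simp)

lemma interp_eq_trig (v : Fin (N + 1) → ℂ) :
    interp a b N v = trig a b (modes N) (discreteCoef a b N v) := rfl

lemma memLp_of_bound [IsFiniteMeasure ν] {g : ℝ → ℂ} (hg : AEStronglyMeasurable g ν) {C : ℝ}
    (h : ∀ x, ‖g x‖ ≤ C) : MemLp g 2 ν :=
  MemLp.of_bound hg C (Eventually.of_forall h)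

lemma memLp_trig [IsFiniteMeasure ν] (S : Finset ℤ) (d : ℤ → ℂ) : MemLp (trig a b S d) 2 ν :=
  memLp_of_bound (continuous_trig a b S d).aestronglyMeasurable (norm_trig_le S d)

lemma memLp_mode [IsFiniteMeasure ν] (l : ℤ) : MemLp (mode a b l) 2 ν :=
  memLp_of_bound (continuous_mode a b l).aestronglyMeasurable (fun x => (norm_mode a b l x).le)

lemma IsAveraging.integral_mode_sub (hν : IsAveraging a b N ν) {l m : ℤ} (h : |l - m| < N) :
    ∫ x, mode a b l x * mode a b (-m) x ∂ν = if l = m then 1 else 0 := by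
  have := hν.prob
  simp_rw [← mode_add]
  split_ifs with hlm
  · subst hlm; simp
  · exact hν.orth _ (by omega) (by rwa [← sub_eq_add_neg])

lemma IsAveraging.orthonormal (hν : IsAveraging a b N ν) :
    haveI := hν.prob
    Orthonormal ℂ (fun l : modes N => MemLp.toLp (mode a b l)
      (memLp_mode (a := a) (b := b) (ν := ν) (l : ℤ))) := by
  have := hν.prob
  rw [orthonormal_iff_ite]
  intro l m
  rw [L2.inner_def]
  have h := hν.integral_mode_sub (abs_sub_lt_of_mem_modes m.2 l.2)
  have e : (∫ x, inner ℂ (MemLp.toLp (mode a b l) (memLp_mode (a := a) (b := b) (ν := ν) (l : ℤ)) x)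
      (MemLp.toLp (mode a b m) (memLp_mode (a := a) (b := b) (ν := ν) (m : ℤ)) x) ∂ν) =
      ∫ x, mode a b m x * mode a b (-l) x ∂ν := by
    refine integral_congr_ae ?_
    filter_upwards [(memLp_mode (a := a) (b := b) (ν := ν) (l : ℤ)).coeFn_toLp,
      (memLp_mode (a := a) (b := b) (ν := ν) (m : ℤ)).coeFn_toLp] with x h1 h2
    rw [h1, h2, mode_neg]
    rfl
  rw [e, h]
  simp only [Subtype.ext_iff, eq_comm (a := (m : ℤ))]

/-- Bessel's inequality. -/
lemma IsAveraging.bessel (hν : IsAveraging a b N ν) {g : ℝ → ℂ} (hg : MemLp g 2 ν) :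
    sn (modes N) (coef a b ν g) ≤ l2 ν g := by
  have := hν.prob
  have h := hν.orthonormal.sum_inner_products_le (x := hg.toLp) (s := Finset.univ)
  rw [← l2_sq_eq_norm] at h
  refine Real.sqrt_le_iff.2 ⟨l2_nonneg _ _, le_trans (le_of_eq ?_) h⟩
  rw [← Finset.sum_coe_sort]
  refine Finset.sum_congr rfl fun l _ => ?_
  congr 2
  rw [L2.inner_def, coef]
  refine integral_congr_ae ?_
  filter_upwards [(memLp_mode (a := a) (b := b) (ν := ν) (l : ℤ)).coeFn_toLp,
      hg.coeFn_toLp] with x h1 h2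
  rw [h1, h2, mode_neg]
  rfl

lemma IsAveraging.coef_trig (hν : IsAveraging a b N ν) {S : Finset ℤ} (hS : S ⊆ modes N)
    (d : ℤ → ℂ) {l : ℤ} (hl : l ∈ modes N) :
    coef a b ν (trig a b S d) l = if l ∈ S then d l else 0 := by
  have := hν.prob
  unfold coef trig
  simp_rw [Finset.sum_mul, mul_assoc]
  rw [integral_finsetSum]
  · simp_rw [integral_const_mul]
    rw [Finset.sum_congr rfl fun m hm => by
      rw [hν.integral_mode_sub (abs_sub_lt_of_mem_modes (hS hm) hl)]]
    simp
  · intro m _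
    exact (integrable_mul_mode (memLp_mode m) _).const_mul _

/-- Expand only the conjugated factor of `|trig|²` and read off the coefficients of the other by
`coef_trig`. Since `ν` may be either average, the grid norm and the `L²` norm agree on these
polynomials. -/
lemma IsAveraging.l2_trig (hν : IsAveraging a b N ν) {S : Finset ℤ} (hS : S ⊆ modes N)
    (d : ℤ → ℂ) : l2 ν (trig a b S d) = sn S d := by
  have := hν.prob
  have key : (∫ x, trig a b S d x * star (trig a b S d x) ∂ν) = ∑ l ∈ S, d l * star (d l) := by
    have e : ∀ x, trig a b S d x * star (trig a b S d x) =
        ∑ l ∈ S, star (d l) * (trig a b S d x * mode a b (-l) x) := fun x => by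
      conv_lhs => enter [2]; rw [trig, star_sum]
      rw [Finset.mul_sum]
      refine Finset.sum_congr rfl fun l _ => ?_
      rw [mode_neg, star_mul']
      ring
    simp_rw [e]
    rw [integral_finsetSum]
    · refine Finset.sum_congr rfl fun l hl => ?_
      rw [integral_const_mul]
      have := hν.coef_trig hS d (hS hl)
      rw [coef, if_pos hl] at this
      rw [this, mul_comm]
    · intro l _
      exact (integrable_mul_mode (memLp_trig S d) _).const_mul _
  have e2 : ∀ z : ℂ, z * star z = ((‖z‖ ^ 2 : ℝ) : ℂ) := fun z => by
    rw [Complex.star_def, Complex.mul_conj']; push_cast; rfl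
  simp_rw [e2] at key
  rw [integral_complex_ofReal, ← Complex.ofReal_sum] at key
  have key' := Complex.ofReal_injective key
  rw [← l2_sq (memLp_trig S d), ← sn_sq] at key'
  exact (pow_left_inj₀ (l2_nonneg _ _) (sn_nonneg _ _) two_ne_zero).1 key'

/-! ## Shifts -/

/-- Jordan's inequality for `|e^{iθ} - 1| = 2 |sin (θ/2)|`. It serves twice: in space with `θ = μh`,
in time with `θ = -τμ²`. -/
lemma norm_exp_sub_one_ge {θ : ℝ} (h : |θ| ≤ Real.pi) :
    2 / Real.pi * |θ| ≤ ‖Complex.exp (Complex.I * (θ : ℂ)) - 1‖ := by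
  rw [Complex.norm_exp_I_mul_ofReal_sub_one, norm_mul, Real.norm_eq_abs, Real.norm_eq_abs, abs_two]
  have := Real.mul_abs_le_abs_sin (x := θ / 2) (by rw [abs_div, abs_two]; linarith)
  rw [abs_div, abs_two] at this
  linarith

lemma abs_freq_mul_mesh_le (hab : a < b) {l : ℤ} (hl : l ∈ modes N) :
    |freq a b l * mesh a b N| ≤ Real.pi := by
  have h := (sub_pos.2 hab).ne'
  unfold modes at hl
  rw [Finset.mem_Ico] at hl
  rcases Nat.eq_zero_or_pos N with rfl | hN
  · simp at hl; omega
  have hN' : (0 : ℝ) < N := by exact_mod_cast hN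
  have e : freq a b l * mesh a b N = Real.pi * (2 * l / N) := by
    unfold freq mesh; field_simp
  have h2 : |2 * l| ≤ (N : ℤ) := by rw [abs_le]; omega
  have h3 : |(2 * l : ℝ)| ≤ N := by exact_mod_cast h2
  rw [e, abs_mul, abs_of_pos Real.pi_pos, abs_div, Nat.abs_cast]
  exact mul_le_of_le_one_right Real.pi_pos.le ((div_le_one hN').2 h3)

/-- The increment `g(x + h) - g(x)`. -/
def incr (h : ℝ) (g : ℝ → ℂ) (x : ℝ) : ℂ := g (x + h) - g x

lemma continuous_incr {g : ℝ → ℂ} (hg : Continuous g) (h : ℝ) : Continuous (incr h g) := by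
  unfold incr; fun_prop

lemma periodic_bound (hab : a < b) {g : ℝ → ℂ} (hg : Continuous g)
    (hp : Function.Periodic g (b - a)) : ∃ C, ∀ x, ‖g x‖ ≤ C := by
  obtain ⟨C, hC⟩ := (isCompact_Icc (a := a) (b := a + (b - a))).exists_bound_of_continuousOn
    hg.continuousOn
  refine ⟨C, fun x => ?_⟩
  obtain ⟨y, hy, hxy⟩ := hp.exists_mem_Ico (sub_pos.2 hab) x a
  rw [hxy]
  exact hC y (Ico_subset_Icc_self hy)

lemma memLp_periodic [IsFiniteMeasure ν] (hab : a < b) {g : ℝ → ℂ} (hg : Continuous g)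
    (hp : Function.Periodic g (b - a)) : MemLp g 2 ν :=
  let ⟨_, hC⟩ := periodic_bound hab hg hp
  memLp_of_bound hg.aestronglyMeasurable hC

lemma periodic_incr {g : ℝ → ℂ} {p h : ℝ} (hp : Function.Periodic g p) :
    Function.Periodic (incr h g) p := fun x => by
  unfold incr
  rw [hp x, show x + p + h = x + h + p by ring, hp]

/-- Translation invariance of the average makes the increment a Fourier multiplier, for grid
coefficients as for true ones. -/
lemma IsAveraging.coef_incr (hν : IsAveraging a b N ν) (hab : a < b) {g : ℝ → ℂ}
    (hg : Continuous g) (hp : Function.Periodic g (b - a)) (l : ℤ) :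
    coef a b ν (incr (mesh a b N) g) l =
      (Complex.exp (Complex.I * ((freq a b l * mesh a b N : ℝ) : ℂ)) - 1) * coef a b ν g l := by
  have := hν.prob
  have hp' : Function.Periodic (fun x => g (x + mesh a b N)) (b - a) := fun x => by
    simp only; rw [add_right_comm, hp]
  unfold incr
  rw [coef_sub (memLp_periodic hab (by fun_prop) hp') (memLp_periodic hab hg hp),
    sub_mul, one_mul]
  congr 1
  have h := hν.shift (fun x => g x * mode a b (-l) x) (hg.mul (continuous_mode a b _))
    (hp.mul (mode_periodic hab _))
  unfold coef
  rw [← h, ← integral_const_mul]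
  refine integral_congr_ae (Eventually.of_forall fun x => ?_)
  simp only
  rw [mode_shift, freq_neg]
  have e : Complex.exp (Complex.I * ((freq a b l * mesh a b N : ℝ) : ℂ)) *
      Complex.exp (Complex.I * ((-freq a b l * mesh a b N : ℝ) : ℂ)) = 1 := by
    rw [← Complex.exp_add, Complex.exp_eq_one_iff]
    exact ⟨0, by push_cast; ring⟩
  linear_combination (-(g (x + mesh a b N) * mode a b (-l) x)) * e

/-- The derivative of the projection to the modes `|l| ≤ N / 2` is controlled by increments. -/
lemma IsAveraging.sn_freq_coef_le (hν : IsAveraging a b N ν) (hab : a < b) (hN : 0 < N) {g : ℝ → ℂ}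
    (hg : Continuous g) (hp : Function.Periodic g (b - a)) :
    sn (modes N) (fun l => freq a b l * coef a b ν g l) ≤
      2 / mesh a b N * l2 ν (incr (mesh a b N) g) := by
  have := hν.prob
  have hh := mesh_pos hab hN
  refine le_trans ?_ (mul_le_mul_of_nonneg_left (hν.bessel (memLp_periodic hab
    (continuous_incr hg _) (periodic_incr hp))) (by positivity))
  refine sn_mono (by positivity) fun l hl => ?_
  rw [hν.coef_incr hab hg hp, norm_mul, norm_mul, ← mul_assoc]
  refine mul_le_mul_of_nonneg_right ?_ (norm_nonneg _)
  have h1 := norm_exp_sub_one_ge (abs_freq_mul_mesh_le hab hl)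
  rw [Complex.norm_real, Real.norm_eq_abs]
  rw [abs_mul, abs_of_pos hh] at h1
  rw [div_mul_eq_mul_div, le_div_iff₀ hh]
  -- The factor `π/2` of Jordan's inequality is rounded up to `2`, using `π ≤ 4`.
  have h2 : 1 / 2 * (|freq a b l| * mesh a b N) ≤ 2 / Real.pi * (|freq a b l| * mesh a b N) := by
    refine mul_le_mul_of_nonneg_right ?_ (by positivity)
    rw [div_le_div_iff₀ (by norm_num) Real.pi_pos]
    linarith [Real.pi_le_four]
  linarith

/-! ## Fourier series -/

/-- **Parseval's identity** on `(a, b)`. -/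
lemma parseval (hab : a < b) {g : ℝ → ℂ} (hg : MemLp g 2 (vol a b)) :
    HasSum (fun l => ‖coef a b (avgVol a b) g l‖ ^ 2) (l2 (avgVol a b) g ^ 2) := by
  have hg' : MemLp g 2 (volume.restrict (Ioc a b)) := by
    rwa [← restrict_Ioo_eq_restrict_Ioc]
  have h := hasSum_sq_fourierCoeffOn hab hg'
  convert h using 1
  · funext l
    have hL : (b : ℂ) - a ≠ 0 := by exact_mod_cast (sub_pos.2 hab).ne'
    -- The modes are centred at `a`, the characters of the circle at `0`; they differ by a constant
    -- of modulus one, invisible in `|coef|²`.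
    have hm : ∀ x : ℝ, g x * mode a b (-l) x = mode a b (-l) 0 *
        (fourier (-l) (x : AddCircle (b - a)) • g x) := fun x => by
      rw [fourier_coe_apply, mode, mode, smul_eq_mul, ← mul_assoc, ← Complex.exp_add, mul_comm]
      congr 2
      unfold freq
      push_cast
      field_simp
      ring
    rw [← fourierCoef_eq_coef hab, fourierCoef, fourierCoeffOn_eq_integral]
    simp_rw [exp_neg_freq_eq_mode, hm]
    rw [intervalIntegral.integral_const_mul, norm_mul, norm_mul, norm_smul, norm_mode, norm_inv,
      Complex.norm_real, one_mul, one_div, norm_inv]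
  · rw [l2_sq (memLp_avgVol hab hg), avgVol, integral_smul_measure,
      intervalIntegral.integral_of_le hab.le, ← integral_Ioc_eq_integral_Ioo, ENNReal.toReal_inv,
      ENNReal.toReal_ofReal (sub_pos.2 hab).le]

/-- The Fourier series with coefficients `d`. -/
noncomputable def syn (a b : ℝ) (d : ℤ → ℂ) (x : ℝ) : ℂ := ∑' l, d l * mode a b l x

variable {d e : ℤ → ℂ}

lemma summable_syn (hd : Summable fun l => ‖d l‖) (x : ℝ) :
    Summable fun l => d l * mode a b l x :=
  Summable.of_norm (by simpa using hd)

lemma norm_syn_le (hd : Summable fun l => ‖d l‖) (x : ℝ) : ‖syn a b d x‖ ≤ ∑' l, ‖d l‖ := by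
  refine (norm_tsum_le_tsum_norm (by simpa using hd)).trans (le_of_eq ?_)
  simp

lemma continuous_syn (hd : Summable fun l => ‖d l‖) : Continuous (syn a b d) :=
  continuous_tsum (fun l => continuous_const.mul (continuous_mode a b l)) hd fun l x => by simp

lemma periodic_syn (hab : a < b) (d : ℤ → ℂ) : Function.Periodic (syn a b d) (b - a) := fun x => by
  unfold syn
  simp_rw [mode_periodic hab _ x]

lemma memLp_syn [IsFiniteMeasure ν] (hd : Summable fun l => ‖d l‖) : MemLp (syn a b d) 2 ν :=
  memLp_of_bound (continuous_syn hd).aestronglyMeasurable (norm_syn_le hd)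

lemma syn_sub (hd : Summable fun l => ‖d l‖) (he : Summable fun l => ‖e l‖) (x : ℝ) :
    syn a b (fun l => d l - e l) x = syn a b d x - syn a b e x := by
  unfold syn
  rw [← (summable_syn hd x).tsum_sub (summable_syn he x)]
  simp_rw [sub_mul]

lemma syn_incr (hd : Summable fun l => ‖d l‖) (h x : ℝ) :
    incr h (syn a b d) x =
      syn a b (fun l => (Complex.exp (Complex.I * ((freq a b l * h : ℝ) : ℂ)) - 1) * d l) x := by
  unfold incr syn
  rw [← (summable_syn hd _).tsum_sub (summable_syn hd x)]
  congr 1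
  funext l
  rw [mode_shift]
  ring

lemma trig_eq_syn (S : Finset ℤ) (d : ℤ → ℂ) (x : ℝ) :
    trig a b S d x = syn a b (fun l => if l ∈ S then d l else 0) x := by
  unfold trig syn
  rw [tsum_eq_sum (s := S) (fun l hl => by simp [hl])]
  exact Finset.sum_congr rfl fun l hl => by simp [hl]

lemma summable_ite_mem (S : Finset ℤ) (d : ℤ → ℂ) :
    Summable fun l => ‖if l ∈ S then d l else 0‖ :=
  summable_of_ne_finset_zero (s := S) fun l hl => by simp [hl]

lemma syn_sub_trig (hd : Summable fun l => ‖d l‖) (S : Finset ℤ) (x : ℝ) :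
    syn a b d x - trig a b S d x = syn a b (fun l => if l ∈ S then 0 else d l) x := by
  rw [trig_eq_syn, ← syn_sub hd (summable_ite_mem S d)]
  unfold syn
  congr 1; funext l
  dsimp only
  split_ifs <;> simp

lemma coef_syn (hab : a < b) (hd : Summable fun l => ‖d l‖) (l : ℤ) :
    coef a b (avgVol a b) (syn a b d) l = d l := by
  have := avgVol_prob hab
  unfold coef syn
  simp_rw [← tsum_mul_right]
  have hi : ∀ m : ℤ, Integrable (fun x => d m * mode a b m x * mode a b (-l) x) (avgVol a b) :=
    fun m => by
      simp_rw [mul_assoc]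
      exact (integrable_mul_mode (memLp_mode m) _).const_mul _
  have h := hasSum_integral_of_summable_integral_norm (μ := avgVol a b)
    (F := fun (m : ℤ) x => d m * mode a b m x * mode a b (-l) x) hi (by simpa using hd)
  rw [← h.tsum_eq, tsum_eq_single l]
  · simp_rw [mul_assoc, ← mode_add]
    simp
  · intro m hm
    simp_rw [mul_assoc, ← mode_add]
    -- Lebesgue measure is averaging for every mesh parameter, so one exceeding `|m - l|` may be
    -- chosen.
    rw [integral_const_mul, (isAveraging_avgVol hab ((m + -l).natAbs + 1)).orth, mul_zero]
    · omega
    · push_cast; omega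

lemma l2_syn_sq (hab : a < b) (hd : Summable fun l => ‖d l‖) :
    HasSum (fun l => ‖d l‖ ^ 2) (l2 (avgVol a b) (syn a b d) ^ 2) := by
  have : IsFiniteMeasure (vol a b) := ⟨by simp [vol]⟩
  have h := parseval hab (memLp_syn (a := a) (b := b) hd)
  simp_rw [coef_syn hab hd] at h
  exact h

/-- All coefficients of the difference vanish, hence by Parseval so does its norm. -/
lemma ae_eq_syn (hab : a < b) {g : ℝ → ℂ} (hg : MemLp g 2 (vol a b))
    (hs : Summable fun l => ‖coef a b (avgVol a b) g l‖) :
    g =ᵐ[vol a b] syn a b (coef a b (avgVol a b) g) := by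
  have := avgVol_prob hab
  have : IsFiniteMeasure (vol a b) := ⟨by simp [vol]⟩
  have hm : MemLp (fun x => g x - syn a b (coef a b (avgVol a b) g) x) 2 (vol a b) :=
    hg.sub (memLp_syn hs)
  have h := parseval hab hm
  simp_rw [coef_sub (memLp_avgVol hab hg) (memLp_syn hs), coef_syn hab hs, sub_self] at h
  have h0 : l2 (avgVol a b) (fun x => g x - syn a b (coef a b (avgVol a b) g) x) = 0 := by
    have := h.unique (a₂ := 0) (by simp)
    exact pow_eq_zero_iff two_ne_zero |>.1 this
  have hm' := memLp_avgVol hab hm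
  rw [l2, ENNReal.toReal_eq_zero_iff, or_iff_left hm'.2.ne, eLpNorm_eq_zero_iff hm'.1 two_ne_zero]
    at h0
  have h1 := ae_avgVol_iff.1 h0
  filter_upwards [h1] with x hx
  exact sub_eq_zero.1 hx

end GPE

namespace GPE

/-! ## Error propagation for a filtered one-step recursion -/

/-- `∫_0^s e^{iσκ} dσ`. -/
noncomputable def osc (κ s : ℝ) : ℂ := ∫ σ in (0 : ℝ)..s, Complex.exp (Complex.I * ((σ * κ : ℝ) : ℂ))

lemma hasDerivAt_osc (κ s : ℝ) :
    HasDerivAt (osc κ) (Complex.exp (Complex.I * ((s * κ : ℝ) : ℂ))) s := by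
  have hc : Continuous fun σ : ℝ => Complex.exp (Complex.I * ((σ * κ : ℝ) : ℂ)) := by fun_prop
  exact intervalIntegral.integral_hasDerivAt_right (hc.intervalIntegrable _ _)
    hc.aestronglyMeasurable.stronglyMeasurableAtFilter hc.continuousAt

@[simp] lemma osc_zero (κ : ℝ) : osc κ 0 = 0 := by simp [osc]

lemma norm_osc_sub_le {κ τ : ℝ} (hκ : 0 ≤ κ) (hτ : 0 ≤ τ) :
    ‖osc κ τ - τ‖ ≤ τ * κ * τ := by
  have hc : Continuous fun σ : ℝ => Complex.exp (Complex.I * ((σ * κ : ℝ) : ℂ)) := by fun_prop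
  have e : osc κ τ - τ = ∫ σ in (0 : ℝ)..τ, (Complex.exp (Complex.I * ((σ * κ : ℝ) : ℂ)) - 1) := by
    rw [intervalIntegral.integral_sub (hc.intervalIntegrable _ _) (by simp)]
    simp [osc]
  rw [e]
  have := intervalIntegral.norm_integral_le_of_norm_le_const (a := (0 : ℝ)) (b := τ) (C := τ * κ)
    (f := fun σ : ℝ => Complex.exp (Complex.I * ((σ * κ : ℝ) : ℂ)) - 1) (fun σ hσ => by
      rw [uIoc_of_le hτ] at hσ
      refine (Real.norm_exp_I_mul_ofReal_sub_one_le).trans ?_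
      rw [Real.norm_eq_abs, abs_of_nonneg (mul_nonneg hσ.1.le hκ)]
      exact mul_le_mul_of_nonneg_right hσ.2 hκ)
  rwa [sub_zero, abs_of_nonneg hτ] at this

/-- The numerator `osc κ τ - τ` is at most `τ²κ`, while `|1 - e^{-iτκ}| ≥ (2/π) τκ` because `τκ ≤
π`. The quotient is thus at most `(π/2) τ ≤ 2τ` uniformly in `κ`; this bounded quotient is what lets
the freezing error telescope. At `κ = 0` both sides vanish. -/
lemma exists_filter {κ τ : ℝ} (hκ : 0 ≤ κ) (hτ : 0 < τ) (h : τ * κ ≤ Real.pi) :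
    ∃ ρ : ℂ, ‖ρ‖ ≤ 2 * τ ∧ -Complex.I * (osc κ τ - τ) =
      (1 - Complex.exp (-Complex.I * ((τ * κ : ℝ) : ℂ))) * ρ := by
  rcases hκ.eq_or_lt with rfl | hκ
  · exact ⟨0, by simp [hτ.le], by simp [osc]⟩
  have hz : 2 / Real.pi * (τ * κ) ≤ ‖1 - Complex.exp (-Complex.I * ((τ * κ : ℝ) : ℂ))‖ := by
    have := norm_exp_sub_one_ge (θ := -(τ * κ)) (by rwa [abs_neg, abs_of_pos (by positivity)])
    rw [abs_neg, abs_of_pos (by positivity)] at this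
    rw [norm_sub_rev]
    rwa [show -Complex.I * ((τ * κ : ℝ) : ℂ) = Complex.I * ((-(τ * κ) : ℝ) : ℂ) by push_cast; ring]
  have hp : 0 < 2 / Real.pi * (τ * κ) := by have := Real.pi_pos; positivity
  have hz0 : 1 - Complex.exp (-Complex.I * ((τ * κ : ℝ) : ℂ)) ≠ 0 := norm_pos_iff.1 (hp.trans_le hz)
  refine ⟨-Complex.I * (osc κ τ - τ) / (1 - Complex.exp (-Complex.I * ((τ * κ : ℝ) : ℂ))), ?_, ?_⟩
  · rw [norm_div, div_le_iff₀ (hp.trans_le hz), norm_mul, norm_neg, Complex.norm_I, one_mul]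
    refine (norm_osc_sub_le hκ.le hτ.le).trans (le_trans ?_
      (mul_le_mul_of_nonneg_left hz (by positivity)))
    have h4 : 1 ≤ 4 / Real.pi := by rw [le_div_iff₀ Real.pi_pos]; linarith [Real.pi_le_four]
    have : 2 * τ * (2 / Real.pi * (τ * κ)) = 4 / Real.pi * (τ * κ * τ) := by ring
    rw [this]
    exact le_mul_of_one_le_left (by positivity) h4
  · rw [mul_div_cancel₀ _ hz0]

lemma discrete_gronwall {d : ℕ → ℝ} {Q τ η : ℝ} (hQ : 0 ≤ Q) (hτ : 0 ≤ τ) (hη : 0 ≤ η)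
    (n : ℕ) (h0 : 0 ≤ d 0) (h : ∀ k < n, d (k + 1) ≤ (1 + Q * τ) * d k + τ * η) :
    d n ≤ Real.exp (Q * (n * τ)) * (d 0 + n * τ * η) := by
  have h1 : 1 ≤ 1 + Q * τ := by nlinarith [mul_nonneg hQ hτ]
  have key : ∀ k ≤ n, d k ≤ (1 + Q * τ) ^ k * (d 0 + k * (τ * η)) := by
    intro k
    induction k with
    | zero => intro _; simp
    | succ k ih =>
      intro hk
      refine (h k hk).trans ?_
      have := mul_le_mul_of_nonneg_left (ih (Nat.le_of_succ_le hk)) (zero_le_one.trans h1)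
      have hp : 1 ≤ (1 + Q * τ) ^ (k + 1) := one_le_pow₀ h1
      have h3 : τ * η ≤ (1 + Q * τ) ^ (k + 1) * (τ * η) :=
        le_mul_of_one_le_left (mul_nonneg hτ hη) hp
      push_cast
      rw [pow_succ] at h3 ⊢
      nlinarith
  refine (key n le_rfl).trans ?_
  rw [← mul_assoc]
  refine mul_le_mul_of_nonneg_right ?_ (by positivity)
  have := Real.add_one_le_exp (Q * τ)
  rw [add_comm] at this
  calc (1 + Q * τ) ^ n ≤ Real.exp (Q * τ) ^ n := pow_le_pow_left₀ (by linarith) this n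
    _ = Real.exp (Q * (n * τ)) := by rw [← Real.exp_nat_mul]; congr 1; ring

/-- Stability of the recursion `E' = e^{-iτκ} (E + m F + R)`, where the local error `m F`,
`m = -i (∫_0^τ e^{iσκ} dσ - τ)`, is not small but oscillates over the time steps. -/
lemma sn_recursion_le {S : Finset ℤ} {κ : ℤ → ℝ} {τ : ℝ} (hτ : 0 < τ) (hκ : ∀ l, 0 ≤ κ l)
    (hκπ : ∀ l ∈ S, τ * κ l ≤ Real.pi) {E F R : ℕ → ℤ → ℂ} {n : ℕ} {M K Q δ : ℝ}
    (hM : 0 ≤ M) (hK : 0 ≤ K) (hQ : 0 ≤ Q) (hδ : 0 ≤ δ)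
    (hrec : ∀ k < n, ∀ l ∈ S, E (k + 1) l = Complex.exp (-Complex.I * ((τ * κ l : ℝ) : ℂ)) *
      (E k l + -Complex.I * (osc (κ l) τ - τ) * F k l + R k l))
    (hF : ∀ k ≤ n, sn S (F k) ≤ M)
    (hdF : ∀ k < n, sn S (fun l => F (k + 1) l - F k l) ≤ K * τ)
    (hR : ∀ k < n, sn S (R k) ≤ τ * (δ + Q * sn S (E k))) :
    sn S (E n) ≤ Real.exp (Q * (n * τ)) *
      (sn S (E 0) + 2 * τ * M + n * τ * (δ + 2 * Q * τ * M + 2 * τ * K)) + 2 * τ * M := by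
  have hρ : ∀ l, ∃ ρ : ℂ, l ∈ S → ‖ρ‖ ≤ 2 * τ ∧ -Complex.I * (osc (κ l) τ - τ) =
      (1 - Complex.exp (-Complex.I * ((τ * κ l : ℝ) : ℂ))) * ρ := fun l => by
    by_cases hl : l ∈ S
    · obtain ⟨ρ, h⟩ := exists_filter (hκ l) hτ (hκπ l hl)
      exact ⟨ρ, fun _ => h⟩
    · exact ⟨0, fun h => absurd h hl⟩
  choose ρ hρ using hρ
  set z : ℤ → ℂ := fun l => Complex.exp (-Complex.I * ((τ * κ l : ℝ) : ℂ)) with hz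
  have hz1 : ∀ l, ‖z l‖ = 1 := fun l => by
    have : -Complex.I * ((τ * κ l : ℝ) : ℂ) = ((-(τ * κ l) : ℝ) : ℂ) * Complex.I := by
      push_cast; ring
    rw [hz]; simp only; rw [this]; exact Complex.norm_exp_ofReal_mul_I _
  have hB : ∀ c : ℤ → ℂ, sn S (fun l => z l * ρ l * c l) ≤ 2 * τ * sn S c := fun c =>
    sn_mono (by positivity) fun l hl => by
      rw [norm_mul, norm_mul, hz1, one_mul]
      exact mul_le_mul_of_nonneg_right (hρ l hl).1 (norm_nonneg _)
  -- Summation by parts in the form of a change of unknown: subtracting `zρF`, itself `O(τ)`,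
  -- absorbs the oscillating source.
  let D : ℕ → ℤ → ℂ := fun k l => E k l - z l * ρ l * F k l
  have hDE : ∀ k ≤ n, sn S (E k) ≤ sn S (D k) + 2 * τ * M := fun k hk => by
    have h1 := sn_add_le S (D k) (fun l => z l * ρ l * F k l)
    have h2 : sn S (E k) = sn S (fun l => D k l + z l * ρ l * F k l) :=
      sn_congr fun l _ => by simp [D]
    rw [h2]
    have h3 := mul_le_mul_of_nonneg_left (hF k hk) (by positivity : 0 ≤ 2 * τ)
    linarith [hB (F k)]
  have hstep : ∀ k < n, sn S (D (k + 1)) ≤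
      (1 + Q * τ) * sn S (D k) + τ * (δ + 2 * Q * τ * M + 2 * τ * K) := fun k hk => by
    -- Since `z(E + (1 - z)ρF + R) - zρF' = z(E - zρF) + zR - zρ(F' - F)`, only the increment of `F`
    -- survives; with the factor `ρ` it is `O(τ²)`.
    have e : sn S (D (k + 1)) = sn S (fun l => (z l * D k l + z l * R k l) -
        z l * ρ l * (F (k + 1) l - F k l)) := sn_congr fun l hl => by
      simp only [D]
      rw [hrec k hk l hl, (hρ l hl).2]
      simp only [hz]
      ring
    have e1 : sn S (fun l => z l * D k l) = sn S (D k) := sn_congr_norm fun l _ => by simp [hz1]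
    have e2 : sn S (fun l => z l * R k l) = sn S (R k) := sn_congr_norm fun l _ => by simp [hz1]
    have h1 := sn_sub_le S (fun l => z l * D k l + z l * R k l)
      (fun l => z l * ρ l * (F (k + 1) l - F k l))
    have h2 := sn_add_le S (fun l => z l * D k l) (fun l => z l * R k l)
    have h3 := (hB (fun l => F (k + 1) l - F k l)).trans
      (mul_le_mul_of_nonneg_left (hdF k hk) (by positivity))
    have h4 := (hR k hk).trans (mul_le_mul_of_nonneg_left (add_le_add_right
      (mul_le_mul_of_nonneg_left (hDE k hk.le) hQ) δ) hτ.le)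
    rw [e1, e2] at h2
    rw [e]
    nlinarith
  have hD0 : sn S (D 0) ≤ sn S (E 0) + 2 * τ * M := by
    have h1 := sn_sub_le S (E 0) (fun l => z l * ρ l * F 0 l)
    have h3 := mul_le_mul_of_nonneg_left (hF 0 (Nat.zero_le _)) (by positivity : 0 ≤ 2 * τ)
    linarith [hB (F 0)]
  have hg := discrete_gronwall (d := fun k => sn S (D k)) hQ hτ.le
    (by positivity : 0 ≤ δ + 2 * Q * τ * M + 2 * τ * K) n (sn_nonneg S (D 0)) hstep
  refine (hDE n le_rfl).trans (add_le_add_left (hg.trans ?_) _)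
  exact mul_le_mul_of_nonneg_left (by linarith) (Real.exp_pos _).le

/-- The mean value inequality in `ℓ²(S)` as one normed space, so that no factor depending on the
number of modes appears. -/
lemma sn_image_sub_le {S : Finset ℤ} {y y' : ℝ → ℤ → ℂ} {τ C : ℝ} (hτ : 0 ≤ τ)
    (hy : ∀ s ∈ Icc 0 τ, ∀ l, HasDerivWithinAt (fun s => y s l) (y' s l) (Icc 0 τ) s)
    (hb : ∀ s ∈ Icc 0 τ, sn S (y' s) ≤ C) : sn S (fun l => y τ l - y 0 l) ≤ C * τ := by
  let Y : ℝ → EuclideanSpace ℂ S := fun s => WithLp.toLp 2 fun l : S => y s l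
  have hY : ∀ s ∈ Icc 0 τ, HasDerivWithinAt Y (WithLp.toLp 2 fun l : S => y' s l) (Icc 0 τ) s :=
    fun s hs => by
      have h : HasDerivWithinAt (fun s => fun l : S => y s l) (fun l : S => y' s l) (Icc 0 τ) s :=
        hasDerivWithinAt_pi.2 fun l => hy s hs l
      exact ((PiLp.continuousLinearEquiv 2 ℝ (fun _ : S => ℂ)).symm :
        (S → ℂ) →L[ℝ] EuclideanSpace ℂ S).hasFDerivAt.comp_hasDerivWithinAt s h
  have h := norm_image_sub_le_of_norm_deriv_le_segment' hY (fun s hs => by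
    rw [← sn_eq_norm]
    exact hb s (Ico_subset_Icc_self hs)) τ (right_mem_Icc.2 hτ)
  rw [sub_zero] at h
  rw [sn_eq_norm]
  exact h

/-- Local consistency of the exact flow in Fourier space. -/
lemma sn_duhamel_le {S : Finset ℤ} {κ : ℤ → ℝ} {wt : ℤ → ℂ} {c F : ℝ → ℤ → ℂ} {t τ T K : ℝ}
    (ht : 0 ≤ t) (hτ : 0 ≤ τ) (htT : t + τ ≤ T) (hK : 0 ≤ K)
    (hc : ∀ s ∈ Icc 0 T, ∀ l, HasDerivWithinAt (fun s => c s l)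
      (-Complex.I * (κ l * c s l + F s l)) (Icc 0 T) s)
    (hF : ∀ s ∈ Icc 0 τ, sn S (fun l => wt l * (F (t + s) l - F t l)) ≤ K * s) :
    sn S (fun l => wt l * (Complex.exp (Complex.I * ((τ * κ l : ℝ) : ℂ)) * c (t + τ) l - c t l +
      Complex.I * osc (κ l) τ * F t l)) ≤ K * τ ^ 2 := by
  -- The quantity to be estimated, with `τ` replaced by a running time `s`. The integrating factor
  -- removes `κc` from its derivative and `osc` removes the frozen force, so only `F (t + s) - F t`
  -- remains.
  let y : ℝ → ℤ → ℂ := fun s l =>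
    wt l * (Complex.exp (Complex.I * ((s * κ l : ℝ) : ℂ)) * c (t + s) l +
      Complex.I * osc (κ l) s * F t l)
  let y' : ℝ → ℤ → ℂ := fun s l =>
    -Complex.I * Complex.exp (Complex.I * ((s * κ l : ℝ) : ℂ)) * (wt l * (F (t + s) l - F t l))
  have hy : ∀ s ∈ Icc 0 τ, ∀ l, HasDerivWithinAt (fun s => y s l) (y' s l) (Icc 0 τ) s :=
      fun s hs l => by
    have hmaps : MapsTo (fun s => t + s) (Icc 0 τ) (Icc 0 T) := fun x hx => by
      constructor <;> linarith [hx.1, hx.2]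
    have h1 : HasDerivWithinAt (fun s => c (t + s) l)
        (-Complex.I * (κ l * c (t + s) l + F (t + s) l)) (Icc 0 τ) s := by
      have := HasDerivWithinAt.scomp s (hc (t + s) (hmaps hs) l)
        ((hasDerivAt_id s).const_add t).hasDerivWithinAt hmaps
      simpa [Function.comp_def] using this
    have h2 : HasDerivAt (fun s : ℝ => Complex.exp (Complex.I * ((s * κ l : ℝ) : ℂ)))
        (Complex.exp (Complex.I * ((s * κ l : ℝ) : ℂ)) * (Complex.I * ((1 * κ l : ℝ) : ℂ))) s :=
      (((hasDerivAt_id s).mul_const (κ l)).ofReal_comp.const_mul Complex.I).cexp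
    have h3 := ((h2.hasDerivWithinAt.mul h1).add
      (((hasDerivAt_osc (κ l) s).const_mul Complex.I).mul_const (F t l)).hasDerivWithinAt).const_mul
        (wt l)
    refine h3.congr_deriv ?_
    simp only [y']
    push_cast
    ring
  have hb : ∀ s ∈ Icc 0 τ, sn S (y' s) ≤ K * τ := fun s hs => by
    have e : sn S (y' s) = sn S (fun l => wt l * (F (t + s) l - F t l)) := by
      refine sn_congr_norm fun l _ => ?_
      rw [norm_mul, norm_mul, mul_comm Complex.I, Complex.norm_exp_ofReal_mul_I]
      simp
    rw [e]
    exact (hF s hs).trans (mul_le_mul_of_nonneg_left hs.2 hK)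
  have h := sn_image_sub_le hτ hy hb
  have e : sn S (fun l => y τ l - y 0 l) = sn S (fun l => wt l *
      (Complex.exp (Complex.I * ((τ * κ l : ℝ) : ℂ)) *
      c (t + τ) l - c t l + Complex.I * osc (κ l) τ * F t l)) := by
    refine sn_congr fun l _ => ?_
    simp only [y, zero_mul, Complex.ofReal_zero, mul_zero, Complex.exp_zero, add_zero, osc_zero,
      one_mul]
    ring
  rw [e] at h
  calc _ ≤ _ := h
    _ = K * τ ^ 2 := by ring

end GPE

namespace GPE

/-! ## Pointwise estimates for the nonlinearity -/

/-- The cubic nonlinearity `|z|² z`. -/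
noncomputable def cub (z : ℂ) : ℂ := ((‖z‖ ^ 2 : ℝ) : ℂ) * z

lemma cub_eq (z : ℂ) : cub z = z * star z * z := by
  rw [cub, Complex.star_def, Complex.mul_conj']; push_cast; rfl

lemma continuous_cub : Continuous cub := by unfold cub; fun_prop

lemma norm_cub (z : ℂ) : ‖cub z‖ = ‖z‖ ^ 3 := by
  rw [cub, norm_mul, Complex.norm_real, Real.norm_eq_abs, abs_of_nonneg (sq_nonneg _)]; ring

lemma norm_mul_mul_le {x y z : ℂ} {A B C : ℝ} (hx : ‖x‖ ≤ A) (hy : ‖y‖ ≤ B) (hz : ‖z‖ ≤ C) :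
    ‖x * y * z‖ ≤ A * B * C := by
  have hA := (norm_nonneg x).trans hx
  have hB := (norm_nonneg y).trans hy
  rw [norm_mul, norm_mul]
  gcongr

lemma norm_cub_sub_le {y z : ℂ} {M : ℝ} (hy : ‖y‖ ≤ M) (hz : ‖z‖ ≤ M) :
    ‖cub y - cub z‖ ≤ 3 * M ^ 2 * ‖y - z‖ := by
  have e : cub y - cub z = (y - z) * star y * y + z * star (y - z) * y + z * star z * (y - z) := by
    rw [cub_eq, cub_eq, star_sub]; ring
  have hy' : ‖star y‖ ≤ M := by rwa [norm_star]
  have hz' : ‖star z‖ ≤ M := by rwa [norm_star]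
  rw [e]
  refine (norm_add₃_le).trans ?_
  have h1 := norm_mul_mul_le (le_refl ‖y - z‖) hy' hy
  have h2 := norm_mul_mul_le hz (norm_star (y - z)).le hy
  have h3 := norm_mul_mul_le hz hz' (le_refl ‖y - z‖)
  linarith

/-- Increments of a difference of cubic terms. -/
lemma norm_incr_cub_sub_le {y z y' z' : ℂ} {M η : ℝ} (hy : ‖y‖ ≤ M) (hz : ‖z‖ ≤ M)
    (hy' : ‖y'‖ ≤ M) (hz' : ‖z'‖ ≤ M) (hη : ‖y - z‖ ≤ η) :
    ‖(cub y' - cub z') - (cub y - cub z)‖ ≤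
      3 * M ^ 2 * ‖(y' - z') - (y - z)‖ + 3 * M * η * (‖y' - y‖ + ‖z' - z‖) := by
  have s1 : ‖star y‖ ≤ M := by rwa [norm_star]
  have s3 : ‖star y'‖ ≤ M := by rwa [norm_star]
  have s4 : ‖star z'‖ ≤ M := by rwa [norm_star]
  have s5 : ‖star (y - z)‖ ≤ η := by rwa [norm_star]
  -- `cub y - cub z` is a sum of three trilinear terms, each with one factor `y - z` up to
  -- conjugation. The product rule for increments splits them into nine: three carry the increment
  -- of `y - z`, and three each the increments of `y` and of `z`.
  have e : (cub y' - cub z') - (cub y - cub z) =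
      ((((y' - z') - (y - z)) * star y' * y' + (y - z) * star (y' - y) * y' +
        (y - z) * star y * (y' - y)) +
      (z' * star ((y' - z') - (y - z)) * y' + (z' - z) * star (y - z) * y' +
        z * star (y - z) * (y' - y))) +
      (z' * star z' * ((y' - z') - (y - z)) + (z' - z) * star z' * (y - z) +
        z * star (z' - z) * (y - z)) := by
    simp only [cub_eq, star_sub]; ring
  rw [e]
  refine (norm_add₃_le).trans ?_
  refine (add_le_add_three (norm_add₃_le) (norm_add₃_le) (norm_add₃_le)).trans ?_
  set D := ‖(y' - z') - (y - z)‖ with hD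
  have h1 := norm_mul_mul_le hD.ge s3 hy'
  have h2 := norm_mul_mul_le hη (norm_star (y' - y)).le hy'
  have h3 := norm_mul_mul_le hη s1 (le_refl ‖y' - y‖)
  have h4 := norm_mul_mul_le hz' ((norm_star ((y' - z') - (y - z))).trans hD.symm).le hy'
  have h5 := norm_mul_mul_le (le_refl ‖z' - z‖) s5 hy'
  have h6 := norm_mul_mul_le hz s5 (le_refl ‖y' - y‖)
  have h7 := norm_mul_mul_le hz' s4 hD.ge
  have h8 := norm_mul_mul_le (le_refl ‖z' - z‖) s4 hη
  have h9 := norm_mul_mul_le hz (norm_star (z' - z)).le hη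
  linarith

/-- The second order remainder `e^{-iθ} - 1 + iθ`. -/
noncomputable def expRem (θ : ℝ) : ℂ := Complex.exp (-Complex.I * (θ : ℂ)) - 1 + Complex.I * θ

lemma continuous_expRem : Continuous expRem := by unfold expRem; fun_prop

lemma norm_exp_neg_I (θ : ℝ) : ‖Complex.exp (-Complex.I * (θ : ℂ))‖ = 1 := by
  rw [show -Complex.I * (θ : ℂ) = ((-θ : ℝ) : ℂ) * Complex.I by push_cast; ring]
  exact Complex.norm_exp_ofReal_mul_I _

lemma norm_exp_neg_I_sub_one_le (θ : ℝ) : ‖Complex.exp (-Complex.I * (θ : ℂ)) - 1‖ ≤ |θ| := by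
  rw [show -Complex.I * (θ : ℂ) = Complex.I * ((-θ : ℝ) : ℂ) by push_cast; ring]
  simpa using Real.norm_exp_I_mul_ofReal_sub_one_le (x := -θ)

lemma norm_exp_neg_I_sub_le (θ θ' : ℝ) :
    ‖Complex.exp (-Complex.I * (θ : ℂ)) - Complex.exp (-Complex.I * (θ' : ℂ))‖ ≤ |θ - θ'| := by
  have e : Complex.exp (-Complex.I * (θ : ℂ)) - Complex.exp (-Complex.I * (θ' : ℂ)) =
      Complex.exp (-Complex.I * (θ' : ℂ)) * (Complex.exp (-Complex.I * ((θ - θ' : ℝ) : ℂ)) - 1) := by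
    rw [mul_sub, ← Complex.exp_add, mul_one]
    congr 2
    push_cast; ring
  rw [e, norm_mul, norm_exp_neg_I, one_mul]
  exact norm_exp_neg_I_sub_one_le _

/-- The derivative of `expRem` is `-i (e^{-iθ} - 1)`, of modulus at most `|θ| ≤ m` on the segment.
-/
lemma norm_expRem_sub_le {θ θ' m : ℝ} (h : |θ| ≤ m) (h' : |θ'| ≤ m) :
    ‖expRem θ - expRem θ'‖ ≤ m * |θ - θ'| := by
  have hd : ∀ x ∈ Icc (-m) m, HasDerivWithinAt expRem
      (-Complex.I * (Complex.exp (-Complex.I * (x : ℂ)) - 1)) (Icc (-m) m) x := fun x _ => by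
    have h1 : HasDerivAt (fun x : ℝ => (x : ℂ)) 1 x := by
      simpa using (hasDerivAt_id x).ofReal_comp
    have h2 := (((h1.const_mul (-Complex.I)).cexp.sub_const 1).add (h1.const_mul Complex.I))
    refine (h2.congr_deriv ?_).hasDerivWithinAt
    ring
  have := Convex.norm_image_sub_le_of_norm_hasDerivWithin_le (C := m) hd (fun x hx => by
    rw [norm_mul, norm_neg, Complex.norm_I, one_mul]
    exact (norm_exp_neg_I_sub_one_le x).trans (abs_le.2 hx)) (convex_Icc _ _)
    (abs_le.1 h') (abs_le.1 h)
  simpa using this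

lemma norm_expRem_le {θ m : ℝ} (h : |θ| ≤ m) : ‖expRem θ‖ ≤ m ^ 2 := by
  have := norm_expRem_sub_le h (θ' := 0) (by simpa using (abs_nonneg θ).trans h)
  have h0 : expRem 0 = 0 := by simp [expRem]
  rw [h0, sub_zero, sub_zero] at this
  nlinarith [abs_nonneg θ]

/-- The exact flow of the cubic ODE. -/
noncomputable def cubFlow (τ β : ℝ) (z : ℂ) : ℂ :=
  z * Complex.exp (-Complex.I * ((τ * (β * ‖z‖ ^ 2) : ℝ) : ℂ))

lemma continuous_cubFlow (τ β : ℝ) : Continuous (cubFlow τ β) := by unfold cubFlow; fun_prop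

lemma norm_cubFlow (τ β : ℝ) (z : ℂ) : ‖cubFlow τ β z‖ = ‖z‖ := by
  rw [cubFlow, norm_mul, norm_exp_neg_I, mul_one]

section
variable {τ β M : ℝ} {y z : ℂ}

lemma abs_phase_le (hτ : 0 ≤ τ) (hz : ‖z‖ ≤ M) : |τ * (β * ‖z‖ ^ 2)| ≤ τ * |β| * M ^ 2 := by
  rw [abs_mul, abs_mul, abs_of_nonneg hτ, abs_of_nonneg (sq_nonneg ‖z‖), ← mul_assoc]
  have := pow_le_pow_left₀ (norm_nonneg z) hz 2
  gcongr

lemma abs_phase_sub_le (hτ : 0 ≤ τ) (hy : ‖y‖ ≤ M) (hz : ‖z‖ ≤ M) :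
    |τ * (β * ‖y‖ ^ 2) - τ * (β * ‖z‖ ^ 2)| ≤ 2 * τ * |β| * M * ‖y - z‖ := by
  have e : τ * (β * ‖y‖ ^ 2) - τ * (β * ‖z‖ ^ 2) = τ * β * ((‖y‖ + ‖z‖) * (‖y‖ - ‖z‖)) := by ring
  rw [e, abs_mul, abs_mul, abs_mul, abs_of_nonneg hτ,
    abs_of_nonneg (add_nonneg (norm_nonneg y) (norm_nonneg z))]
  have h1 := abs_norm_sub_norm_le y z
  have hM := (norm_nonneg z).trans hz
  calc τ * |β| * ((‖y‖ + ‖z‖) * |‖y‖ - ‖z‖|) ≤ τ * |β| * ((M + M) * ‖y - z‖) := by gcongr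
    _ = _ := by ring

lemma norm_cubFlow_sub_self_le (hτ : 0 ≤ τ) (hz : ‖z‖ ≤ M) :
    ‖cubFlow τ β z - z‖ ≤ τ * |β| * M ^ 2 * M := by
  have e : cubFlow τ β z - z = z * (Complex.exp (-Complex.I * ((τ * (β * ‖z‖ ^ 2) : ℝ) : ℂ)) - 1) := by
    unfold cubFlow; ring
  rw [e, norm_mul, mul_comm]
  have := (norm_exp_neg_I_sub_one_le _).trans (abs_phase_le (β := β) hτ hz)
  have h0 := (norm_nonneg _).trans this
  exact mul_le_mul this hz (norm_nonneg _) h0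

lemma norm_cubFlow_sub_self_sub_le (hτ : 0 ≤ τ) (hy : ‖y‖ ≤ M) (hz : ‖z‖ ≤ M) :
    ‖(cubFlow τ β y - y) - (cubFlow τ β z - z)‖ ≤ 3 * (τ * |β| * M ^ 2) * ‖y - z‖ := by
  have e : (cubFlow τ β y - y) - (cubFlow τ β z - z) =
      (y - z) * (Complex.exp (-Complex.I * ((τ * (β * ‖y‖ ^ 2) : ℝ) : ℂ)) - 1) +
      z * (Complex.exp (-Complex.I * ((τ * (β * ‖y‖ ^ 2) : ℝ) : ℂ)) -
        Complex.exp (-Complex.I * ((τ * (β * ‖z‖ ^ 2) : ℝ) : ℂ))) := by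
    unfold cubFlow; ring
  rw [e]
  refine (norm_add_le _ _).trans ?_
  rw [norm_mul, norm_mul]
  have h1 := (norm_exp_neg_I_sub_one_le _).trans (abs_phase_le (β := β) hτ hy)
  have h2 := (norm_exp_neg_I_sub_le _ _).trans (abs_phase_sub_le (β := β) hτ hy hz)
  have hM := (norm_nonneg z).trans hz
  have h3 := mul_le_mul_of_nonneg_left h1 (norm_nonneg (y - z))
  have h4 := mul_le_mul hz h2 (norm_nonneg _) hM
  linarith

lemma norm_cubFlow_sub_le (hτ : 0 ≤ τ) (hy : ‖y‖ ≤ M) (hz : ‖z‖ ≤ M) :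
    ‖cubFlow τ β y - cubFlow τ β z‖ ≤ (1 + 3 * (τ * |β| * M ^ 2)) * ‖y - z‖ := by
  have h := norm_cubFlow_sub_self_sub_le (β := β) hτ hy hz
  have e : cubFlow τ β y - cubFlow τ β z =
    ((cubFlow τ β y - y) - (cubFlow τ β z - z)) + (y - z) := by ring
  rw [e]
  refine (norm_add_le _ _).trans ?_
  linarith

/-- The local defect of the linearised nonlinear flow. -/
noncomputable def cubRem (τ β : ℝ) (z : ℂ) : ℂ := cubFlow τ β z - z + Complex.I * τ * (β * cub z)

/-- The cubic flow is a rotation by an angle proportional to `|z|²`, so its second order remainder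
is that of the scalar exponential. -/
lemma cubRem_eq (τ β : ℝ) (z : ℂ) : cubRem τ β z = z * expRem (τ * (β * ‖z‖ ^ 2)) := by
  unfold cubRem cubFlow expRem cub; push_cast; ring

lemma continuous_cubRem (τ β : ℝ) : Continuous (cubRem τ β) := by
  have := continuous_cubFlow τ β
  have := continuous_cub
  unfold cubRem; fun_prop

lemma norm_cubRem_le (hτ : 0 ≤ τ) (hz : ‖z‖ ≤ M) :
    ‖cubRem τ β z‖ ≤ (τ * |β| * M ^ 2) ^ 2 * M := by
  rw [cubRem_eq, norm_mul, mul_comm]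
  exact mul_le_mul (norm_expRem_le (abs_phase_le hτ hz)) hz (norm_nonneg _) (sq_nonneg _)

lemma norm_cubRem_sub_le (hτ : 0 ≤ τ) (hy : ‖y‖ ≤ M) (hz : ‖z‖ ≤ M) :
    ‖cubRem τ β y - cubRem τ β z‖ ≤ 3 * (τ * |β| * M ^ 2) ^ 2 * ‖y - z‖ := by
  have e : cubRem τ β y - cubRem τ β z = (y - z) * expRem (τ * (β * ‖y‖ ^ 2)) +
      z * (expRem (τ * (β * ‖y‖ ^ 2)) - expRem (τ * (β * ‖z‖ ^ 2))) := by
    rw [cubRem_eq, cubRem_eq]; ring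
  rw [e]
  refine (norm_add_le _ _).trans ?_
  rw [norm_mul, norm_mul]
  have h0 := abs_phase_le (β := β) hτ hy
  have hm := (abs_nonneg _).trans h0
  have h1 := norm_expRem_le h0
  have h2 := (norm_expRem_sub_le h0 (abs_phase_le hτ hz)).trans
    (mul_le_mul_of_nonneg_left (abs_phase_sub_le (β := β) hτ hy hz) hm)
  have hM := (norm_nonneg z).trans hz
  have h3 := mul_le_mul_of_nonneg_left h1 (norm_nonneg (y - z))
  have h4 := mul_le_mul hz h2 (norm_nonneg _) hM
  linarith

end

/-! ## The scheme in Fourier space -/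

variable {a b : ℝ} {N : ℕ}

/-- For even `N` the modes are exactly `N` consecutive integers; a shift by `N/2` turns the sum into
an ordinary geometric one. -/
lemma sum_modes_zpow (hN : 0 < N) (hNe : Even N) {ζ : ℂ} (hζ : ζ ^ N = 1) :
    ∑ l ∈ modes N, ζ ^ l = if ζ = 1 then (N : ℂ) else 0 := by
  have hζ0 : ζ ≠ 0 := by rintro rfl; simp [hN.ne'] at hζ
  obtain ⟨K, hK⟩ := hNe
  have e : ∑ l ∈ modes N, ζ ^ l = ζ ^ (-(K : ℤ)) * ∑ i ∈ Finset.range N, ζ ^ i := by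
    rw [Finset.mul_sum]
    symm
    refine Finset.sum_bij (fun i _ => (i : ℤ) - K) ?_ ?_ ?_ ?_
    · intro i hi
      rw [Finset.mem_range] at hi
      unfold modes
      rw [Finset.mem_Ico]
      omega
    · intro i _ j _ h; simpa using h
    · intro l hl
      unfold modes at hl
      rw [Finset.mem_Ico] at hl
      exact ⟨(l + K).toNat, by rw [Finset.mem_range]; omega, by omega⟩
    · intro i _
      rw [sub_eq_neg_add, zpow_add₀ hζ0, zpow_natCast]
  rw [e]
  split_ifs with h
  · subst h; simp
  · rw [geom_sum_eq h, hζ]; simp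

/-- Trigonometric interpolation reproduces the grid values. -/
lemma trig_coef_gridPt (hab : a < b) (hN : 0 < N) (hNe : Even N) (g : ℝ → ℂ) {j : ℕ} (hj : j < N) :
    trig a b (modes N) (coef a b (avgGrid a b N) g) (gridPt a b N j) = g (gridPt a b N j) := by
  have hN' : (N : ℂ) ≠ 0 := by exact_mod_cast hN.ne'
  unfold trig coef
  simp_rw [integral_avgGrid, mul_assoc, Finset.sum_mul]
  rw [← Finset.mul_sum, Finset.sum_comm]
  have key : ∀ k ∈ Finset.range N, ∑ l ∈ modes N, g (gridPt a b N k) *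
      mode a b (-l) (gridPt a b N k) * mode a b l (gridPt a b N j) =
      if k = j then N * g (gridPt a b N j) else 0 := fun k hk => by
    rw [Finset.mem_range] at hk
    set ζ : ℂ := Complex.exp (2 * Real.pi * Complex.I * (((j : ℤ) - k : ℤ) / N)) with hζ
    have h1 : ∀ l : ℤ, mode a b (-l) (gridPt a b N k) * mode a b l (gridPt a b N j) = ζ ^ l :=
      fun l => by
        rw [mode_gridPt hab hN, mode_gridPt hab hN, ← Complex.exp_nat_mul, ← Complex.exp_nat_mul,
          ← Complex.exp_add, hζ, ← Complex.exp_int_mul]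
        congr 1
        push_cast
        field_simp
        ring
    simp_rw [mul_assoc, h1]
    have h2 : ζ ^ N = 1 := by
      rw [hζ, ← Complex.exp_nat_mul, Complex.exp_eq_one_iff]
      exact ⟨(j : ℤ) - k, by push_cast; field_simp⟩
    rw [← Finset.mul_sum, sum_modes_zpow hN hNe h2]
    have h3 : ζ = 1 ↔ k = j := by
      constructor
      · intro h
        rw [hζ, Complex.exp_eq_one_iff] at h
        obtain ⟨n, hn⟩ := h
        have h4 : ((((j : ℤ) - k : ℤ) : ℂ) / N) = n := by
          apply mul_left_cancel₀ Complex.two_pi_I_ne_zero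
          rw [hn]; ring
        rw [div_eq_iff hN'] at h4
        have h5 : ((j : ℤ) - k : ℤ) = n * N := by exact_mod_cast h4
        have h6 : ((j : ℤ) - k : ℤ) = 0 := Int.eq_zero_of_abs_lt_dvd (m := N)
          ⟨n, by rw [h5]; ring⟩ (by rw [abs_lt]; omega)
        omega
      · rintro rfl; simp [hζ]
    by_cases h : k = j
    · rw [if_pos (h3.2 h), if_pos h, h]; ring
    · rw [if_neg (fun h' => h (h3.1 h')), if_neg h]; ring
  rw [Finset.sum_congr rfl key, Finset.sum_ite_eq', if_pos (Finset.mem_range.2 hj)]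
  field_simp

variable {β τ : ℝ} {V : ℝ → ℝ} {ψ₀ : ℝ → ℂ}

/-- The Fourier coefficients of the numerical solution. -/
noncomputable def numCoef (a b β : ℝ) (V : ℝ → ℝ) (ψ₀ : ℝ → ℂ) (τ : ℝ) (N n : ℕ) : ℤ → ℂ :=
  discreteCoef a b N (numSol a b β V ψ₀ τ N n)

lemma coef_avgGrid_congr {g k : ℝ → ℂ} (h : ∀ j < N, g (gridPt a b N j) = k (gridPt a b N j))
    (l : ℤ) : coef a b (avgGrid a b N) g l = coef a b (avgGrid a b N) k l := by
  unfold coef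
  rw [integral_avgGrid, integral_avgGrid]
  congr 1
  exact Finset.sum_congr rfl fun j hj => by rw [h j (Finset.mem_range.1 hj)]

lemma numCoef_zero (l : ℤ) :
    numCoef a b β V ψ₀ τ N 0 l = coef a b (avgGrid a b N) ψ₀ l :=
  discreteCoef_eq_coef _ ψ₀ (fun _ => rfl) l

lemma numSol_succ_eq (n : ℕ) (j : Fin (N + 1)) :
    numSol a b β V ψ₀ τ N (n + 1) j = trig a b (modes N) (fun l =>
      Complex.exp (-Complex.I * ((τ * freq a b l ^ 2 : ℝ) : ℂ)) *
        fourierCoef a b (stage a b β V τ N (numSol a b β V ψ₀ τ N n)) l) (gridPt a b N j) := rfl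

/-- After at least one step the grid values come from a trigonometric polynomial, initially they
come from `ψ₀`; in both cases interpolation reproduces them. The node `x_N` is left out, as nothing
in the recursion reads it. -/
lemma numSol_eq_trig (hab : a < b) (hN : 0 < N) (hNe : Even N) (n : ℕ) (j : Fin N) :
    numSol a b β V ψ₀ τ N n j.castSucc =
      trig a b (modes N) (numCoef a b β V ψ₀ τ N n) (gridPt a b N j) := by
  have key : ∀ g : ℝ → ℂ, (∀ j : Fin N, numSol a b β V ψ₀ τ N n j.castSucc = g (gridPt a b N j)) →
      numSol a b β V ψ₀ τ N n j.castSucc =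
        trig a b (modes N) (numCoef a b β V ψ₀ τ N n) (gridPt a b N j) := fun g hg => by
    rw [hg, ← trig_coef_gridPt hab hN hNe g j.2]
    refine Finset.sum_congr rfl fun l _ => ?_
    rw [numCoef, discreteCoef_eq_coef _ g hg]
  cases n with
  | zero => exact key ψ₀ fun _ => rfl
  | succ n => exact key _ fun j => numSol_succ_eq n j.castSucc

/-- Sampling a polynomial with frequencies in `modes N` and taking the discrete transform returns
its coefficients. Hence the scheme is a recursion on coefficients alone, in which the grid enters
only through the interpolated cubic flow. -/
lemma numCoef_succ (hab : a < b) (hN : 0 < N) (hNe : Even N) (n : ℕ) {l : ℤ} (hl : l ∈ modes N) :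
    numCoef a b β V ψ₀ τ N (n + 1) l = Complex.exp (-Complex.I * ((τ * freq a b l ^ 2 : ℝ) : ℂ)) *
      coef a b (avgVol a b) (fun x => Complex.exp (-Complex.I * ((τ * V x : ℝ) : ℂ)) *
        trig a b (modes N) (coef a b (avgGrid a b N) (fun x => cubFlow τ β
          (trig a b (modes N) (numCoef a b β V ψ₀ τ N n) x))) x) l := by
  rw [numCoef, discreteCoef_eq_coef _ _ (fun j => numSol_succ_eq n j.castSucc),
    (isAveraging_avgGrid hab hN).coef_trig subset_rfl _ hl, if_pos hl, fourierCoef_eq_coef hab]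
  have e : stage a b β V τ N (numSol a b β V ψ₀ τ N n) =
      fun x => Complex.exp (-Complex.I * ((τ * V x : ℝ) : ℂ)) *
        trig a b (modes N) (coef a b (avgGrid a b N) (fun x => cubFlow τ β
          (trig a b (modes N) (numCoef a b β V ψ₀ τ N n) x))) x := by
    funext x
    rw [stage, interp_eq_trig]
    congr 1
    unfold trig
    refine Finset.sum_congr rfl fun m _ => congrArg (· * mode a b m x) ?_
    refine discreteCoef_eq_coef _ _ (fun j => ?_) m
    rw [cubFlow, numSol_eq_trig hab hN hNe]
    rfl
  rw [e]

end GPE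

namespace GPE

variable {a b : ℝ} {N : ℕ}

/-! ## Exactness of trigonometric interpolation on cubic terms of low degree -/

/-- Trigonometric polynomials of degree at most `K`. -/
noncomputable def trigPoly (a b : ℝ) (K : ℤ) : Submodule ℂ (ℝ → ℂ) :=
  Submodule.span ℂ (mode a b '' {m | |m| ≤ K})

lemma mul_mem_trigPoly {K L : ℤ} {f g : ℝ → ℂ} (hf : f ∈ trigPoly a b K) (hg : g ∈ trigPoly a b L) :
    f * g ∈ trigPoly a b (K + L) := by
  have h := Submodule.mul_mem_mul hf hg
  rw [trigPoly, trigPoly, Submodule.span_mul_span] at h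
  refine Submodule.span_mono ?_ h
  rintro _ ⟨_, ⟨l, hl, rfl⟩, _, ⟨m, hm, rfl⟩, rfl⟩
  have hl' : |l| ≤ K := hl
  have hm' : |m| ≤ L := hm
  exact ⟨l + m, (abs_add_le l m).trans (add_le_add hl' hm'), funext fun x => mode_add a b l m x⟩

lemma star_mem_trigPoly {K : ℤ} {f : ℝ → ℂ} (hf : f ∈ trigPoly a b K) : star f ∈ trigPoly a b K := by
  induction hf using Submodule.span_induction with
  | mem f hf =>
    obtain ⟨l, hl, rfl⟩ := hf
    refine Submodule.subset_span ⟨-l, ?_, funext fun x => mode_neg a b l x⟩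
    simpa using hl
  | zero => rw [star_zero]; exact zero_mem _
  | add f g _ _ hf hg => rw [star_add]; exact add_mem hf hg
  | smul c f _ hf => rw [star_smul]; exact Submodule.smul_mem _ _ hf

lemma trig_mem_trigPoly {K : ℤ} {S : Finset ℤ} (hS : ∀ l ∈ S, |l| ≤ K) (d : ℤ → ℂ) :
    trig a b S d ∈ trigPoly a b K := by
  have e : trig a b S d = ∑ l ∈ S, d l • mode a b l := by
    funext x; simp [trig]
  rw [e]
  exact Submodule.sum_mem _ fun l hl =>
    Submodule.smul_mem _ _ (Submodule.subset_span ⟨l, hS l hl, rfl⟩)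

lemma exists_eq_trig {K : ℤ} {S : Finset ℤ} (hS : ∀ l, |l| ≤ K → l ∈ S) {f : ℝ → ℂ}
    (hf : f ∈ trigPoly a b K) : ∃ d, f = trig a b S d := by
  induction hf using Submodule.span_induction with
  | mem f hf =>
    obtain ⟨l, hl, rfl⟩ := hf
    refine ⟨fun m => if m = l then 1 else 0, funext fun x => ?_⟩
    simp [trig, hS l hl]
  | zero => exact ⟨0, funext fun x => by simp [trig]⟩
  | add f g _ _ hf hg =>
    obtain ⟨d, rfl⟩ := hf
    obtain ⟨e, rfl⟩ := hg
    exact ⟨d + e, funext fun x => by simp [trig, add_mul, Finset.sum_add_distrib]⟩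
  | smul c f _ hf =>
    obtain ⟨d, rfl⟩ := hf
    exact ⟨c • d, funext fun x => by simp [trig, Finset.mul_sum, mul_assoc]⟩

/-- The lowest third of the modes. -/
noncomputable def lowModes (N : ℕ) : Finset ℤ := (modes N).filter fun l => 6 * |l| < N

lemma lowModes_subset (N : ℕ) : lowModes N ⊆ modes N := Finset.filter_subset _ _

/-- The cube of a polynomial of degree below `N/6` has degree strictly below `N/2`, hence no
frequency outside `modes N`, and both averages return its coefficients there. This exchanges the
integral for the grid without aliasing error. -/
lemma coef_cub_low (hab : a < b) (hN : 0 < N) (hNe : Even N) (d : ℤ → ℂ) {l : ℤ}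
    (hl : l ∈ modes N) :
    coef a b (avgVol a b) (fun x => cub (trig a b (lowModes N) d x)) l =
      coef a b (avgGrid a b N) (fun x => cub (trig a b (lowModes N) d x)) l := by
  -- The largest degree with `6K < N`. Then `3K < N/2` strictly, as needed because `N/2` itself is
  -- not a mode.
  set K : ℤ := ((N : ℤ) - 1) / 6
  have hq : trig a b (lowModes N) d ∈ trigPoly a b K := trig_mem_trigPoly (fun m hm => by
    have := (Finset.mem_filter.1 hm).2
    omega) d
  have hc : (fun x => cub (trig a b (lowModes N) d x)) ∈ trigPoly a b (K + K + K) := by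
    have := mul_mem_trigPoly (mul_mem_trigPoly hq (star_mem_trigPoly hq)) hq
    convert this using 1
    funext x
    exact cub_eq _
  obtain ⟨e, he⟩ := exists_eq_trig (S := modes N) (fun m hm => by
    unfold modes
    rw [Finset.mem_Ico]
    obtain ⟨r, hr⟩ := hNe
    rw [abs_le] at hm
    omega) hc
  rw [he, (isAveraging_avgVol hab N).coef_trig subset_rfl _ hl,
    (isAveraging_avgGrid hab hN).coef_trig subset_rfl _ hl]

/-! ## Decomposition of the local error -/

lemma memLp_potential_mul (hV : AEStronglyMeasurable V (vol a b)) {B : ℝ}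
    (hB : ∀ᵐ x ∂vol a b, |V x| ≤ B) {g : ℝ → ℂ} (hg : MemLp g 2 (avgVol a b)) :
    MemLp (fun x => (V x : ℂ) * g x) 2 (avgVol a b) := by
  have hV' : AEStronglyMeasurable V (avgVol a b) := hV.mono_ac (by
    unfold avgVol; exact Measure.smul_absolutelyContinuous)
  refine hg.of_le_mul (c := B) ((Complex.continuous_ofReal.comp_aestronglyMeasurable hV').mul hg.1) ?_
  filter_upwards [ae_avgVol_iff.2 hB] with x hx
  rw [norm_mul, Complex.norm_real, Real.norm_eq_abs]
  exact mul_le_mul_of_nonneg_right hx (norm_nonneg _)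

lemma memLp_continuous_potential_mul (hV : AEStronglyMeasurable V (vol a b)) {k : ℝ → ℂ}
    (hk : Continuous k) {B : ℝ} (hB : ∀ᵐ x ∂vol a b, ‖k (V x)‖ ≤ B) {g : ℝ → ℂ}
    (hg : MemLp g 2 (avgVol a b)) : MemLp (fun x => k (V x) * g x) 2 (avgVol a b) := by
  have hV' : AEStronglyMeasurable V (avgVol a b) := hV.mono_ac (by
    unfold avgVol; exact Measure.smul_absolutelyContinuous)
  refine hg.of_le_mul (c := B) ((hk.comp_aestronglyMeasurable hV').mul hg.1) ?_
  filter_upwards [ae_avgVol_iff.2 hB] with x hx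
  rw [norm_mul]
  exact mul_le_mul_of_nonneg_right hx (norm_nonneg _)

lemma memLp_cub {ν : Measure ℝ} [IsFiniteMeasure ν] {g : ℝ → ℂ} (hg : Continuous g) {M : ℝ}
    (h : ∀ x, ‖g x‖ ≤ M) : MemLp (fun x => cub (g x)) 2 ν :=
  memLp_of_bound (continuous_cub.comp hg).aestronglyMeasurable (C := M ^ 3) fun x => by
    rw [norm_cub]; exact pow_le_pow_left₀ (norm_nonneg _) (h x) 3

/-- The Fourier coefficients of the right hand side `Vψ + β|ψ|²ψ`, `ψ = syn c`. -/
noncomputable def forceCoef (a b β : ℝ) (V : ℝ → ℝ) (c : ℤ → ℂ) : ℤ → ℂ :=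
  coef a b (avgVol a b) fun x => (V x : ℂ) * syn a b c x + β * cub (syn a b c x)

/-- The coefficients of the interpolant of the nonlinear substep. -/
noncomputable def flowCoef (a b τ β : ℝ) (N : ℕ) (d : ℤ → ℂ) : ℤ → ℂ :=
  coef a b (avgGrid a b N) fun x => cubFlow τ β (trig a b (modes N) d x)

variable {τ β B : ℝ} {V : ℝ → ℝ} {c d : ℤ → ℂ}

/-- The seven sources of the defect are, in order: truncation of the solution under `V`; the present
error under `V`; the change made by the cubic flow before `V` acts; the second order remainder of
`e^{-iτV}`; low-mode truncation in the cubic; the cubic at the truncation against the cubic at the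
numerical solution, on the grid; the second order remainder of the cubic flow. The weight is `1` for
`L²` and `μ` for `H¹`. -/
lemma sn_defect_le (hab : a < b) (hN : 0 < N) (hNe : Even N) (hτ : 0 ≤ τ)
    (hV : AEStronglyMeasurable V (vol a b)) (hB : ∀ᵐ x ∂vol a b, |V x| ≤ B)
    (hc : Summable fun l => ‖c l‖) (wt : ℤ → ℂ) :
    sn (modes N) (fun l => wt l * (-Complex.I * τ * forceCoef a b β V c l -
      (coef a b (avgVol a b) (fun x => Complex.exp (-Complex.I * ((τ * V x : ℝ) : ℂ)) *
        trig a b (modes N) (flowCoef a b τ β N d) x) l - d l))) ≤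
    τ * sn (modes N) (fun l => wt l * coef a b (avgVol a b)
      (fun x => (V x : ℂ) * (syn a b c x - trig a b (modes N) c x)) l) +
    τ * sn (modes N) (fun l => wt l * coef a b (avgVol a b)
      (fun x => (V x : ℂ) * trig a b (modes N) (fun l => c l - d l) x) l) +
    τ * sn (modes N) (fun l => wt l * coef a b (avgVol a b)
      (fun x => (V x : ℂ) * trig a b (modes N) (fun l => flowCoef a b τ β N d l - d l) x) l) +
    sn (modes N) (fun l => wt l * coef a b (avgVol a b)
      (fun x => expRem (τ * V x) * trig a b (modes N) (flowCoef a b τ β N d) x) l) +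
    τ * |β| * sn (modes N) (fun l => wt l * coef a b (avgVol a b)
      (fun x => cub (syn a b c x) - cub (trig a b (lowModes N) c x)) l) +
    τ * |β| * sn (modes N) (fun l => wt l * coef a b (avgGrid a b N)
      (fun x => cub (trig a b (lowModes N) c x) - cub (trig a b (modes N) d x)) l) +
    sn (modes N) (fun l => wt l * coef a b (avgGrid a b N)
      (fun x => cubRem τ β (trig a b (modes N) d x)) l) := by
  have hp0 := avgVol_prob hab
  have hpN := (isAveraging_avgGrid hab hN).prob
  set S := modes N
  set w := flowCoef a b τ β N d with hw
  have trig_sub : ∀ (e f : ℤ → ℂ) (x : ℝ), trig a b S (fun l => e l - f l) x =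
      trig a b S e x - trig a b S f x := fun e f x => by
    simp [trig, sub_mul, Finset.sum_sub_distrib]
  have key : ∀ l ∈ S, wt l * (-Complex.I * τ * forceCoef a b β V c l -
      (coef a b (avgVol a b) (fun x => Complex.exp (-Complex.I * ((τ * V x : ℝ) : ℂ)) *
        trig a b S w x) l - d l)) =
      (-Complex.I * τ) * (wt l * coef a b (avgVol a b)
        (fun x => (V x : ℂ) * (syn a b c x - trig a b S c x)) l) +
      (-Complex.I * τ) * (wt l * coef a b (avgVol a b)
        (fun x => (V x : ℂ) * trig a b S (fun l => c l - d l) x) l) -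
      (-Complex.I * τ) * (wt l * coef a b (avgVol a b)
        (fun x => (V x : ℂ) * trig a b S (fun l => w l - d l) x) l) -
      (wt l * coef a b (avgVol a b) (fun x => expRem (τ * V x) * trig a b S w x) l) +
      (-Complex.I * τ * β) * (wt l * coef a b (avgVol a b)
        (fun x => cub (syn a b c x) - cub (trig a b (lowModes N) c x)) l) +
      (-Complex.I * τ * β) * (wt l * coef a b (avgGrid a b N)
        (fun x => cub (trig a b (lowModes N) c x) - cub (trig a b S d x)) l) -
      (wt l * coef a b (avgGrid a b N) (fun x => cubRem τ β (trig a b S d x)) l) := fun l hl => by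
    have mΨ := memLp_syn (a := a) (b := b) (ν := avgVol a b) hc
    have mV := fun {g : ℝ → ℂ} (hg : MemLp g 2 (avgVol a b)) => memLp_potential_mul hV hB hg
    have mt : ∀ S d, MemLp (trig a b S d) 2 (avgVol a b) := memLp_trig
    have mc : ∀ S d, MemLp (fun x => cub (trig a b S d x)) 2 (avgVol a b) := fun S d =>
      memLp_cub (continuous_trig a b S d) (norm_trig_le S d)
    have mcN : ∀ S d, MemLp (fun x => cub (trig a b S d x)) 2 (avgGrid a b N) := fun S d =>
      memLp_cub (continuous_trig a b S d) (norm_trig_le S d)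
    have mcΨ : MemLp (fun x => cub (syn a b c x)) 2 (avgVol a b) :=
      memLp_cub (continuous_syn hc) (norm_syn_le hc)
    have f1 : forceCoef a b β V c l = coef a b (avgVol a b) (fun x => (V x : ℂ) * syn a b c x) l +
        β * coef a b (avgVol a b) (fun x => cub (syn a b c x)) l := by
      rw [forceCoef, coef_add (mV mΨ) (mcΨ.const_mul _), coef_const_mul]
    have f2 : coef a b (avgVol a b) (fun x => (V x : ℂ) * (syn a b c x - trig a b S c x)) l =
        coef a b (avgVol a b) (fun x => (V x : ℂ) * syn a b c x) l -
        coef a b (avgVol a b) (fun x => (V x : ℂ) * trig a b S c x) l := by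
      simp_rw [mul_sub]
      rw [coef_sub (mV mΨ) (mV (mt S c))]
    have f3 : ∀ e f : ℤ → ℂ, coef a b (avgVol a b)
        (fun x => (V x : ℂ) * trig a b S (fun l => e l - f l) x) l =
        coef a b (avgVol a b) (fun x => (V x : ℂ) * trig a b S e x) l -
        coef a b (avgVol a b) (fun x => (V x : ℂ) * trig a b S f x) l := fun e f => by
      simp_rw [trig_sub, mul_sub]
      rw [coef_sub (mV (mt S e)) (mV (mt S f))]
    have mE : MemLp (fun x => Complex.exp (-Complex.I * ((τ * V x : ℝ) : ℂ)) * trig a b S w x) 2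
        (avgVol a b) :=
      memLp_continuous_potential_mul hV (k := fun y => Complex.exp (-Complex.I * ((τ * y : ℝ) : ℂ)))
        (by fun_prop) (B := 1) (Eventually.of_forall fun x => (norm_exp_neg_I _).le) (mt S w)
    have f4 : coef a b (avgVol a b) (fun x => expRem (τ * V x) * trig a b S w x) l =
        coef a b (avgVol a b) (fun x => Complex.exp (-Complex.I * ((τ * V x : ℝ) : ℂ)) *
          trig a b S w x) l - w l +
        Complex.I * τ * coef a b (avgVol a b) (fun x => (V x : ℂ) * trig a b S w x) l := by
      have e : ∀ x, expRem (τ * V x) * trig a b S w x =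
          (Complex.exp (-Complex.I * ((τ * V x : ℝ) : ℂ)) * trig a b S w x - trig a b S w x) +
          Complex.I * τ * ((V x : ℂ) * trig a b S w x) := fun x => by
        unfold expRem; push_cast; ring
      simp_rw [e]
      have mS : MemLp (fun x => Complex.exp (-Complex.I * ((τ * V x : ℝ) : ℂ)) * trig a b S w x -
        trig a b S w x) 2 (avgVol a b) := mE.sub (mt S w)
      rw [coef_add mS ((mV (mt S w)).const_mul _), coef_sub mE (mt S w),
        coef_const_mul, (isAveraging_avgVol hab N).coef_trig subset_rfl _ hl, if_pos hl]
    have f5 := coef_sub mcΨ (mc (lowModes N) c) (a := a) (b := b) l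
    have f6 := coef_sub (mcN (lowModes N) c) (mcN S d) (a := a) (b := b) l
    have mF : MemLp (fun x => cubFlow τ β (trig a b S d x)) 2 (avgGrid a b N) :=
      memLp_of_bound ((continuous_cubFlow τ β).comp (continuous_trig a b S d)).aestronglyMeasurable
        fun x => (norm_cubFlow τ β _).trans_le (norm_trig_le S d x)
    have f7 : coef a b (avgGrid a b N) (fun x => cubRem τ β (trig a b S d x)) l =
        w l - d l + Complex.I * τ * (β *
          coef a b (avgGrid a b N) (fun x => cub (trig a b S d x)) l) := by
      have mS : MemLp (fun x => cubFlow τ β (trig a b S d x) - trig a b S d x) 2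
        (avgGrid a b N) := mF.sub (memLp_trig S d)
      unfold cubRem
      rw [coef_add mS (((mcN S d).const_mul _).const_mul _),
        coef_sub mF (memLp_trig S d), coef_const_mul, coef_const_mul,
        (isAveraging_avgGrid hab hN).coef_trig subset_rfl _ hl, if_pos hl, hw, flowCoef]
    -- The cubic of the low-mode truncation occurs once with each measure; `coef_cub_low` identifies
    -- the two occurrences, which then cancel.
    rw [f1, f2, f3, f3, f4, f5, f6, f7, coef_cub_low hab hN hNe c hl]
    ring
  rw [sn_congr key]
  have n1 : ‖-Complex.I * (τ : ℂ)‖ = τ := by simp [abs_of_nonneg hτ]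
  have n2 : ‖-Complex.I * (τ : ℂ) * β‖ = τ * |β| := by simp [abs_of_nonneg hτ]
  refine (sn_sub_le _ _ _).trans (add_le_add ?_ le_rfl)
  refine (sn_add_le _ _ _).trans (add_le_add ?_ (by rw [sn_const_mul, n2]))
  refine (sn_add_le _ _ _).trans (add_le_add ?_ (by rw [sn_const_mul, n2]))
  refine (sn_sub_le _ _ _).trans (add_le_add ?_ le_rfl)
  refine (sn_sub_le _ _ _).trans (add_le_add ?_ (by rw [sn_const_mul, n1]))
  refine (sn_add_le _ _ _).trans (add_le_add ?_ (by rw [sn_const_mul, n1]))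
  rw [sn_const_mul, n1]

end GPE

namespace GPE

variable {a b : ℝ} {N : ℕ} {c d : ℤ → ℂ}

/-! ## Truncation and aliasing -/

/-- Outside the low modes `|l| ≥ N/6`, so `|μ| ≥ (π/3)/h ≥ 1/h`. Truncating to low modes therefore
still gains a factor `h` per derivative. -/
lemma le_abs_freq_of_not_mem_low (hab : a < b) (hN : 0 < N) (hNe : Even N) {l : ℤ}
    (hl : l ∉ lowModes N) : 1 / mesh a b N ≤ |freq a b l| := by
  have hL := sub_pos.2 hab
  have hN' : (0 : ℝ) < N := by exact_mod_cast hN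
  have h6 : (N : ℤ) ≤ 6 * |l| := by
    by_contra! h
    refine hl (Finset.mem_filter.2 ⟨?_, h⟩)
    unfold modes
    rw [Finset.mem_Ico]
    obtain ⟨r, hr⟩ := hNe
    have := abs_lt.1 (show |l| < (N : ℤ) / 2 by omega)
    omega
  have h6' : (N : ℝ) ≤ 6 * |(l : ℝ)| := by exact_mod_cast h6
  have hm : 1 / mesh a b N = N / (b - a) := by unfold mesh; rw [one_div_div]
  have hf : |freq a b l| = 2 * Real.pi * |(l : ℝ)| / (b - a) := by
    unfold freq
    rw [abs_div, abs_mul, abs_of_pos hL, abs_of_pos Real.two_pi_pos]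
  rw [hm, hf]
  gcongr
  nlinarith [Real.pi_gt_three, abs_nonneg (l : ℝ)]

lemma le_abs_freq_of_not_mem_modes (hab : a < b) (hN : 0 < N) (hNe : Even N) {l : ℤ}
    (hl : l ∉ modes N) : 1 / mesh a b N ≤ |freq a b l| :=
  le_abs_freq_of_not_mem_low hab hN hNe fun h => hl (lowModes_subset N h)

lemma summable_sq_of_le {κ : ℝ} (hd : Summable fun l => ‖d l‖ ^ 2) (h : ∀ l, ‖c l‖ ≤ κ * ‖d l‖) :
    Summable fun l => ‖c l‖ ^ 2 := by
  refine Summable.of_nonneg_of_le (fun _ => sq_nonneg _) (fun l => ?_) (hd.mul_left (κ ^ 2))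
  rw [← mul_pow]
  exact pow_le_pow_left₀ (norm_nonneg _) (h l) 2

lemma tsum_sq_le {κ M : ℝ} (hd : Summable fun l => ‖d l‖ ^ 2) (hM : ∑' l, ‖d l‖ ^ 2 ≤ M ^ 2)
    (h : ∀ l, ‖c l‖ ≤ κ * ‖d l‖) : ∑' l, ‖c l‖ ^ 2 ≤ (κ * M) ^ 2 := by
  have hs := summable_sq_of_le hd h
  calc ∑' l, ‖c l‖ ^ 2 ≤ ∑' l, κ ^ 2 * ‖d l‖ ^ 2 := by
        refine hs.tsum_le_tsum (fun l => ?_) (hd.mul_left _)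
        rw [← mul_pow]
        exact pow_le_pow_left₀ (norm_nonneg _) (h l) 2
    _ = κ ^ 2 * ∑' l, ‖d l‖ ^ 2 := tsum_mul_left
    _ ≤ κ ^ 2 * M ^ 2 := mul_le_mul_of_nonneg_left hM (sq_nonneg _)
    _ = _ := by ring

lemma l2_syn_le (hab : a < b) {κ M : ℝ} (hκ : 0 ≤ κ) (hM0 : 0 ≤ M) (hc : Summable fun l => ‖c l‖)
    (hd : Summable fun l => ‖d l‖ ^ 2) (hM : ∑' l, ‖d l‖ ^ 2 ≤ M ^ 2)
    (h : ∀ l, ‖c l‖ ≤ κ * ‖d l‖) : l2 (avgVol a b) (syn a b c) ≤ κ * M := by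
  have h1 := tsum_sq_le hd hM h
  rw [(l2_syn_sq hab hc).tsum_eq] at h1
  exact sn_le_of_tsum.le_of_sq_le_sq h1 (mul_nonneg hκ hM0)

lemma summable_ite_not_mem (hc : Summable fun l => ‖c l‖) (S : Finset ℤ) :
    Summable fun l => ‖if l ∈ S then 0 else c l‖ :=
  hc.of_nonneg_of_le (fun _ => norm_nonneg _) fun l => by split_ifs <;> simp

/-- The tail of a Fourier series outside `S`, where all frequencies are at least `1 / h`. -/
lemma norm_tail_le {S : Finset ℤ} {h : ℝ} (hh : 0 < h)
    (hS : ∀ l ∉ S, 1 / h ≤ |freq a b l|) (p : ℕ) (l : ℤ) :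
    ‖if l ∈ S then 0 else c l‖ ≤ h ^ p * ‖(freq a b l : ℂ) ^ p * c l‖ := by
  split_ifs with hl
  · simp only [norm_zero]; positivity
  · rw [norm_mul, norm_pow, Complex.norm_real, Real.norm_eq_abs, ← mul_assoc, ← mul_pow]
    have := (div_le_iff₀ hh).1 (hS l hl)
    refine le_mul_of_one_le_left (norm_nonneg _) (one_le_pow₀ ?_)
    linarith

lemma tsum_mul_sq_le {x y : ℤ → ℝ} (hx : Summable fun k => x k ^ 2) (hy : Summable fun k => y k ^ 2)
    (hxy : Summable fun k => x k * y k) :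
    (∑' k, x k * y k) ^ 2 ≤ (∑' k, x k ^ 2) * ∑' k, y k ^ 2 := by
  refine le_of_tendsto_of_tendsto (Tendsto.pow hxy.hasSum 2)
    (Tendsto.mul hx.hasSum hy.hasSum)
    (Eventually.of_forall fun s => ?_)
  exact Finset.sum_mul_sq_le_sq_mul_sq s x y

lemma summable_mul_of_sq {x y : ℤ → ℝ} (hx : Summable fun k => x k ^ 2)
    (hy : Summable fun k => y k ^ 2) : Summable fun k => x k * y k := by
  refine Summable.of_norm_bounded (hx.add hy) fun k => ?_
  rw [Real.norm_eq_abs, abs_mul]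
  nlinarith [sq_nonneg (|x k| - |y k|), sq_abs (x k), sq_abs (y k), sq_nonneg (x k), sq_nonneg (y k)]

/-- Aliasing: the discrete coefficients collect the Fourier coefficients modulo `N`. -/
lemma hasSum_coef_avgGrid_syn (hab : a < b) (hN : 0 < N) (hc : Summable fun l => ‖c l‖) (l : ℤ) :
    HasSum (fun k : ℤ => c (l + k * N)) (coef a b (avgGrid a b N) (syn a b c) l) := by
  have := (isAveraging_avgGrid hab hN).prob
  have hi : ∀ m : ℤ, Integrable (fun x => c m * mode a b m x * mode a b (-l) x) (avgGrid a b N) :=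
    fun m => by
      simp_rw [mul_assoc]
      exact (integrable_mul_mode (memLp_mode m) _).const_mul _
  have h := hasSum_integral_of_summable_integral_norm (μ := avgGrid a b N)
    (F := fun (m : ℤ) x => c m * mode a b m x * mode a b (-l) x) hi (by simpa using hc)
  have e : ∀ m : ℤ, ∫ x, c m * mode a b m x * mode a b (-l) x ∂avgGrid a b N =
      if (N : ℤ) ∣ m - l then c m else 0 := fun m => by
    simp_rw [mul_assoc, ← mode_add]
    rw [integral_const_mul, ← sub_eq_add_neg, integral_mode_avgGrid hab hN]
    split_ifs <;> simp
  simp_rw [e, tsum_mul_right] at h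
  -- Only the indices `m = l + kN` contribute, so the sum is reindexed by `k`.
  have hinj : Function.Injective fun k : ℤ => l + k * N := fun k k' hk => by
    simpa [hN.ne'] using hk
  have h2 := (hinj.hasSum_iff (f := fun m => if (N : ℤ) ∣ m - l then c m else 0) (fun m hm => by
    rw [if_neg]
    rintro ⟨k, hk⟩
    exact hm ⟨k, by simp only; linarith⟩)).2 h
  simpa [Function.comp_def, coef, syn] using h2

/-- A universal constant in the aliasing estimate. -/
noncomputable def aliasConst : ℝ := Real.sqrt (∑' k : ℤ, (1 / (k : ℝ) ^ 2) ^ 2)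

lemma summable_alias : Summable fun k : ℤ => (1 / (k : ℝ) ^ 2) ^ 2 := by
  have := Real.summable_one_div_int_pow (p := 4) |>.2 (by norm_num)
  refine this.congr fun k => ?_
  rw [div_pow, one_pow, ← pow_mul]

lemma aliasConst_nonneg : 0 ≤ aliasConst := Real.sqrt_nonneg _

/-- Cauchy-Schwarz in the alias index `k` against the square summable weight `1/k²`. Since `(l, k) ↦
l + kN` is injective on `modes N × ℤ`, the sums left over are dominated by a single sum over `ℤ`. -/
lemma sn_alias_le (hab : a < b) (hN : 0 < N) (hc : Summable fun l => ‖c l‖)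
    {wt : ℤ → ℂ} {M η : ℝ} (hM0 : 0 ≤ M) (hη : 0 ≤ η) (hd : Summable fun l => ‖d l‖ ^ 2)
    (hM : ∑' l, ‖d l‖ ^ 2 ≤ M ^ 2)
    (h : ∀ l ∈ modes N, ∀ k : ℤ, k ≠ 0 →
      ‖wt l * c (l + k * N)‖ ≤ η * (1 / (k : ℝ) ^ 2 * ‖d (l + k * N)‖)) :
    sn (modes N) (fun l => wt l * (c l - coef a b (avgGrid a b N) (syn a b c) l)) ≤
      aliasConst * η * M := by
  have hA : aliasConst ^ 2 = ∑' k : ℤ, (1 / (k : ℝ) ^ 2) ^ 2 :=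
    Real.sq_sqrt (tsum_nonneg fun _ => sq_nonneg _)
  have hinj : Function.Injective fun p : modes N × ℤ => (p.1 : ℤ) + p.2 * N := by
    rintro ⟨l, k⟩ ⟨l', k'⟩ h
    simp only at h
    have h1 := abs_sub_lt_of_mem_modes l.2 l'.2
    have h2 : (l : ℤ) - l' = 0 := Int.eq_zero_of_abs_lt_dvd (m := N) ⟨k' - k, by linarith⟩ h1
    have hN' : (N : ℤ) ≠ 0 := by exact_mod_cast hN.ne'
    have h3 : (l : ℤ) = l' := by omega
    rw [h3, add_right_inj] at h
    exact Prod.ext (Subtype.ext h3) (mul_right_cancel₀ hN' h)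
  have hdS : Summable fun p : modes N × ℤ => ‖d (p.1 + p.2 * N)‖ ^ 2 := hd.comp_injective hinj
  have hsum : ∑ l ∈ modes N, ∑' k : ℤ, ‖d (l + k * N)‖ ^ 2 ≤ M ^ 2 := by
    refine le_trans ?_ hM
    have h1 := tsum_comp_le_tsum_of_inj hd (fun _ => sq_nonneg _) hinj
    rw [Function.comp_def, hdS.tsum_prod, tsum_fintype] at h1
    rwa [← Finset.sum_coe_sort]
  have hk : ∀ l ∈ modes N, ‖wt l * (c l - coef a b (avgGrid a b N) (syn a b c) l)‖ ^ 2 ≤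
      (aliasConst * η) ^ 2 * ∑' k : ℤ, ‖d (l + k * N)‖ ^ 2 := fun l hl => by
    have hs : Summable fun k : ℤ => ‖d (l + k * N)‖ ^ 2 := hdS.prod_factor ⟨l, hl⟩
    have hxy := summable_mul_of_sq summable_alias hs
    have h1 := hasSum_coef_avgGrid_syn hab hN hc l
    have h2 : HasSum (fun k : ℤ => if k = 0 then 0 else c (l + k * N))
        (coef a b (avgGrid a b N) (syn a b c) l - c l) := by
      have h3 := h1.sub (hasSum_ite_eq (0 : ℤ) (c l))
      refine h3.congr_fun ?_ 
      intro k
      by_cases hk : k = 0 <;> simp [hk]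
    have h4 : ‖wt l * (c l - coef a b (avgGrid a b N) (syn a b c) l)‖ ≤
        η * ∑' k : ℤ, 1 / (k : ℝ) ^ 2 * ‖d (l + k * N)‖ := by
      rw [norm_mul, norm_sub_rev, ← norm_mul, ← (h2.mul_left (wt l)).tsum_eq, ← tsum_mul_left]
      refine tsum_of_norm_bounded (hxy.mul_left η).hasSum fun k => ?_
      -- At `k = 0` both sides are zero, the right one because `1 / 0 = 0`.
      by_cases hk : k = 0
      · simp [hk]
      · rw [if_neg hk]; exact h l hl k hk
    have h5 := tsum_mul_sq_le summable_alias hs hxy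
    rw [← hA] at h5
    calc _ ≤ (η * ∑' k : ℤ, 1 / (k : ℝ) ^ 2 * ‖d (l + k * N)‖) ^ 2 :=
          pow_le_pow_left₀ (norm_nonneg _) h4 2
      _ = η ^ 2 * (∑' k : ℤ, 1 / (k : ℝ) ^ 2 * ‖d (l + k * N)‖) ^ 2 := by ring
      _ ≤ η ^ 2 * (aliasConst ^ 2 * ∑' k : ℤ, ‖d (l + k * N)‖ ^ 2) :=
          mul_le_mul_of_nonneg_left h5 (sq_nonneg _)
      _ = _ := by ring
  refine Real.sqrt_le_iff.2 ⟨mul_nonneg (mul_nonneg aliasConst_nonneg hη) hM0, ?_⟩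
  refine (Finset.sum_le_sum hk).trans ?_
  rw [← Finset.mul_sum, mul_pow _ M]
  exact mul_le_mul_of_nonneg_left hsum (sq_nonneg _)

/-- With `|l| ≤ N/2` one has `|l + kN| ≥ (|k| - 1/2) N`, which is at least `|k|N/2` and at least
`|l|`. The first bound yields the gain `h/|k|` per derivative, the second lets the weight pass to
the aliased frequency. -/
lemma abs_freq_alias_ge (hab : a < b) (hN : 0 < N) {l : ℤ} (hl : l ∈ modes N)
    {k : ℤ} (hk : k ≠ 0) :
    |(k : ℝ)| / mesh a b N ≤ |freq a b (l + k * N)| ∧ |freq a b l| ≤ |freq a b (l + k * N)| := by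
  have hL := sub_pos.2 hab
  have hN' : (0 : ℝ) < N := by exact_mod_cast hN
  have hf : ∀ m : ℤ, |freq a b m| = 2 * Real.pi * |(m : ℝ)| / (b - a) := fun m => by
    unfold freq
    rw [abs_div, abs_mul, abs_of_pos hL, abs_of_pos Real.two_pi_pos]
  unfold modes at hl
  rw [Finset.mem_Ico] at hl
  have hl2 : 2 * |l| ≤ N := by
    have : |l| ≤ (N : ℤ) / 2 := abs_le.2 ⟨by omega, by omega⟩
    omega
  have hk1 : 1 ≤ |k| := Int.one_le_abs hk
  have h3 : |k| * N - |l| ≤ |l + k * N| := by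
    have := abs_sub_abs_le_abs_sub (k * N : ℤ) (-l)
    rw [abs_neg, abs_mul, Nat.abs_cast, sub_neg_eq_add, add_comm (k * (N : ℤ))] at this
    exact this
  have h4 : |k| * N ≤ 2 * |l + k * N| := by nlinarith
  have h5 : |l| ≤ |l + k * N| := by nlinarith
  have h4' : |(k : ℝ)| * N ≤ 2 * |((l + k * N : ℤ) : ℝ)| := by exact_mod_cast h4
  have h5' : |(l : ℝ)| ≤ |((l + k * N : ℤ) : ℝ)| := by exact_mod_cast h5
  rw [hf, hf]
  constructor
  · rw [mesh, div_div_eq_mul_div]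
    refine div_le_div_of_nonneg_right ?_ hL.le
    nlinarith [Real.pi_gt_three, abs_nonneg ((l + k * N : ℤ) : ℝ)]
  · have := Real.pi_pos
    gcongr

/-- Aliasing error for coefficients with `∑ |μ^{p+2} c|² ≤ M²`, in the seminorm with weight
`μ^p`. -/
lemma sn_freq_alias_le (hab : a < b) (hN : 0 < N) (hc : Summable fun l => ‖c l‖) (p : ℕ)
    {M : ℝ} (hM0 : 0 ≤ M) (hd : Summable fun l => ‖(freq a b l : ℂ) ^ (p + 2) * c l‖ ^ 2)
    (hM : ∑' l, ‖(freq a b l : ℂ) ^ (p + 2) * c l‖ ^ 2 ≤ M ^ 2) :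
    sn (modes N) (fun l => (freq a b l : ℂ) ^ p *
      (c l - coef a b (avgGrid a b N) (syn a b c) l)) ≤ aliasConst * mesh a b N ^ 2 * M := by
  refine sn_alias_le hab hN hc hM0 (sq_nonneg _) hd hM fun l hl k hk => ?_
  obtain ⟨h1, h2⟩ := abs_freq_alias_ge hab hN hl hk
  have hh := mesh_pos hab hN
  have hk' : (0 : ℝ) < |(k : ℝ)| := abs_pos.2 (by exact_mod_cast hk)
  rw [norm_mul, norm_mul, norm_pow, norm_pow, Complex.norm_real, Complex.norm_real,
    Real.norm_eq_abs, Real.norm_eq_abs, ← sq_abs (k : ℝ)]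
  set f := |freq a b (l + k * N)|
  -- Two derivatives are spent to produce `h²` and the summable weight `1/k²`.
  have h3 : 1 ≤ mesh a b N ^ 2 * (1 / |(k : ℝ)| ^ 2 * f ^ 2) := by
    rw [div_le_iff₀ hh] at h1
    have : mesh a b N ^ 2 * (1 / |(k : ℝ)| ^ 2 * f ^ 2) = (f * mesh a b N / |(k : ℝ)|) ^ 2 := by
      field_simp
    rw [this]
    exact one_le_pow₀ ((one_le_div hk').2 h1)
  have h4 : |freq a b l| ^ p ≤ f ^ p := pow_le_pow_left₀ (abs_nonneg _) h2 p
  calc |freq a b l| ^ p * ‖c (l + k * N)‖ ≤ f ^ p * ‖c (l + k * N)‖ := by gcongr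
    _ ≤ (mesh a b N ^ 2 * (1 / |(k : ℝ)| ^ 2 * f ^ 2)) * (f ^ p * ‖c (l + k * N)‖) :=
        le_mul_of_one_le_left (by positivity) h3
    _ = _ := by ring

end GPE

/-! ### The solution as a curve of Fourier coefficients, and consistency in `L²`. -/

namespace GPE

variable {a b T β M B K τ : ℝ} {V : ℝ → ℝ} {N : ℕ}

/-- The Fourier coefficients of a curve with uniform bounds `M` in `L^∞ ∩ H²` and a Lipschitz bound
`K` in `L²`, together with a bound `B` of the potential `V`. -/
structure FourierCurve (a b T M B K : ℝ) (V : ℝ → ℝ) (c : ℝ → ℤ → ℂ) : Prop where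
  M_nonneg : 0 ≤ M
  B_nonneg : 0 ≤ B
  K_nonneg : 0 ≤ K
  meas : AEStronglyMeasurable V (vol a b)
  bound : ∀ᵐ x ∂vol a b, |V x| ≤ B
  summable : ∀ t ∈ Icc 0 T, Summable fun l => ‖c t l‖
  tsum_le : ∀ t ∈ Icc 0 T, ∑' l, ‖c t l‖ ≤ M
  summable_sq : ∀ t ∈ Icc 0 T, Summable fun l => ‖(freq a b l : ℂ) ^ 2 * c t l‖ ^ 2
  tsum_sq_le : ∀ t ∈ Icc 0 T, ∑' l, ‖(freq a b l : ℂ) ^ 2 * c t l‖ ^ 2 ≤ M ^ 2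
  lip : ∀ s ∈ Icc 0 T, ∀ t ∈ Icc 0 T,
    l2 (avgVol a b) (fun x => syn a b (c t) x - syn a b (c s) x) ≤ K * |t - s|

/-- A solution of the Gross-Pitaevskii equation in Fourier space. -/
structure FourierFlow (a b T β M B K : ℝ) (V : ℝ → ℝ) (c : ℝ → ℤ → ℂ) : Prop
    extends FourierCurve a b T M B K V c where
  ode : ∀ t ∈ Icc 0 T, ∀ l, HasDerivWithinAt (fun s => c s l)
    (-Complex.I * (((freq a b l ^ 2 : ℝ) : ℂ) * c t l + forceCoef a b β V (c t) l)) (Icc 0 T) t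

lemma norm_potential_mul_le {V : ℝ → ℝ} (hB : ∀ᵐ x ∂vol a b, |V x| ≤ B) (g : ℝ → ℂ) :
    ∀ᵐ x ∂avgVol a b, ‖(V x : ℂ) * g x‖ ≤ B * ‖g x‖ := by
  filter_upwards [ae_avgVol_iff.2 hB] with x hx
  rw [norm_mul, Complex.norm_real, Real.norm_eq_abs]
  exact mul_le_mul_of_nonneg_right hx (norm_nonneg _)

lemma l2_tail_le (hab : a < b) (hN : 0 < N) {c : ℤ → ℂ} (hM0 : 0 ≤ M)
    (hc : Summable fun l => ‖c l‖) (hd : Summable fun l => ‖(freq a b l : ℂ) ^ 2 * c l‖ ^ 2)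
    (hM : ∑' l, ‖(freq a b l : ℂ) ^ 2 * c l‖ ^ 2 ≤ M ^ 2) {S : Finset ℤ}
    (hS : ∀ l ∉ S, 1 / mesh a b N ≤ |freq a b l|) :
    l2 (avgVol a b) (fun x => syn a b c x - trig a b S c x) ≤ mesh a b N ^ 2 * M := by
  simp_rw [syn_sub_trig hc S]
  exact l2_syn_le hab (sq_nonneg _) hM0 (summable_ite_not_mem hc S) hd hM
    (norm_tail_le (mesh_pos hab hN) hS 2)

/-- Consistency error of one time step in `L²`. -/
lemma sn_defect_le_l2 (hab : a < b) (hN : 0 < N) (hNe : Even N) (hτ : 0 ≤ τ)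
    (hV : AEStronglyMeasurable V (vol a b)) (hB0 : 0 ≤ B) (hB : ∀ᵐ x ∂vol a b, |V x| ≤ B)
    {c d : ℤ → ℂ} (hc : Summable fun l => ‖c l‖) {η : ℝ} (hη : 0 ≤ η)
    (hcM : ∑' l, ‖c l‖ ≤ M) (hdM : ∑ l ∈ modes N, ‖d l‖ ≤ M)
    (h1 : l2 (avgVol a b) (fun x => syn a b c x - trig a b (modes N) c x) ≤ η)
    (h2 : l2 (avgVol a b) (fun x => syn a b c x - trig a b (lowModes N) c x) ≤ η) :
    sn (modes N) (fun l => (-Complex.I * τ * forceCoef a b β V c l -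
      (coef a b (avgVol a b) (fun x => Complex.exp (-Complex.I * ((τ * V x : ℝ) : ℂ)) *
        trig a b (modes N) (flowCoef a b τ β N d) x) l - d l))) ≤
    τ * ((B + 6 * |β| * M ^ 2) * (η + sn (modes N) (fun l => c l - d l)) +
      M * (B + |β| * M ^ 2) ^ 2 * τ) := by
  have hp0 := avgVol_prob hab
  have hν0 := isAveraging_avgVol hab N
  have hνN := isAveraging_avgGrid hab hN
  have hpN := hνN.prob
  have hM0 : 0 ≤ M := (tsum_nonneg fun _ => norm_nonneg _).trans hcM
  have h := sn_defect_le (β := β) (d := d) hab hN hNe hτ hV hB hc (fun _ => 1)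
  simp only [one_mul] at h
  refine h.trans ?_
  set S := modes N
  set ε := sn S (fun l => c l - d l)
  have hε : 0 ≤ ε := sn_nonneg _ _
  set w := flowCoef a b τ β N d with hw
  have hΨ : ∀ x, ‖syn a b c x‖ ≤ M := fun x => (norm_syn_le hc x).trans hcM
  have hu : ∀ x, ‖trig a b S d x‖ ≤ M := fun x => (norm_trig_le S d x).trans hdM
  have hq : ∀ S' x, ‖trig a b S' c x‖ ≤ M := fun S' x =>
    (norm_trig_le S' c x).trans ((hc.sum_le_tsum S' fun _ _ => norm_nonneg _).trans hcM)
  have mΨ : ∀ S', MemLp (fun x => syn a b c x - trig a b S' c x) 2 (avgVol a b) := fun S' =>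
    (memLp_syn hc).sub (memLp_trig S' c)
  have mV := fun {g : ℝ → ℂ} (hg : MemLp g 2 (avgVol a b)) => memLp_potential_mul hV hB hg
  have lV : ∀ g : ℝ → ℂ, MemLp g 2 (avgVol a b) →
      sn S (coef a b (avgVol a b) (fun x => (V x : ℂ) * g x)) ≤ B * l2 (avgVol a b) g := fun g hg =>
    (hν0.bessel (mV hg)).trans (l2_mono hB0 hg (norm_potential_mul_le hB g))
  have mF : MemLp (fun x => cubFlow τ β (trig a b S d x)) 2 (avgGrid a b N) :=
    memLp_of_bound ((continuous_cubFlow τ β).comp (continuous_trig a b S d)).aestronglyMeasurable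
      fun x => (norm_cubFlow τ β _).trans_le (hu x)
  have hwM : sn S w ≤ M := (hνN.bessel mF).trans (l2_le_of_bound hM0
    (Eventually.of_forall fun x => (norm_cubFlow τ β _).trans_le (hu x)))
  -- The cubic flow moves each value by `O(τ)`, so letting `V` act after it rather than before costs
  -- only `O(τ²)`.
  have hwd : sn S (fun l => w l - d l) ≤ τ * |β| * M ^ 2 * M := by
    have mS : MemLp (fun x => cubFlow τ β (trig a b S d x) - trig a b S d x) 2
        (avgGrid a b N) := mF.sub (memLp_trig S d)
    have e : sn S (fun l => w l - d l) = sn S (coef a b (avgGrid a b N)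
        (fun x => cubFlow τ β (trig a b S d x) - trig a b S d x)) := sn_congr fun l hl => by
      rw [coef_sub mF (memLp_trig S d), hνN.coef_trig subset_rfl _ hl, if_pos hl, hw, flowCoef]
    rw [e]
    exact (hνN.bessel mS).trans (l2_le_of_bound (by positivity)
      (Eventually.of_forall fun x => norm_cubFlow_sub_self_le hτ (hu x)))
  have t1 := (lV _ (mΨ S)).trans (mul_le_mul_of_nonneg_left h1 hB0)
  have t2 := lV (trig a b S (fun l => c l - d l)) (memLp_trig S _)
  rw [hν0.l2_trig subset_rfl] at t2
  have t3 := lV (trig a b S (fun l => w l - d l)) (memLp_trig S _)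
  rw [hν0.l2_trig subset_rfl] at t3
  replace t3 := t3.trans (mul_le_mul_of_nonneg_left hwd hB0)
  have t4 : sn S (coef a b (avgVol a b) (fun x => expRem (τ * V x) * trig a b S w x)) ≤
      (τ * B) ^ 2 * M := by
    have hb : ∀ᵐ x ∂vol a b, ‖expRem (τ * V x)‖ ≤ (τ * B) ^ 2 := by
      filter_upwards [hB] with x hx
      refine norm_expRem_le ?_
      rw [abs_mul, abs_of_nonneg hτ]
      exact mul_le_mul_of_nonneg_left hx hτ
    have m4 : MemLp (fun x => expRem (τ * V x) * trig a b S w x) 2 (avgVol a b) :=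
      memLp_continuous_potential_mul hV (k := fun y => expRem (τ * y))
        (continuous_expRem.comp (continuous_const_mul τ)) hb (memLp_trig S w)
    refine (hν0.bessel m4).trans ((l2_mono (sq_nonneg (τ * B)) (memLp_trig S w) ?_).trans
      (mul_le_mul_of_nonneg_left ((hν0.l2_trig subset_rfl w).trans_le hwM) (sq_nonneg _)))
    filter_upwards [ae_avgVol_iff.2 hb] with x hx
    rw [norm_mul]
    exact mul_le_mul_of_nonneg_right hx (norm_nonneg _)
  have t5 : sn S (coef a b (avgVol a b)
      (fun x => cub (syn a b c x) - cub (trig a b (lowModes N) c x))) ≤ 3 * M ^ 2 * η := by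
    have m5 : MemLp (fun x => cub (syn a b c x) - cub (trig a b (lowModes N) c x)) 2
        (avgVol a b) := (memLp_cub (continuous_syn hc) hΨ).sub
      (memLp_cub (continuous_trig _ _ _ _) (hq (lowModes N)))
    refine (hν0.bessel m5).trans ((l2_mono (by positivity) (mΨ (lowModes N)) ?_).trans
      (mul_le_mul_of_nonneg_left h2 (by positivity)))
    exact Eventually.of_forall fun x => norm_cub_sub_le (hΨ x) (hq _ x)
  -- The low part of `c` differs from `d` by the error minus the discarded tail.
  have hlow : sn S (fun l => (if l ∈ lowModes N then c l else 0) - d l) ≤ η + ε := by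
    have e : ∀ l, (if l ∈ lowModes N then c l else 0) - d l =
        (c l - d l) - (if l ∈ lowModes N then 0 else c l) := fun l => by split_ifs <;> ring
    simp_rw [e]
    have h3 : sn S (fun l => if l ∈ lowModes N then 0 else c l) ≤ η := by
      have hs := summable_ite_not_mem hc (lowModes N)
      have h4 := l2_syn_sq hab hs
      refine sn_le_of_tsum S h4.summable hη ?_
      rw [h4.tsum_eq]
      have h5 : syn a b (fun l => if l ∈ lowModes N then 0 else c l) =
          fun x => syn a b c x - trig a b (lowModes N) c x :=
        funext fun x => (syn_sub_trig hc _ x).symm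
      rw [h5]
      exact pow_le_pow_left₀ (l2_nonneg _ _) h2 2
    refine (sn_sub_le _ _ _).trans ?_
    linarith
  have t6 : sn S (coef a b (avgGrid a b N)
      (fun x => cub (trig a b (lowModes N) c x) - cub (trig a b S d x))) ≤ 3 * M ^ 2 * (η + ε) := by
    have m6 : MemLp (fun x => cub (trig a b (lowModes N) c x) - cub (trig a b S d x)) 2
        (avgGrid a b N) := (memLp_cub (continuous_trig _ _ _ _) (hq (lowModes N))).sub
      (memLp_cub (continuous_trig _ _ _ _) hu)
    have m6' := memLp_trig (a := a) (b := b) (ν := avgGrid a b N) S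
      (fun l => (if l ∈ lowModes N then c l else 0) - d l)
    refine (hνN.bessel m6).trans ((l2_mono (by positivity) m6' ?_).trans
      (mul_le_mul_of_nonneg_left ((hνN.l2_trig subset_rfl _).trans_le hlow) (by positivity)))
    refine Eventually.of_forall fun x => (norm_cub_sub_le (hq _ x) (hu x)).trans (le_of_eq ?_)
    congr 2
    simp only [trig, sub_mul, Finset.sum_sub_distrib]
    congr 1
    rw [← Finset.sum_subset (lowModes_subset N)]
    · exact Finset.sum_congr rfl fun l hl => by rw [if_pos hl]
    · intro l _ hl; rw [if_neg hl, zero_mul]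
  have t7 : sn S (coef a b (avgGrid a b N) (fun x => cubRem τ β (trig a b S d x))) ≤
      (τ * |β| * M ^ 2) ^ 2 * M := by
    have hb : ∀ x, ‖cubRem τ β (trig a b S d x)‖ ≤ (τ * |β| * M ^ 2) ^ 2 * M := fun x =>
      norm_cubRem_le hτ (hu x)
    exact (hνN.bessel (memLp_of_bound
      ((continuous_cubRem τ β).comp (continuous_trig a b S d)).aestronglyMeasurable hb)).trans
      (l2_le_of_bound (by positivity) (Eventually.of_forall hb))
  have hβ := abs_nonneg β
  have u1 := mul_le_mul_of_nonneg_left t1 hτ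
  have u2 := mul_le_mul_of_nonneg_left t2 hτ
  have u3 := mul_le_mul_of_nonneg_left t3 hτ
  have u5 := mul_le_mul_of_nonneg_left t5 (mul_nonneg hτ hβ)
  have u6 := mul_le_mul_of_nonneg_left t6 (mul_nonneg hτ hβ)
  -- Slack in the closed form: `6|β|M²` counts `ε` twice where once suffices, and the square `(B +
  -- |β|M²)²` contains the cross term twice.
  have u8 : 0 ≤ τ * |β| * M ^ 2 * ε := by positivity
  have u9 : 0 ≤ τ ^ 2 * (B * |β| * M ^ 3) := by positivity
  calc _ ≤ τ * (B * η) + τ * (B * ε) + τ * (B * (τ * |β| * M ^ 2 * M)) + (τ * B) ^ 2 * M +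
        τ * |β| * (3 * M ^ 2 * η) + τ * |β| * (3 * M ^ 2 * (η + ε)) +
        (τ * |β| * M ^ 2) ^ 2 * M :=
        add_le_add (add_le_add (add_le_add (add_le_add (add_le_add (add_le_add u1 u2) u3) t4) u5) u6)
          t7
    _ ≤ _ := by linarith

namespace FourierCurve

variable {c : ℝ → ℤ → ℂ}

lemma norm_syn_le (hc : FourierCurve a b T M B K V c) {t : ℝ} (ht : t ∈ Icc 0 T) (x : ℝ) :
    ‖syn a b (c t) x‖ ≤ M := (GPE.norm_syn_le (hc.summable t ht) x).trans (hc.tsum_le t ht)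

lemma sn_force_le (hc : FourierCurve a b T M B K V c) (hab : a < b) {t : ℝ} (ht : t ∈ Icc 0 T) :
    sn (modes N) (forceCoef a b β V (c t)) ≤ (B + |β| * M ^ 2) * M := by
  have hp0 := avgVol_prob hab
  have hΨ := hc.norm_syn_le ht
  have m1 := memLp_potential_mul hc.meas hc.bound
    (memLp_syn (a := a) (b := b) (ν := avgVol a b) (hc.summable t ht))
  have m2 : MemLp (fun x => cub (syn a b (c t) x)) 2 (avgVol a b) :=
    memLp_cub (continuous_syn (hc.summable t ht)) hΨ
  refine ((isAveraging_avgVol hab N).bessel (m1.add (m2.const_mul (β : ℂ)))).trans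
    (l2_le_of_bound (mul_nonneg (by have := hc.B_nonneg; positivity) hc.M_nonneg) ?_)
  filter_upwards [norm_potential_mul_le hc.bound (syn a b (c t))] with x hx
  refine (norm_add_le _ _).trans ?_
  rw [norm_mul (β : ℂ), norm_cub, Complex.norm_real, Real.norm_eq_abs]
  have h1 := mul_le_mul_of_nonneg_left (hΨ x) hc.B_nonneg
  have h2 := mul_le_mul_of_nonneg_left (pow_le_pow_left₀ (norm_nonneg _) (hΨ x) 3) (abs_nonneg β)
  nlinarith

lemma sn_force_sub_le (hc : FourierCurve a b T M B K V c) (hab : a < b) {s t : ℝ}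
    (hs : s ∈ Icc 0 T) (ht : t ∈ Icc 0 T) :
    sn (modes N) (fun l => forceCoef a b β V (c t) l - forceCoef a b β V (c s) l) ≤
      (B + 3 * |β| * M ^ 2) * K * |t - s| := by
  have hp0 := avgVol_prob hab
  have m1 : ∀ r ∈ Icc 0 T, MemLp (fun x => (V x : ℂ) * syn a b (c r) x + β * cub (syn a b (c r) x)) 2
      (avgVol a b) := fun r hr =>
    (memLp_potential_mul hc.meas hc.bound (memLp_syn (hc.summable r hr))).add
      ((memLp_cub (continuous_syn (hc.summable r hr)) (hc.norm_syn_le hr)).const_mul (β : ℂ))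
  have e : (fun l => forceCoef a b β V (c t) l - forceCoef a b β V (c s) l) =
      coef a b (avgVol a b) (fun x => ((V x : ℂ) * syn a b (c t) x + β * cub (syn a b (c t) x)) -
        ((V x : ℂ) * syn a b (c s) x + β * cub (syn a b (c s) x))) :=
    funext fun l => (coef_sub (m1 t ht) (m1 s hs) l).symm
  have h0 : 0 ≤ B + 3 * |β| * M ^ 2 := by have := hc.B_nonneg; positivity
  have mΨ : MemLp (fun x => syn a b (c t) x - syn a b (c s) x) 2 (avgVol a b) :=
    (memLp_syn (hc.summable t ht)).sub (memLp_syn (hc.summable s hs))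
  have mm : MemLp (fun x => ((V x : ℂ) * syn a b (c t) x + β * cub (syn a b (c t) x)) -
        ((V x : ℂ) * syn a b (c s) x + β * cub (syn a b (c s) x))) 2 (avgVol a b) :=
    (m1 t ht).sub (m1 s hs)
  rw [e, mul_assoc]
  refine ((isAveraging_avgVol hab N).bessel mm).trans ((l2_mono h0 mΨ ?_).trans
    (mul_le_mul_of_nonneg_left (hc.lip s hs t ht) h0))
  filter_upwards [norm_potential_mul_le hc.bound (fun x => syn a b (c t) x - syn a b (c s) x)]
    with x hx
  have e2 : ((V x : ℂ) * syn a b (c t) x + β * cub (syn a b (c t) x)) -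
        ((V x : ℂ) * syn a b (c s) x + β * cub (syn a b (c s) x)) =
      (V x : ℂ) * (syn a b (c t) x - syn a b (c s) x) +
        β * (cub (syn a b (c t) x) - cub (syn a b (c s) x)) := by ring
  rw [e2]
  refine (norm_add_le _ _).trans ?_
  rw [norm_mul (β : ℂ), Complex.norm_real, Real.norm_eq_abs]
  have := mul_le_mul_of_nonneg_left (norm_cub_sub_le (hc.norm_syn_le ht x) (hc.norm_syn_le hs x))
    (abs_nonneg β)
  linarith

end FourierCurve

namespace FourierFlow

variable {c : ℝ → ℤ → ℂ} {ψ₀ : ℝ → ℂ}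

/-- The error recursion, `A` being the local error of freezing the force and the remaining
part of the bracket the defect of the scheme. -/
lemma error_succ (hab : a < b) (hN : 0 < N) (hNe : Even N) (t : ℝ) (n : ℕ)
    {l : ℤ} (hl : l ∈ modes N) :
    c (t + τ) l - numCoef a b β V ψ₀ τ N (n + 1) l =
      Complex.exp (-Complex.I * ((τ * freq a b l ^ 2 : ℝ) : ℂ)) *
      ((c t l - numCoef a b β V ψ₀ τ N n l) +
        -Complex.I * (osc (freq a b l ^ 2) τ - τ) * forceCoef a b β V (c t) l +
        ((Complex.exp (Complex.I * ((τ * freq a b l ^ 2 : ℝ) : ℂ)) * c (t + τ) l - c t l +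
          Complex.I * osc (freq a b l ^ 2) τ * forceCoef a b β V (c t) l) +
        (-Complex.I * τ * forceCoef a b β V (c t) l -
      (coef a b (avgVol a b) (fun x => Complex.exp (-Complex.I * ((τ * V x : ℝ) : ℂ)) *
        trig a b (modes N) (flowCoef a b τ β N (numCoef a b β V ψ₀ τ N n)) x) l -
          numCoef a b β V ψ₀ τ N n l)))) := by
  have e := numCoef_succ (β := β) (τ := τ) (V := V) (ψ₀ := ψ₀) hab hN hNe n hl
  have ez : Complex.exp (-Complex.I * ((τ * freq a b l ^ 2 : ℝ) : ℂ)) *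
      Complex.exp (Complex.I * ((τ * freq a b l ^ 2 : ℝ) : ℂ)) = 1 := by
    rw [← Complex.exp_add]; simp
  rw [e]
  change _ - _ * coef a b (avgVol a b) (fun x => _ * trig a b (modes N)
    (flowCoef a b τ β N (numCoef a b β V ψ₀ τ N n)) x) l = _
  linear_combination (-c (t + τ) l) * ez

lemma sn_duhamel_le_l2 (hc : FourierFlow a b T β M B K V c) (hab : a < b) {t : ℝ} (ht : 0 ≤ t)
    (hτ : 0 ≤ τ) (htT : t + τ ≤ T) :
    sn (modes N) (fun l => Complex.exp (Complex.I * ((τ * freq a b l ^ 2 : ℝ) : ℂ)) * c (t + τ) l -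
      c t l + Complex.I * osc (freq a b l ^ 2) τ * forceCoef a b β V (c t) l) ≤
      (B + 3 * |β| * M ^ 2) * K * τ ^ 2 := by
  have h0 : 0 ≤ (B + 3 * |β| * M ^ 2) * K := by
    have := hc.B_nonneg; have := hc.K_nonneg; positivity
  have h := sn_duhamel_le (S := modes N) (κ := fun l => freq a b l ^ 2) (wt := fun _ => 1)
    (c := c) (F := fun t => forceCoef a b β V (c t)) ht hτ htT h0 hc.ode (fun s hs => by
      have := hc.sn_force_sub_le (β := β) hab (N := N) (s := t) (t := t + s) ⟨ht, by linarith⟩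
        ⟨by linarith [hs.1], by linarith [hs.2]⟩
      simpa [abs_of_nonneg hs.1] using this)
  simpa using h

end FourierFlow

end GPE

/-! ### The `L²` error estimate. -/

namespace GPE

variable {a b T β M B K τ : ℝ} {V : ℝ → ℝ} {N : ℕ}

lemma card_modes_le (N : ℕ) : ((modes N).card : ℝ) ≤ N := by
  have : (modes N).card ≤ N := by
    unfold modes
    rw [Int.card_Ico]
    omega
  exact_mod_cast this

lemma sum_modes_norm_le (N : ℕ) (c : ℤ → ℂ) : ∑ l ∈ modes N, ‖c l‖ ≤ Real.sqrt N * sn (modes N) c := by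
  have h := sum_norm_mul_le_sn_mul_sn (modes N) (fun _ => 1) c
  simp only [abs_one, one_mul, one_pow, Finset.sum_const, nsmul_eq_mul, mul_one] at h
  exact h.trans (mul_le_mul_of_nonneg_right (Real.sqrt_le_sqrt (card_modes_le N)) (sn_nonneg _ _))

lemma sum_modes_norm_le_add {c d : ℤ → ℂ} (hc : Summable fun l => ‖c l‖) (hM : ∑' l, ‖c l‖ ≤ M) :
    ∑ l ∈ modes N, ‖d l‖ ≤ M + Real.sqrt N * sn (modes N) (fun l => c l - d l) := by
  have h1 : ∀ l ∈ modes N, ‖d l‖ ≤ ‖c l‖ + ‖c l - d l‖ := fun l _ => by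
    have := norm_sub_norm_le (d l) (c l)
    rw [norm_sub_rev] at this
    linarith
  refine (Finset.sum_le_sum h1).trans ?_
  rw [Finset.sum_add_distrib]
  exact add_le_add ((hc.sum_le_tsum _ fun _ _ => norm_nonneg _).trans hM) (sum_modes_norm_le N _)

/-- Because `Nh = b - a`, the loss `√N` of passing from `ℓ²` to `ℓ¹` is beaten by an error of size
`h²`, with a power of `h` to spare. -/
lemma sqrt_mul_mesh_sq_le (hab : a < b) (hN : 0 < N) (h1 : mesh a b N ≤ 1) :
    Real.sqrt N * mesh a b N ^ 2 ≤ Real.sqrt (b - a) * mesh a b N := by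
  have hh := mesh_pos hab hN
  have hN' : (0 : ℝ) < N := by exact_mod_cast hN
  have e : (N : ℝ) * mesh a b N = b - a := by unfold mesh; field_simp
  have h : Real.sqrt N * mesh a b N ≤ Real.sqrt (b - a) := by
    refine Real.le_sqrt_of_sq_le ?_
    rw [mul_pow, Real.sq_sqrt hN'.le, sq, ← mul_assoc, e]
    exact mul_le_of_le_one_right (sub_pos.2 hab).le h1
  rw [sq, ← mul_assoc]
  exact mul_le_mul_of_nonneg_right h hh.le

/-- The role of the step size restriction: with `|μ| ≤ π/h` it keeps the phase `τμ²` of every mode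
within half a turn, as `exists_filter` requires. -/
lemma step_mul_freq_sq_le (hab : a < b) (hτ : τ ≤ mesh a b N ^ 2 / Real.pi) {l : ℤ}
    (hl : l ∈ modes N) : τ * freq a b l ^ 2 ≤ Real.pi := by
  have h := pow_le_pow_left₀ (abs_nonneg _) (abs_freq_mul_mesh_le hab hl) 2
  rw [sq_abs, mul_pow] at h
  have hpi := Real.pi_pos
  calc τ * freq a b l ^ 2 ≤ mesh a b N ^ 2 / Real.pi * freq a b l ^ 2 := by gcongr
    _ = freq a b l ^ 2 * mesh a b N ^ 2 / Real.pi := by ring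
    _ ≤ Real.pi ^ 2 / Real.pi := by gcongr
    _ = Real.pi := by field_simp

lemma step_le_mesh_sq (hτ : τ ≤ mesh a b N ^ 2 / Real.pi) : τ ≤ mesh a b N ^ 2 := by
  refine hτ.trans (div_le_self (sq_nonneg _) ?_)
  linarith [Real.pi_gt_three]

lemma coef_avgGrid_init (hab : a < b) (hN : 0 < N) {ψ₀ g : ℝ → ℂ}
    (hψ₀ : ∀ x ∈ Icc a b, ψ₀ x = g x) (l : ℤ) :
    coef a b (avgGrid a b N) ψ₀ l = coef a b (avgGrid a b N) g l := by
  refine coef_avgGrid_congr (fun j hj => hψ₀ _ ?_) l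
  have hh := mesh_pos hab hN
  have hjN : (j : ℝ) ≤ N := by exact_mod_cast hj.le
  have h2 := gridPt_self a b hN
  unfold gridPt at h2 ⊢
  constructor
  · have : 0 ≤ (j : ℝ) * mesh a b N := by positivity
    linarith
  · have := mul_le_mul_of_nonneg_right hjN hh.le
    linarith

/-- Monotonicity of the bound resulting from the error recursion. -/
lemma recursion_bound_le {Q n T F C E τ h2 δ δ₁ δ₂ : ℝ} (hQ : 0 ≤ Q) (hn : n * τ ≤ T) (hT : 0 ≤ T)
    (hF : 0 ≤ F) (hC : 0 ≤ C) (hτ : 0 ≤ τ) (hh : 0 ≤ h2) {e0 : ℝ} (he0 : 0 ≤ e0)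
    (hE : E ≤ e0 * h2) (hδ : δ = δ₁ * τ + δ₂ * h2) (h1 : 0 ≤ δ₁) (h2' : 0 ≤ δ₂) :
    Real.exp (Q * (n * τ)) * (E + 2 * τ * F + n * τ * (δ + 2 * Q * τ * F + 2 * τ * C)) +
      2 * τ * F ≤
    (Real.exp (Q * T) * (e0 + 2 * F + T * (δ₁ + δ₂ + 2 * Q * F + 2 * C)) + 2 * F) * (τ + h2) := by
  have hX : 0 ≤ δ + 2 * Q * τ * F + 2 * τ * C := by rw [hδ]; positivity
  have hexp : Real.exp (Q * (n * τ)) ≤ Real.exp (Q * T) :=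
    Real.exp_le_exp.2 (mul_le_mul_of_nonneg_left hn hQ)
  have hX2 : δ + 2 * Q * τ * F + 2 * τ * C ≤ (δ₁ + δ₂ + 2 * Q * F + 2 * C) * (τ + h2) := by
    have e1 : 0 ≤ δ₁ * h2 := by positivity
    have e2 : 0 ≤ δ₂ * τ := by positivity
    have e3 : 0 ≤ 2 * Q * F * h2 := by positivity
    have e4 : 0 ≤ 2 * C * h2 := by positivity
    rw [hδ]; linarith
  have hY : E + 2 * τ * F + n * τ * (δ + 2 * Q * τ * F + 2 * τ * C) ≤
      (e0 + 2 * F + T * (δ₁ + δ₂ + 2 * Q * F + 2 * C)) * (τ + h2) := by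
    have e1 := mul_le_mul hn hX2 hX hT
    have e2 : 0 ≤ e0 * τ := by positivity
    have e3 : 0 ≤ F * h2 := by positivity
    linarith
  have hY0 : 0 ≤ (e0 + 2 * F + T * (δ₁ + δ₂ + 2 * Q * F + 2 * C)) * (τ + h2) := by positivity
  have h3 := (mul_le_mul_of_nonneg_left hY (Real.exp_pos _).le).trans
    (mul_le_mul_of_nonneg_right hexp hY0)
  have e3 : 0 ≤ F * h2 := by positivity
  linarith

namespace FourierFlow

variable {c : ℝ → ℤ → ℂ} {ψ₀ : ℝ → ℂ}

/-- The `L²` error estimate for the Fourier coefficients, together with the uniform bound of the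
numerical solution. -/
theorem l2_error (hc : FourierFlow a b T β M B K V c) (hab : a < b) (hT : 0 < T)
    (hψ₀ : ∀ x ∈ Icc a b, ψ₀ x = syn a b (c 0) x) :
    ∃ h₀ : ℝ, 0 < h₀ ∧ h₀ ≤ 1 ∧ ∃ C : ℝ, 0 < C ∧ ∀ (N : ℕ) (τ : ℝ), 0 < N → Even N →
      mesh a b N < h₀ → 0 < τ → τ ≤ mesh a b N ^ 2 / Real.pi → ∀ n : ℕ, n * τ ≤ T →
        sn (modes N) (fun l => c (n * τ) l - numCoef a b β V ψ₀ τ N n l) ≤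
          C * (τ + mesh a b N ^ 2) ∧
        ∑ l ∈ modes N, ‖numCoef a b β V ψ₀ τ N n l‖ ≤ M + 1 := by
  have hB0 := hc.B_nonneg
  have hM0 := hc.M_nonneg
  have hK0 := hc.K_nonneg
  have h0T : (0 : ℝ) ∈ Icc 0 T := ⟨le_rfl, hT.le⟩
  -- Stability and defect constants are computed with the bound `M + 1` that the induction will
  -- establish for the numerical solution, so that `C` is fixed before `h₀`.
  set Q := B + 6 * |β| * (M + 1) ^ 2 with hQ
  set P := (M + 1) * (B + |β| * (M + 1) ^ 2) ^ 2 with hP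
  set Mf := (B + |β| * M ^ 2) * M with hMf
  set Kf := (B + 3 * |β| * M ^ 2) * K with hKf
  have hQ0 : 0 ≤ Q := by positivity
  have hP0 : 0 ≤ P := by positivity
  have hMf0 : 0 ≤ Mf := by positivity
  have hKf0 : 0 ≤ Kf := by positivity
  have hA0 := aliasConst_nonneg
  set C := Real.exp (Q * T) * (aliasConst * M + 2 * Mf +
    T * ((Kf + P) + Q * M + 2 * Q * Mf + 2 * Kf)) + 2 * Mf + 1 with hC
  have hC0 : 0 < C := by positivity
  -- Chosen so that `√N · C (τ + h²) ≤ 2C √(b - a) h ≤ 1` whenever `h < h₀`.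
  set h₀ := min 1 (1 / (2 * C * Real.sqrt (b - a) + 1)) with hh₀
  have hden : 0 < 2 * C * Real.sqrt (b - a) + 1 := by positivity
  refine ⟨h₀, lt_min one_pos (by positivity), min_le_left _ _, C, hC0, ?_⟩
  intro N τ hN hNe hmesh hτ hτh
  have hh := mesh_pos hab hN
  have hτ2 := step_le_mesh_sq hτh
  have hboot : ∀ n : ℕ, n * τ ≤ T →
      sn (modes N) (fun l => c (n * τ) l - numCoef a b β V ψ₀ τ N n l) ≤ C * (τ + mesh a b N ^ 2) →
      ∑ l ∈ modes N, ‖numCoef a b β V ψ₀ τ N n l‖ ≤ M + 1 := fun n hn h => by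
    have ht : (n : ℝ) * τ ∈ Icc 0 T := ⟨by positivity, hn⟩
    refine (sum_modes_norm_le_add (hc.summable _ ht) (hc.tsum_le _ ht)).trans
      (add_le_add le_rfl ?_)
    have h1 := sqrt_mul_mesh_sq_le hab hN (hmesh.le.trans (min_le_left _ _))
    have h2 : mesh a b N * (2 * C * Real.sqrt (b - a) + 1) ≤ 1 :=
      (le_div_iff₀ hden).1 (hmesh.le.trans (min_le_right _ _))
    calc _ ≤ Real.sqrt N * (C * (τ + mesh a b N ^ 2)) := by gcongr
      _ ≤ Real.sqrt N * (C * (mesh a b N ^ 2 + mesh a b N ^ 2)) := by gcongr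
      _ = 2 * C * (Real.sqrt N * mesh a b N ^ 2) := by ring
      _ ≤ 2 * C * (Real.sqrt (b - a) * mesh a b N) := by gcongr
      _ ≤ 1 := by linarith
  suffices hmain : ∀ n : ℕ, n * τ ≤ T →
      sn (modes N) (fun l => c (n * τ) l - numCoef a b β V ψ₀ τ N n l) ≤
        C * (τ + mesh a b N ^ 2) from fun n hn => ⟨hmain n hn, hboot n hn (hmain n hn)⟩
  intro n
  -- The recursion is rerun from time zero for each `n`, because summation by parts uses all earlier
  -- steps. The hypothesis supplies the sup bound at each `k < n`, and the constant obtained does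
  -- not depend on `n`.
  induction n using Nat.strong_induction_on with
  | _ n ih =>
  intro hn
  have hk : ∀ k ≤ n, (k : ℝ) * τ ∈ Icc 0 T := fun k hk => by
    have : (k : ℝ) ≤ n := by exact_mod_cast hk
    exact ⟨by positivity, le_trans (by gcongr) hn⟩
  have hsucc : ∀ k : ℕ, ((k + 1 : ℕ) : ℝ) * τ = k * τ + τ := fun k => by push_cast; ring
  have hrec := sn_recursion_le (S := modes N) (κ := fun l => freq a b l ^ 2) (τ := τ)
    (E := fun k l => c (k * τ) l - numCoef a b β V ψ₀ τ N k l)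
    (F := fun k => forceCoef a b β V (c (k * τ)))
    (R := fun k l => (Complex.exp (Complex.I * ((τ * freq a b l ^ 2 : ℝ) : ℂ)) * c (k * τ + τ) l -
        c (k * τ) l + Complex.I * osc (freq a b l ^ 2) τ * forceCoef a b β V (c (k * τ)) l) +
      (-Complex.I * τ * forceCoef a b β V (c (k * τ)) l -
      (coef a b (avgVol a b) (fun x => Complex.exp (-Complex.I * ((τ * V x : ℝ) : ℂ)) *
        trig a b (modes N) (flowCoef a b τ β N (numCoef a b β V ψ₀ τ N k)) x) l -
          numCoef a b β V ψ₀ τ N k l)))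
    (n := n) (M := Mf) (K := Kf) (Q := Q) (δ := (Kf + P) * τ + Q * M * mesh a b N ^ 2)
    hτ (fun l => sq_nonneg _) (fun l hl => step_mul_freq_sq_le hab hτh hl) hMf0 hKf0 hQ0
    (by positivity)
    (fun k _ l hl => by
      rw [hsucc]
      exact error_succ hab hN hNe _ k hl)
    (fun k hkn => hc.sn_force_le hab (hk k hkn))
    (fun k hkn => by
      have h := hc.sn_force_sub_le (β := β) hab (N := N) (hk k hkn.le) (hk (k + 1) hkn)
      rw [hsucc, add_sub_cancel_left, abs_of_pos hτ] at h
      rw [hsucc]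
      exact h)
    (fun k hkn => by
      have htk := hk k hkn.le
      have hs := hc.summable _ htk
      have htk' := hk (k + 1) hkn
      rw [hsucc] at htk'
      have ihk := ih k hkn htk.2
      have h1 := hc.sn_duhamel_le_l2 hab (N := N) htk.1 hτ.le htk'.2
      have h2 := sn_defect_le_l2 (β := β) (M := M + 1)
        (d := numCoef a b β V ψ₀ τ N k) hab hN hNe hτ.le hc.meas hB0 hc.bound
        hs (η := mesh a b N ^ 2 * M) (by positivity) ((hc.tsum_le _ htk).trans (by linarith))
        (hboot k htk.2 ihk)
        (l2_tail_le hab hN hM0 hs (hc.summable_sq _ htk) (hc.tsum_sq_le _ htk)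
          fun l hl => le_abs_freq_of_not_mem_modes hab hN hNe hl)
        (l2_tail_le hab hN hM0 hs (hc.summable_sq _ htk) (hc.tsum_sq_le _ htk)
          fun l hl => le_abs_freq_of_not_mem_low hab hN hNe hl)
      refine (sn_add_le _ _ _).trans ((add_le_add h1 h2).trans (le_of_eq ?_))
      ring)
  have hE0 : sn (modes N) (fun l => c ((0 : ℕ) * τ) l - numCoef a b β V ψ₀ τ N 0 l) ≤
      aliasConst * M * mesh a b N ^ 2 := by
    have h := sn_freq_alias_le hab hN (hc.summable 0 h0T) 0 hM0
      (by simpa using hc.summable_sq 0 h0T) (by simpa using hc.tsum_sq_le 0 h0T)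
    simp only [pow_zero, one_mul] at h
    have e : (fun l => c ((0 : ℕ) * τ) l - numCoef a b β V ψ₀ τ N 0 l) = fun l =>
        c 0 l - coef a b (avgGrid a b N) (syn a b (c 0)) l := funext fun l => by
      rw [numCoef_zero, coef_avgGrid_init hab hN hψ₀, Nat.cast_zero, zero_mul]
    rw [e]
    exact h.trans (le_of_eq (by ring))
  refine hrec.trans ((recursion_bound_le (e0 := aliasConst * M) hQ0 hn hT.le hMf0 hKf0 hτ.le
    (sq_nonneg _) (by positivity) hE0 rfl (by positivity) (by positivity)).trans ?_)
  have : 0 ≤ τ + mesh a b N ^ 2 := by positivity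
  refine mul_le_mul_of_nonneg_right ?_ this
  rw [hC]
  linarith

end FourierFlow

end GPE

namespace GPE

variable {a b : ℝ} {N : ℕ} {ν : Measure ℝ}

/-! ## Increments of products and of cubic terms -/

lemma l2_mono_add_three {g k₁ k₂ k₃ : ℝ → ℂ} {κ₁ κ₂ : ℝ} (h₁ : 0 ≤ κ₁) (h₂ : 0 ≤ κ₂)
    (hk₁ : MemLp k₁ 2 ν) (hk₂ : MemLp k₂ 2 ν) (hk₃ : MemLp k₃ 2 ν)
    (h : ∀ᵐ x ∂ν, ‖g x‖ ≤ κ₁ * ‖k₁ x‖ + κ₂ * (‖k₂ x‖ + ‖k₃ x‖)) :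
    l2 ν g ≤ κ₁ * l2 ν k₁ + κ₂ * (l2 ν k₂ + l2 ν k₃) := by
  have m : MemLp (fun x => ((‖k₂ x‖ + ‖k₃ x‖ : ℝ) : ℂ)) 2 ν := (hk₂.norm.add hk₃.norm).ofReal
  have e : ∀ x, ‖((‖k₂ x‖ + ‖k₃ x‖ : ℝ) : ℂ)‖ = ‖k₂ x‖ + ‖k₃ x‖ := fun x => by
    rw [Complex.norm_real, Real.norm_eq_abs, abs_of_nonneg (by positivity)]
  refine (l2_mono_add h₁ h₂ hk₁ m (by simpa only [e] using h)).trans ?_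
  gcongr
  have := l2_mono_add (g := fun x => ((‖k₂ x‖ + ‖k₃ x‖ : ℝ) : ℂ)) zero_le_one zero_le_one hk₂ hk₃
    (Eventually.of_forall fun x => by rw [e, one_mul, one_mul])
  simpa using this

section
variable [IsFiniteMeasure ν] {h B η M : ℝ}

lemma memLp_incr (hab : a < b) {g : ℝ → ℂ} (hg : Continuous g)
    (hp : Function.Periodic g (b - a)) : MemLp (incr h g) 2 ν :=
  memLp_periodic hab (continuous_incr hg h) (periodic_incr hp)

/-- Leibniz rule for increments, `G` being taken at the shifted point. -/
lemma l2_incr_mul_le (hab : a < b) {G E : ℝ → ℂ} (hG : Continuous G)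
    (hGp : Function.Periodic G (b - a)) (hE : Continuous E) (hEp : Function.Periodic E (b - a))
    (hB : ∀ x, ‖G x‖ ≤ B) (hη : ∀ x, ‖E x‖ ≤ η) :
    l2 ν (incr h fun x => G x * E x) ≤ B * l2 ν (incr h E) + η * l2 ν (incr h G) := by
  refine l2_mono_add ((norm_nonneg _).trans (hB 0)) ((norm_nonneg _).trans (hη 0))
    (memLp_incr hab hE hEp) (memLp_incr hab hG hGp) (Eventually.of_forall fun x => ?_)
  have e : incr h (fun x => G x * E x) x = G (x + h) * incr h E x + E x * incr h G x := by
    unfold incr; ring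
  rw [e]
  refine (norm_add_le _ _).trans ?_
  rw [norm_mul, norm_mul]
  exact add_le_add (mul_le_mul_of_nonneg_right (hB _) (norm_nonneg _))
    (mul_le_mul_of_nonneg_right (hη _) (norm_nonneg _))

lemma l2_incr_comp_le (hab : a < b) {F : ℂ → ℂ} {g : ℝ → ℂ} {L : ℝ} (hL : 0 ≤ L)
    (hg : Continuous g) (hgp : Function.Periodic g (b - a))
    (hF : ∀ x y, ‖F (g x) - F (g y)‖ ≤ L * ‖g x - g y‖) :
    l2 ν (incr h fun x => F (g x)) ≤ L * l2 ν (incr h g) :=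
  l2_mono hL (memLp_incr hab hg hgp) (Eventually.of_forall fun x => hF (x + h) x)

lemma l2_incr_cub_sub_le (hab : a < b) {y z : ℝ → ℂ} (hy : Continuous y)
    (hyp : Function.Periodic y (b - a)) (hz : Continuous z) (hzp : Function.Periodic z (b - a))
    (hyM : ∀ x, ‖y x‖ ≤ M) (hzM : ∀ x, ‖z x‖ ≤ M) (hη : ∀ x, ‖y x - z x‖ ≤ η) :
    l2 ν (incr h fun x => cub (y x) - cub (z x)) ≤
      3 * M ^ 2 * l2 ν (incr h fun x => y x - z x) +
        3 * M * η * (l2 ν (incr h y) + l2 ν (incr h z)) := by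
  have hM := (norm_nonneg _).trans (hyM 0)
  have hη0 := (norm_nonneg _).trans (hη 0)
  refine l2_mono_add_three (by positivity) (by positivity)
    (memLp_incr hab (hy.sub hz) (hyp.sub hzp)) (memLp_incr hab hy hyp) (memLp_incr hab hz hzp)
    (Eventually.of_forall fun x => ?_)
  exact norm_incr_cub_sub_le (hyM x) (hzM x) (hyM _) (hzM _) (hη x)

end

lemma trig_incr (S : Finset ℤ) (d : ℤ → ℂ) (h x : ℝ) : incr h (trig a b S d) x =
    trig a b S (fun l => (Complex.exp (Complex.I * ((freq a b l * h : ℝ) : ℂ)) - 1) * d l) x := by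
  unfold incr trig
  rw [← Finset.sum_sub_distrib]
  refine Finset.sum_congr rfl fun l _ => ?_
  rw [mode_shift]
  ring

lemma norm_shift_symbol_le {h : ℝ} (hh : 0 ≤ h) (d : ℤ → ℂ) (l : ℤ) :
    ‖(Complex.exp (Complex.I * ((freq a b l * h : ℝ) : ℂ)) - 1) * d l‖ ≤
      h * ‖(freq a b l : ℂ) * d l‖ := by
  rw [norm_mul, norm_mul, ← mul_assoc]
  refine mul_le_mul_of_nonneg_right ?_ (norm_nonneg _)
  refine Real.norm_exp_I_mul_ofReal_sub_one_le.trans (le_of_eq ?_)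
  rw [Real.norm_eq_abs, abs_mul, abs_of_nonneg hh, Complex.norm_real, Real.norm_eq_abs, mul_comm]

lemma IsAveraging.l2_incr_trig_le (hν : IsAveraging a b N ν) {S : Finset ℤ} (hS : S ⊆ modes N)
    {h : ℝ} (hh : 0 ≤ h) (d : ℤ → ℂ) :
    l2 ν (incr h (trig a b S d)) ≤ h * sn S (fun l => (freq a b l : ℂ) * d l) := by
  rw [show incr h (trig a b S d) = _ from funext (trig_incr S d h), hν.l2_trig hS]
  exact sn_mono hh fun l _ => norm_shift_symbol_le hh d l

lemma l2_incr_syn_le (hab : a < b) {d : ℤ → ℂ} (hd : Summable fun l => ‖d l‖) {h M : ℝ}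
    (hh : 0 ≤ h) (hM : 0 ≤ M) (hs : Summable fun l => ‖(freq a b l : ℂ) * d l‖ ^ 2)
    (hsM : ∑' l, ‖(freq a b l : ℂ) * d l‖ ^ 2 ≤ M ^ 2) :
    l2 (avgVol a b) (incr h (syn a b d)) ≤ h * M := by
  rw [show incr h (syn a b d) = _ from funext (syn_incr hd h)]
  refine l2_syn_le hab hh hM ?_ hs hsM fun l => norm_shift_symbol_le hh d l
  refine (hd.mul_left 2).of_nonneg_of_le (fun _ => norm_nonneg _) fun l => ?_
  rw [norm_mul]
  refine mul_le_mul_of_nonneg_right ?_ (norm_nonneg _)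
  refine (norm_sub_le _ _).trans ?_
  rw [mul_comm Complex.I, Complex.norm_exp_ofReal_mul_I]
  norm_num

/-! ## A Sobolev inequality for Fourier coefficients -/

/-- The constant in `∑ |d_l| ≤ |d_0| + C (∑ |μ_l d_l|²)^{1/2}`. -/
noncomputable def sobConst (a b : ℝ) : ℝ := Real.sqrt (∑' l : ℤ, (1 / freq a b l) ^ 2)

lemma sobConst_nonneg (a b : ℝ) : 0 ≤ sobConst a b := Real.sqrt_nonneg _

lemma summable_inv_freq_sq (a b : ℝ) : Summable fun l : ℤ => (1 / freq a b l) ^ 2 := by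
  have h := (Real.summable_one_div_int_pow (p := 2) |>.2 (by norm_num)).mul_left
    (((b - a) / (2 * Real.pi)) ^ 2)
  refine h.congr fun l => ?_
  unfold freq
  rw [one_div_div, one_div, div_pow, div_pow, mul_pow]
  ring

lemma freq_ne_zero (hab : a < b) {l : ℤ} (hl : l ≠ 0) : freq a b l ≠ 0 := by
  unfold freq
  have := (sub_pos.2 hab).ne'
  have := Real.pi_ne_zero
  positivity

/-- Cauchy-Schwarz against `1/μ_l`. The mean `l = 0` is kept apart, and adds nothing to `sobConst`
since `1 / 0 = 0`. -/
lemma sum_norm_le_sob (hab : a < b) (S : Finset ℤ) (d : ℤ → ℂ) :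
    ∑ l ∈ S, ‖d l‖ ≤ ‖d 0‖ + sobConst a b * sn S (fun l => (freq a b l : ℂ) * d l) := by
  have h1 : ∀ l ∈ S, ‖d l‖ ≤ (if l = 0 then ‖d l‖ else 0) +
      |1 / freq a b l| * ‖(freq a b l : ℂ) * d l‖ := fun l _ => by
    split_ifs with hl
    · exact le_add_of_nonneg_right (by positivity)
    · rw [zero_add, norm_mul, Complex.norm_real, Real.norm_eq_abs, ← mul_assoc, ← abs_mul,
        one_div_mul_cancel (freq_ne_zero hab hl), abs_one, one_mul]
  refine (Finset.sum_le_sum h1).trans ?_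
  rw [Finset.sum_add_distrib]
  refine add_le_add ?_ ((sum_norm_mul_le_sn_mul_sn S _ _).trans
    (mul_le_mul_of_nonneg_right ?_ (sn_nonneg _ _)))
  · rw [Finset.sum_ite_eq']
    split_ifs
    · exact le_rfl
    · exact norm_nonneg _
  · exact Real.sqrt_le_sqrt ((summable_inv_freq_sq a b).sum_le_tsum _ fun _ _ => sq_nonneg _)

lemma norm_le_sn {S : Finset ℤ} {l : ℤ} (hl : l ∈ S) (d : ℤ → ℂ) : ‖d l‖ ≤ sn S d := by
  refine Real.le_sqrt_of_sq_le ?_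
  exact Finset.single_le_sum (f := fun l => ‖d l‖ ^ 2) (fun _ _ => sq_nonneg _) hl

lemma summable_norm_of_freq (hab : a < b) {d : ℤ → ℂ}
    (hs : Summable fun l => ‖(freq a b l : ℂ) * d l‖ ^ 2) : Summable fun l => ‖d l‖ := by
  refine summable_of_sum_le (fun _ => norm_nonneg _)
    (c := ‖d 0‖ + sobConst a b * Real.sqrt (∑' l, ‖(freq a b l : ℂ) * d l‖ ^ 2)) fun S => ?_
  refine (sum_norm_le_sob hab S d).trans (add_le_add le_rfl ?_)
  exact mul_le_mul_of_nonneg_left (Real.sqrt_le_sqrt (hs.sum_le_tsum _ fun _ _ => sq_nonneg _))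
    (sobConst_nonneg a b)

lemma tsum_norm_le_sob (hab : a < b) {d : ℤ → ℂ} {M : ℝ} (hM : 0 ≤ M)
    (hs : Summable fun l => ‖(freq a b l : ℂ) * d l‖ ^ 2)
    (hsM : ∑' l, ‖(freq a b l : ℂ) * d l‖ ^ 2 ≤ M ^ 2) :
    ∑' l, ‖d l‖ ≤ ‖d 0‖ + sobConst a b * M := by
  refine (summable_norm_of_freq hab hs).tsum_le_of_sum_le fun S => ?_
  refine (sum_norm_le_sob hab S d).trans (add_le_add le_rfl ?_)
  exact mul_le_mul_of_nonneg_left (sn_le_of_tsum S hs hM hsM) (sobConst_nonneg a b)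

lemma zero_mem_lowModes (hN : 0 < N) (hNe : Even N) : (0 : ℤ) ∈ lowModes N := by
  unfold lowModes modes
  obtain ⟨r, hr⟩ := hNe
  rw [Finset.mem_filter, Finset.mem_Ico]
  simp only [abs_zero]
  omega

end GPE

/-! ### Consistency in `H¹` for a potential in `H¹_per`. -/

namespace GPE

variable {a b : ℝ} {N : ℕ} {ν : Measure ℝ} {B KV : ℝ} {V W : ℝ → ℝ}

/-- `W` is a continuous periodic representative of `V`, bounded by `B` and with
`‖∂ₓW‖_{L²} ≤ KV` expressed through increments. -/
structure SmoothPotential (a b B KV : ℝ) (V W : ℝ → ℝ) : Prop where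
  cont : Continuous W
  per : Function.Periodic W (b - a)
  ae : V =ᵐ[vol a b] W
  bound : ∀ x, |W x| ≤ B
  KV_nonneg : 0 ≤ KV
  incr_le : ∀ h, 0 ≤ h → l2 (avgVol a b) (incr h fun x => (W x : ℂ)) ≤ h * KV

/-- A discrete `H¹` product estimate. Increments of size `h` times a derivative norm cancel the
`1/h` in `sn_freq_coef_le`, and nothing has to be differentiated, so grid averages are covered too.
-/
lemma IsAveraging.sn_freq_coef_mul_le (hν : IsAveraging a b N ν) (hab : a < b) (hN : 0 < N)
    {G E : ℝ → ℂ} (hG : Continuous G) (hGp : Function.Periodic G (b - a)) (hE : Continuous E)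
    (hEp : Function.Periodic E (b - a)) {B K e η : ℝ} (hB : ∀ x, ‖G x‖ ≤ B)
    (hK : l2 ν (incr (mesh a b N) G) ≤ mesh a b N * K)
    (he : l2 ν (incr (mesh a b N) E) ≤ mesh a b N * e) (hη : ∀ x, ‖E x‖ ≤ η) :
    sn (modes N) (fun l => (freq a b l : ℂ) * coef a b ν (fun x => G x * E x) l) ≤
      2 * (B * e + η * K) := by
  have := hν.prob
  have hh := mesh_pos hab hN
  have hB0 := (norm_nonneg _).trans (hB 0)
  have hη0 := (norm_nonneg _).trans (hη 0)
  refine (hν.sn_freq_coef_le hab hN (g := fun x => G x * E x) (hG.mul hE)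
    (hGp.mul hEp)).trans ?_
  have h := (l2_incr_mul_le (ν := ν) (h := mesh a b N) hab hG hGp hE hEp hB hη).trans
    (add_le_add (mul_le_mul_of_nonneg_left he hB0) (mul_le_mul_of_nonneg_left hK hη0))
  calc _ ≤ 2 / mesh a b N * (B * (mesh a b N * e) + η * (mesh a b N * K)) := by gcongr
    _ = _ := by field_simp

lemma IsAveraging.sn_freq_coef_le_of_incr (hν : IsAveraging a b N ν) (hab : a < b) (hN : 0 < N)
    {g : ℝ → ℂ} (hg : Continuous g) (hgp : Function.Periodic g (b - a)) {e : ℝ}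
    (he : l2 ν (incr (mesh a b N) g) ≤ mesh a b N * e) :
    sn (modes N) (fun l => (freq a b l : ℂ) * coef a b ν g l) ≤ 2 * e := by
  have hh := mesh_pos hab hN
  refine (hν.sn_freq_coef_le hab hN hg hgp).trans ?_
  calc _ ≤ 2 / mesh a b N * (mesh a b N * e) := by gcongr
    _ = _ := by field_simp

lemma SmoothPotential.coef_congr (hW : SmoothPotential a b B KV V W) (k : ℝ → ℂ) (g : ℝ → ℂ)
    (l : ℤ) : coef a b (avgVol a b) (fun x => k (V x) * g x) l =
      coef a b (avgVol a b) (fun x => k (W x) * g x) l := by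
  refine coef_congr_ae ?_ l
  filter_upwards [ae_avgVol_iff.2 hW.ae] with x hx
  rw [hx]

lemma SmoothPotential.sn_freq_potential_le (hW : SmoothPotential a b B KV V W) (hab : a < b)
    (hN : 0 < N) {E : ℝ → ℂ} (hE : Continuous E) (hEp : Function.Periodic E (b - a)) {e η : ℝ}
    (he : l2 (avgVol a b) (incr (mesh a b N) E) ≤ mesh a b N * e) (hη : ∀ x, ‖E x‖ ≤ η) :
    sn (modes N) (fun l => (freq a b l : ℂ) *
      coef a b (avgVol a b) (fun x => (V x : ℂ) * E x) l) ≤ 2 * (B * e + η * KV) := by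
  simp_rw [hW.coef_congr (fun y => (y : ℂ))]
  have hc := hW.cont
  refine (isAveraging_avgVol hab N).sn_freq_coef_mul_le hab hN (by fun_prop)
    (fun x => by simp only [hW.per x]) hE hEp
    (fun x => ?_) (hW.incr_le _ (mesh_pos hab hN).le) he hη
  rw [Complex.norm_real]
  exact hW.bound x

lemma SmoothPotential.sn_freq_expRem_le (hW : SmoothPotential a b B KV V W) (hab : a < b)
    (hN : 0 < N) {τ : ℝ} (hτ : 0 ≤ τ) {E : ℝ → ℂ} (hE : Continuous E)
    (hEp : Function.Periodic E (b - a)) {e η : ℝ}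
    (he : l2 (avgVol a b) (incr (mesh a b N) E) ≤ mesh a b N * e) (hη : ∀ x, ‖E x‖ ≤ η) :
    sn (modes N) (fun l => (freq a b l : ℂ) *
      coef a b (avgVol a b) (fun x => expRem (τ * V x) * E x) l) ≤
      2 * ((τ * B) ^ 2 * e + η * (τ ^ 2 * B * KV)) := by
  have hp := avgVol_prob hab
  have hB0 : 0 ≤ B := (abs_nonneg _).trans (hW.bound 0)
  simp_rw [hW.coef_congr (fun y => expRem (τ * y))]
  have hc := hW.cont
  have hb : ∀ x, |τ * W x| ≤ τ * B := fun x => by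
    rw [abs_mul, abs_of_nonneg hτ]
    exact mul_le_mul_of_nonneg_left (hW.bound x) hτ
  refine (isAveraging_avgVol hab N).sn_freq_coef_mul_le hab hN
    (continuous_expRem.comp (continuous_const.mul hc))
    (hW.per.comp fun y => expRem (τ * y)) hE hEp
    (fun x => norm_expRem_le (hb x)) ?_ he hη
  have hWp : Function.Periodic (fun x => (W x : ℂ)) (b - a) := fun x => by simp only [hW.per x]
  have h1 : l2 (avgVol a b) (incr (mesh a b N) fun x => expRem (τ * W x)) ≤
      τ * B * τ * l2 (avgVol a b) (incr (mesh a b N) fun x => (W x : ℂ)) := by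
    refine l2_mono (by positivity) (memLp_incr hab (by fun_prop) hWp)
      (Eventually.of_forall fun x => ?_)
    refine (norm_expRem_sub_le (hb _) (hb _)).trans (le_of_eq ?_)
    rw [incr, ← Complex.ofReal_sub, Complex.norm_real, Real.norm_eq_abs, ← mul_sub, abs_mul,
      abs_of_nonneg hτ]
    ring
  refine h1.trans ((mul_le_mul_of_nonneg_left (hW.incr_le _ (mesh_pos hab hN).le)
    (by positivity)).trans (le_of_eq ?_))
  ring

lemma norm_trig_le_sob (hab : a < b) (hN : 0 < N) (hNe : Even N) (d : ℤ → ℂ) (x : ℝ) :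
    ‖trig a b (modes N) d x‖ ≤ sn (modes N) d +
      sobConst a b * sn (modes N) (fun l => (freq a b l : ℂ) * d l) :=
  (norm_trig_le _ d x).trans ((sum_norm_le_sob hab _ d).trans (add_le_add
    (norm_le_sn (lowModes_subset N (zero_mem_lowModes hN hNe)) d) le_rfl))

section tail

variable {c : ℤ → ℂ} {M₁ : ℝ}

/-- Of three derivatives one is kept as the weight and two are traded for `h²`. -/
lemma freq_tail (hab : a < b) (hN : 0 < N) {S : Finset ℤ}
    (hS : ∀ l ∉ S, 1 / mesh a b N ≤ |freq a b l|)
    (hs : Summable fun l => ‖(freq a b l : ℂ) ^ 3 * c l‖ ^ 2)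
    (hsM : ∑' l, ‖(freq a b l : ℂ) ^ 3 * c l‖ ^ 2 ≤ M₁ ^ 2) :
    (Summable fun l => ‖(freq a b l : ℂ) * (if l ∈ S then 0 else c l)‖ ^ 2) ∧
    ∑' l, ‖(freq a b l : ℂ) * (if l ∈ S then 0 else c l)‖ ^ 2 ≤ (mesh a b N ^ 2 * M₁) ^ 2 := by
  have h : ∀ l, ‖(freq a b l : ℂ) * (if l ∈ S then 0 else c l)‖ ≤
      mesh a b N ^ 2 * ‖(freq a b l : ℂ) ^ 3 * c l‖ := fun l => by
    have := norm_tail_le (c := fun l => (freq a b l : ℂ) * c l) (mesh_pos hab hN) hS 2 l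
    rw [show (freq a b l : ℂ) ^ 3 * c l = (freq a b l : ℂ) ^ 2 * ((freq a b l : ℂ) * c l) by ring,
      mul_ite, mul_zero]
    exact this
  exact ⟨summable_sq_of_le hs h, tsum_sq_le hs hsM h⟩

lemma l2_incr_tail_le (hab : a < b) (hN : 0 < N) {S : Finset ℤ} (hM : 0 ≤ M₁)
    (hS : ∀ l ∉ S, 1 / mesh a b N ≤ |freq a b l|) (hc : Summable fun l => ‖c l‖)
    (hs : Summable fun l => ‖(freq a b l : ℂ) ^ 3 * c l‖ ^ 2)
    (hsM : ∑' l, ‖(freq a b l : ℂ) ^ 3 * c l‖ ^ 2 ≤ M₁ ^ 2) :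
    l2 (avgVol a b) (incr (mesh a b N) fun x => syn a b c x - trig a b S c x) ≤
      mesh a b N * (mesh a b N ^ 2 * M₁) := by
  obtain ⟨h1, h2⟩ := freq_tail hab hN hS hs hsM
  simp_rw [syn_sub_trig hc S]
  exact l2_incr_syn_le hab (summable_ite_not_mem hc S) (mesh_pos hab hN).le (by positivity) h1 h2

lemma tsum_tail_le (hab : a < b) (hN : 0 < N) {S : Finset ℤ} (h0 : (0 : ℤ) ∈ S) (hM : 0 ≤ M₁)
    (hS : ∀ l ∉ S, 1 / mesh a b N ≤ |freq a b l|)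
    (hs : Summable fun l => ‖(freq a b l : ℂ) ^ 3 * c l‖ ^ 2)
    (hsM : ∑' l, ‖(freq a b l : ℂ) ^ 3 * c l‖ ^ 2 ≤ M₁ ^ 2) :
    ∑' l, ‖if l ∈ S then 0 else c l‖ ≤ sobConst a b * (mesh a b N ^ 2 * M₁) := by
  obtain ⟨h1, h2⟩ := freq_tail hab hN hS hs hsM
  have := tsum_norm_le_sob hab (by positivity) h1 h2
  simpa [h0] using this

lemma norm_syn_sub_trig_le (hab : a < b) (hN : 0 < N) {S : Finset ℤ} (h0 : (0 : ℤ) ∈ S)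
    (hM : 0 ≤ M₁) (hS : ∀ l ∉ S, 1 / mesh a b N ≤ |freq a b l|) (hc : Summable fun l => ‖c l‖)
    (hs : Summable fun l => ‖(freq a b l : ℂ) ^ 3 * c l‖ ^ 2)
    (hsM : ∑' l, ‖(freq a b l : ℂ) ^ 3 * c l‖ ^ 2 ≤ M₁ ^ 2) (x : ℝ) :
    ‖syn a b c x - trig a b S c x‖ ≤ sobConst a b * (mesh a b N ^ 2 * M₁) := by
  rw [syn_sub_trig hc S]
  exact (norm_syn_le (summable_ite_not_mem hc S) x).trans (tsum_tail_le hab hN h0 hM hS hs hsM)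

end tail

set_option maxHeartbeats 1000000 in
/-- Consistency error of one time step in the `H¹` seminorm. -/
lemma exists_sn_freq_defect_le (hab : a < b) (β : ℝ) {M M₁ : ℝ} (hM : 0 ≤ M) (hM₁ : 0 ≤ M₁)
    (hW : SmoothPotential a b B KV V W) (hV : AEStronglyMeasurable V (vol a b))
    (hB : ∀ᵐ x ∂vol a b, |V x| ≤ B) :
    ∃ Q X : ℝ, 0 ≤ Q ∧ 0 ≤ X ∧ ∀ (N : ℕ) (τ : ℝ) (c d : ℤ → ℂ), 0 < N → Even N → 0 ≤ τ → τ ≤ 1 →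
      (Summable fun l => ‖c l‖) → ∑' l, ‖c l‖ ≤ M → ∑ l ∈ modes N, ‖d l‖ ≤ M →
      (Summable fun l => ‖(freq a b l : ℂ) * c l‖ ^ 2) →
      ∑' l, ‖(freq a b l : ℂ) * c l‖ ^ 2 ≤ M₁ ^ 2 →
      (Summable fun l => ‖(freq a b l : ℂ) ^ 3 * c l‖ ^ 2) →
      ∑' l, ‖(freq a b l : ℂ) ^ 3 * c l‖ ^ 2 ≤ M₁ ^ 2 →
      sn (modes N) (fun l => (freq a b l : ℂ) * d l) ≤ M₁ →
      sn (modes N) (fun l => (freq a b l : ℂ) * (-Complex.I * τ * forceCoef a b β V c l -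
        (coef a b (avgVol a b) (fun x => Complex.exp (-Complex.I * ((τ * V x : ℝ) : ℂ)) *
          trig a b (modes N) (flowCoef a b τ β N d) x) l - d l))) ≤
      τ * (Q * sn (modes N) (fun l => (freq a b l : ℂ) * (c l - d l)) +
        X * (sn (modes N) (fun l => c l - d l) + mesh a b N ^ 2 + τ)) := by
  have hB0 : 0 ≤ B := (abs_nonneg _).trans (hW.bound 0)
  have hKV := hW.KV_nonneg
  set σ := sobConst a b with hσ
  have hσ0 : 0 ≤ σ := sobConst_nonneg a b
  set μ := |β| * M ^ 2 with hμ
  have hμ0 : 0 ≤ μ := by positivity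
  -- A bound for the `H¹` seminorm of the interpolated cubic flow, made independent of the step by
  -- `τ ≤ 1`.
  set E4 := 2 * ((1 + 3 * μ) * M₁) with hE4
  have hE40 : 0 ≤ E4 := by positivity
  -- `Xh`, `Xe` and `Xt` collect the coefficients of `h²`, of the `L²` error and of `τ` in the seven
  -- contributions; the `H¹` error enters with `Q`.
  set Xh := 2 * M₁ * (B + KV * σ) + |β| * (12 * M ^ 2 * M₁ + 24 * M * σ * M₁ ^ 2) with hXh
  set Xe := 2 * KV + 12 * |β| * M * M₁ with hXe
  set Xt := 12 * B * μ * M₁ + 2 * KV * (μ * M + 6 * σ * μ * M₁) +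
    2 * (B ^ 2 * E4 + B * KV * (M + σ * E4)) + 6 * μ ^ 2 * M₁ with hXt
  have hXh0 : 0 ≤ Xh := by positivity
  have hXe0 : 0 ≤ Xe := by positivity
  have hXt0 : 0 ≤ Xt := by positivity
  refine ⟨2 * (B + KV * σ) + |β| * (6 * M ^ 2 + 12 * M * σ * M₁), Xh + Xe + Xt, by positivity,
    by positivity, ?_⟩
  intro N τ c d hN hNe hτ hτ1 hc hcM hdM hs1 hs1M hs3 hs3M hdM₁
  have hp0 := avgVol_prob hab
  have hν0 := isAveraging_avgVol hab N
  have hνN := isAveraging_avgGrid hab hN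
  have hpN := hνN.prob
  have hh := mesh_pos hab hN
  refine (sn_defect_le (β := β) (d := d) hab hN hNe hτ hV hB hc (fun l => freq a b l)).trans ?_
  set S := modes N with hS
  set h := mesh a b N with hhdef
  set ε := sn S (fun l => c l - d l)
  set ε₁ := sn S (fun l => (freq a b l : ℂ) * (c l - d l))
  have hε : 0 ≤ ε := sn_nonneg _ _
  have hε₁ : 0 ≤ ε₁ := sn_nonneg _ _
  set w := flowCoef a b τ β N d with hw
  set m := τ * |β| * M ^ 2 with hm
  have hmμ : m = τ * μ := by rw [hm, hμ]; ring
  have hm0 : 0 ≤ m := by positivity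
  have hΨ : ∀ x, ‖syn a b c x‖ ≤ M := fun x => (norm_syn_le hc x).trans hcM
  have hu : ∀ x, ‖trig a b S d x‖ ≤ M := fun x => (norm_trig_le S d x).trans hdM
  have hq : ∀ S' x, ‖trig a b S' c x‖ ≤ M := fun S' x =>
    (norm_trig_le S' c x).trans ((hc.sum_le_tsum S' fun _ _ => norm_nonneg _).trans hcM)
  have cΨ := continuous_syn (a := a) (b := b) hc
  have pΨ := periodic_syn hab c
  have ct := fun S' d' => continuous_trig a b S' d'
  have pt := fun S' d' => periodic_trig hab S' d'
  have h0low := zero_mem_lowModes hN hNe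
  have h0S : (0 : ℤ) ∈ S := lowModes_subset N h0low
  have tS : ∀ l ∉ S, 1 / mesh a b N ≤ |freq a b l| := fun l hl =>
    le_abs_freq_of_not_mem_modes hab hN hNe hl
  have tL : ∀ l ∉ lowModes N, 1 / mesh a b N ≤ |freq a b l| := fun l hl =>
    le_abs_freq_of_not_mem_low hab hN hNe hl
  have dtrig : ∀ {ν : Measure ℝ}, IsAveraging a b N ν → ∀ d',
      l2 ν (incr h (trig a b S d')) ≤ h * sn S (fun l => (freq a b l : ℂ) * d' l) :=
    fun hν d' => hν.l2_incr_trig_le subset_rfl hh.le d'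
  have du : l2 (avgGrid a b N) (incr h (trig a b S d)) ≤ h * M₁ :=
    (dtrig hνN d).trans (mul_le_mul_of_nonneg_left hdM₁ hh.le)
  have mF : MemLp (fun x => cubFlow τ β (trig a b S d x)) 2 (avgGrid a b N) :=
    memLp_of_bound ((continuous_cubFlow τ β).comp (continuous_trig a b S d)).aestronglyMeasurable
      fun x => (norm_cubFlow τ β _).trans_le (hu x)
  -- the interpolated nonlinear flow
  have w0 : sn S w ≤ M := (hνN.bessel mF).trans (l2_le_of_bound hM
    (Eventually.of_forall fun x => (norm_cubFlow τ β _).trans_le (hu x)))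
  have w1 : sn S (fun l => (freq a b l : ℂ) * w l) ≤ E4 := by
    have h1 := (l2_incr_comp_le (ν := avgGrid a b N) (h := h) (F := cubFlow τ β) (L := 1 + 3 * m)
      hab (by positivity) (ct S d) (pt S d)
      (fun x y => norm_cubFlow_sub_le hτ (hu x) (hu y))).trans
      (mul_le_mul_of_nonneg_left du (by positivity))
    refine (hνN.sn_freq_coef_le_of_incr hab hN ((continuous_cubFlow τ β).comp (ct S d))
      (fun x => by simp only [Function.comp_apply, pt S d x]) (e := (1 + 3 * m) * M₁)
      (h1.trans (le_of_eq (by ring)))).trans ?_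
    rw [hE4, hmμ]
    have : τ * μ ≤ μ := mul_le_of_le_one_left hμ0 hτ1
    gcongr
  have ewd : ∀ l ∈ S, w l - d l = coef a b (avgGrid a b N)
      (fun x => cubFlow τ β (trig a b S d x) - trig a b S d x) l := fun l hl => by
    rw [coef_sub mF (memLp_trig S d), hνN.coef_trig subset_rfl _ hl, if_pos hl, hw, flowCoef]
  have wd0 : sn S (fun l => w l - d l) ≤ m * M := by
    have mS : MemLp (fun x => cubFlow τ β (trig a b S d x) - trig a b S d x) 2
        (avgGrid a b N) := mF.sub (memLp_trig S d)
    rw [sn_congr ewd]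
    exact (hνN.bessel mS).trans (l2_le_of_bound (by positivity)
      (Eventually.of_forall fun x => norm_cubFlow_sub_self_le hτ (hu x)))
  have wd1 : sn S (fun l => (freq a b l : ℂ) * (w l - d l)) ≤ 2 * (3 * m * M₁) := by
    have h1 := (l2_incr_comp_le (ν := avgGrid a b N) (h := h) (F := fun z => cubFlow τ β z - z)
      (L := 3 * m) hab (by positivity) (ct S d) (pt S d)
      (fun x y => norm_cubFlow_sub_self_sub_le hτ (hu x) (hu y))).trans
      (mul_le_mul_of_nonneg_left du (by positivity))
    rw [sn_congr fun l hl => by rw [ewd l hl]]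
    exact hνN.sn_freq_coef_le_of_incr hab hN
      (((continuous_cubFlow τ β).comp (ct S d)).sub (ct S d))
      ((pt S d).comp fun z => cubFlow τ β z - z) (h1.trans (le_of_eq (by ring)))
  -- the seven contributions
  have t1 := hW.sn_freq_potential_le hab hN (cΨ.sub (ct S c)) (pΨ.sub (pt S c))
    (l2_incr_tail_le hab hN hM₁ tS hc hs3 hs3M)
    (norm_syn_sub_trig_le hab hN h0S hM₁ tS hc hs3 hs3M)
  have t2 := hW.sn_freq_potential_le hab hN (ct S (fun l => c l - d l)) (pt S _)
    (dtrig hν0 _) (norm_trig_le_sob hab hN hNe _)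
  have t3 := hW.sn_freq_potential_le hab hN (ct S (fun l => w l - d l)) (pt S _)
    ((dtrig hν0 _).trans (mul_le_mul_of_nonneg_left wd1 hh.le))
    (fun x => (norm_trig_le_sob hab hN hNe _ x).trans
      (add_le_add wd0 (mul_le_mul_of_nonneg_left wd1 hσ0)))
  have t4 := hW.sn_freq_expRem_le hab hN hτ (ct S w) (pt S w)
    ((dtrig hν0 _).trans (mul_le_mul_of_nonneg_left w1 hh.le))
    (fun x => (norm_trig_le_sob hab hN hNe _ x).trans
      (add_le_add w0 (mul_le_mul_of_nonneg_left w1 hσ0)))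
  have dlow : sn (lowModes N) (fun l => (freq a b l : ℂ) * c l) ≤ M₁ :=
    sn_le_of_tsum _ hs1 hM₁ hs1M
  have t5 : sn S (fun l => (freq a b l : ℂ) * coef a b (avgVol a b)
      (fun x => cub (syn a b c x) - cub (trig a b (lowModes N) c x)) l) ≤
      2 * (3 * M ^ 2 * (h ^ 2 * M₁) + 3 * M * (σ * (h ^ 2 * M₁)) * (M₁ + M₁)) := by
    have h1 := l2_incr_cub_sub_le (ν := avgVol a b) (h := h) hab cΨ pΨ (ct (lowModes N) c)
      (pt (lowModes N) c) hΨ (hq _) (norm_syn_sub_trig_le hab hN h0low hM₁ tL hc hs3 hs3M)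
    have h2 := l2_incr_tail_le hab hN hM₁ tL hc hs3 hs3M
    have h3 := l2_incr_syn_le hab hc hh.le hM₁ hs1 hs1M
    have h4 := (hν0.l2_incr_trig_le (lowModes_subset N) hh.le c).trans
      (mul_le_mul_of_nonneg_left dlow hh.le)
    refine hν0.sn_freq_coef_le_of_incr hab hN
      ((continuous_cub.comp cΨ).sub (continuous_cub.comp (ct _ c)))
      ((pΨ.comp cub).sub ((pt _ c).comp cub)) (h1.trans ?_)
    calc _ ≤ 3 * M ^ 2 * (h * (h ^ 2 * M₁)) + 3 * M * (σ * (h ^ 2 * M₁)) * (h * M₁ + h * M₁) := by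
          gcongr
      _ = _ := by ring
  set e : ℤ → ℂ := fun l => (if l ∈ lowModes N then c l else 0) - d l with he
  have ee : ∀ l, e l = (c l - d l) - (if l ∈ lowModes N then 0 else c l) := fun l => by
    rw [he]; simp only; split_ifs <;> ring
  have etrig : ∀ x, trig a b (lowModes N) c x - trig a b S d x = trig a b S e x := fun x => by
    simp only [he, trig, sub_mul, Finset.sum_sub_distrib]
    congr 1
    rw [← Finset.sum_subset (lowModes_subset N)]
    · exact Finset.sum_congr rfl fun l hl => by rw [if_pos hl]
    · intro l _ hl; rw [if_neg hl, zero_mul]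
  have e1 : sn S (fun l => (freq a b l : ℂ) * e l) ≤ ε₁ + h ^ 2 * M₁ := by
    have : ∀ l, (freq a b l : ℂ) * e l = (freq a b l : ℂ) * (c l - d l) -
        (freq a b l : ℂ) * (if l ∈ lowModes N then 0 else c l) := fun l => by rw [ee]; ring
    simp_rw [this]
    obtain ⟨f1, f2⟩ := freq_tail hab hN tL hs3 hs3M
    exact (sn_sub_le _ _ _).trans (add_le_add le_rfl (sn_le_of_tsum S f1 (by positivity) f2))
  -- Increments of the cubic need the difference in sup norm as well: the error part is handled by
  -- the Sobolev inequality, the discarded part by its `ℓ¹` tail.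
  have esup : ∀ x, ‖trig a b (lowModes N) c x - trig a b S d x‖ ≤
      ε + σ * ε₁ + σ * (h ^ 2 * M₁) := fun x => by
    have r : trig a b (lowModes N) c x - trig a b S d x = trig a b S (fun l => c l - d l) x -
        trig a b S (fun l => if l ∈ lowModes N then 0 else c l) x := by
      rw [etrig]
      simp only [trig, ee, sub_mul, Finset.sum_sub_distrib]
    rw [r]
    refine (norm_sub_le _ _).trans (add_le_add (norm_trig_le_sob hab hN hNe _ x)
      ((norm_trig_le S _ x).trans ?_))
    exact ((summable_ite_not_mem hc _).sum_le_tsum _ fun _ _ => norm_nonneg _).trans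
      (tsum_tail_le hab hN h0low hM₁ tL hs3 hs3M)
  have t6 : sn S (fun l => (freq a b l : ℂ) * coef a b (avgGrid a b N)
      (fun x => cub (trig a b (lowModes N) c x) - cub (trig a b S d x)) l) ≤
      2 * (3 * M ^ 2 * (ε₁ + h ^ 2 * M₁) +
        3 * M * (ε + σ * ε₁ + σ * (h ^ 2 * M₁)) * (M₁ + M₁)) := by
    have h1 := l2_incr_cub_sub_le (ν := avgGrid a b N) (h := h) hab (ct (lowModes N) c)
      (pt (lowModes N) c) (ct S d) (pt S d) (hq _) hu esup
    have h2 : l2 (avgGrid a b N) (incr h fun x => trig a b (lowModes N) c x - trig a b S d x) ≤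
        h * (ε₁ + h ^ 2 * M₁) := by
      simp_rw [etrig]
      exact (dtrig hνN e).trans (mul_le_mul_of_nonneg_left e1 hh.le)
    have h4 := (hνN.l2_incr_trig_le (lowModes_subset N) hh.le c).trans
      (mul_le_mul_of_nonneg_left dlow hh.le)
    refine hνN.sn_freq_coef_le_of_incr hab hN
      ((continuous_cub.comp (ct _ c)).sub (continuous_cub.comp (ct S d)))
      (((pt _ c).comp cub).sub ((pt S d).comp cub)) (h1.trans ?_)
    calc _ ≤ 3 * M ^ 2 * (h * (ε₁ + h ^ 2 * M₁)) +
          3 * M * (ε + σ * ε₁ + σ * (h ^ 2 * M₁)) * (h * M₁ + h * M₁) := by gcongr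
      _ = _ := by ring
  have t7 : sn S (fun l => (freq a b l : ℂ) * coef a b (avgGrid a b N)
      (fun x => cubRem τ β (trig a b S d x)) l) ≤ 2 * (3 * m ^ 2 * M₁) := by
    have h1 := (l2_incr_comp_le (ν := avgGrid a b N) (h := h) (F := cubRem τ β)
      (L := 3 * m ^ 2) hab (by positivity) (ct S d) (pt S d)
      (fun x y => norm_cubRem_sub_le hτ (hu x) (hu y))).trans
      (mul_le_mul_of_nonneg_left du (by positivity))
    exact hνN.sn_freq_coef_le_of_incr hab hN ((continuous_cubRem τ β).comp (ct S d))
      (fun x => by simp only [Function.comp_apply, pt S d x]) (h1.trans (le_of_eq (by ring)))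
  have hβ := abs_nonneg β
  refine (add_le_add (add_le_add (add_le_add (add_le_add (add_le_add (add_le_add
    (mul_le_mul_of_nonneg_left t1 hτ) (mul_le_mul_of_nonneg_left t2 hτ))
    (mul_le_mul_of_nonneg_left t3 hτ)) t4)
    (mul_le_mul_of_nonneg_left t5 (mul_nonneg hτ hβ)))
    (mul_le_mul_of_nonneg_left t6 (mul_nonneg hτ hβ))) t7).trans ?_
  change _ ≤ τ * (_ * ε₁ + _ * (ε + h ^ 2 + τ))
  have hX : Xh * h ^ 2 + Xe * ε + Xt * τ ≤ (Xh + Xe + Xt) * (ε + h ^ 2 + τ) := by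
    have i1 : 0 ≤ Xh * (ε + τ) := by positivity
    have i2 : 0 ≤ Xe * (h ^ 2 + τ) := by positivity
    have i3 : 0 ≤ Xt * (ε + h ^ 2) := by positivity
    linarith
  refine le_trans (le_of_eq ?_) (mul_le_mul_of_nonneg_left (add_le_add le_rfl hX) hτ)
  rw [hXh, hXe, hXt, hmμ]
  change τ * (2 * (B * (h ^ 2 * M₁) + σ * (h ^ 2 * M₁) * KV)) +
    τ * (2 * (B * ε₁ + (ε + σ * ε₁) * KV)) + _ + _ + _ + _ + _ = _
  ring

end GPE

/-! ### The `H¹` error estimate for smooth data. -/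

namespace GPE

variable {a b T β M B K B' KV M₁ K₁ τ : ℝ} {V W : ℝ → ℝ} {N : ℕ} {c : ℝ → ℤ → ℂ} {ψ₀ : ℝ → ℂ}

/-- Additional regularity of a flow in Fourier space: bounds `M₁` in `H³` and a Lipschitz
bound `K₁` in `H¹`. -/
structure SmoothFlow (a b T M₁ K₁ : ℝ) (c : ℝ → ℤ → ℂ) : Prop where
  M_nonneg : 0 ≤ M₁
  K_nonneg : 0 ≤ K₁
  summable_one : ∀ t ∈ Icc 0 T, Summable fun l => ‖(freq a b l : ℂ) * c t l‖ ^ 2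
  tsum_one_le : ∀ t ∈ Icc 0 T, ∑' l, ‖(freq a b l : ℂ) * c t l‖ ^ 2 ≤ M₁ ^ 2
  summable_three : ∀ t ∈ Icc 0 T, Summable fun l => ‖(freq a b l : ℂ) ^ 3 * c t l‖ ^ 2
  tsum_three_le : ∀ t ∈ Icc 0 T, ∑' l, ‖(freq a b l : ℂ) ^ 3 * c t l‖ ^ 2 ≤ M₁ ^ 2
  summable_sub : ∀ s ∈ Icc 0 T, ∀ t ∈ Icc 0 T,
    Summable fun l => ‖(freq a b l : ℂ) * (c t l - c s l)‖ ^ 2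
  lip : ∀ s ∈ Icc 0 T, ∀ t ∈ Icc 0 T,
    ∑' l, ‖(freq a b l : ℂ) * (c t l - c s l)‖ ^ 2 ≤ (K₁ * |t - s|) ^ 2

lemma forceCoef_eq (hab : a < b) (hV : AEStronglyMeasurable V (vol a b))
    (hB : ∀ᵐ x ∂vol a b, |V x| ≤ B) {c : ℤ → ℂ} (hc : Summable fun l => ‖c l‖) (l : ℤ) :
    forceCoef a b β V c l = coef a b (avgVol a b) (fun x => (V x : ℂ) * syn a b c x) l +
      β * coef a b (avgVol a b) (fun x => cub (syn a b c x)) l := by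
  have hp0 := avgVol_prob hab
  have m2 : MemLp (fun x => cub (syn a b c x)) 2 (avgVol a b) :=
    memLp_cub (continuous_syn hc) (norm_syn_le hc)
  have m3 : MemLp (fun x => (β : ℂ) * cub (syn a b c x)) 2 (avgVol a b) := m2.const_mul _
  rw [forceCoef, coef_add (memLp_potential_mul hV hB (memLp_syn hc)) m3, coef_const_mul]

lemma FourierFlow.sn_freq_duhamel_le (hc : FourierFlow a b T β M B K V c) {t : ℝ}
    (ht : 0 ≤ t)
    (hτ : 0 ≤ τ) (htT : t + τ ≤ T) {KF : ℝ} (hKF : 0 ≤ KF)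
    (hF : ∀ s ∈ Icc 0 T, ∀ t ∈ Icc 0 T, sn (modes N) (fun l => (freq a b l : ℂ) *
      (forceCoef a b β V (c t) l - forceCoef a b β V (c s) l)) ≤ KF * |t - s|) :
    sn (modes N) (fun l => (freq a b l : ℂ) *
      (Complex.exp (Complex.I * ((τ * freq a b l ^ 2 : ℝ) : ℂ)) * c (t + τ) l -
      c t l + Complex.I * osc (freq a b l ^ 2) τ * forceCoef a b β V (c t) l)) ≤ KF * τ ^ 2 :=
  sn_duhamel_le (S := modes N) (κ := fun l => freq a b l ^ 2) (wt := fun l => (freq a b l : ℂ))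
    (c := c) (F := fun t => forceCoef a b β V (c t)) ht hτ htT hKF hc.ode fun s hs => by
      have := hF t ⟨ht, by linarith⟩ (t + s) ⟨by linarith [hs.1], by linarith [hs.2]⟩
      simpa [abs_of_nonneg hs.1] using this

lemma sn_freq_le_inverse (hab : a < b) (hN : 0 < N) (d : ℤ → ℂ) :
    sn (modes N) (fun l => (freq a b l : ℂ) * d l) ≤ Real.pi / mesh a b N * sn (modes N) d := by
  have hh := mesh_pos hab hN
  have := Real.pi_pos
  refine sn_mono (by positivity) fun l hl => ?_
  rw [norm_mul, Complex.norm_real, Real.norm_eq_abs]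
  exact mul_le_mul_of_nonneg_right ((le_div_iff₀ hh).2 (by
    rw [← abs_of_pos hh, ← abs_mul]; exact abs_freq_mul_mesh_le hab hl)) (norm_nonneg _)

namespace SmoothFlow

/-- Sobolev inequality for the time increment: its mean is controlled by the Lipschitz bound in
`L²`, the other modes by that in `H¹`. -/
lemma norm_syn_sub_le (hs : SmoothFlow a b T M₁ K₁ c) (hc : FourierFlow a b T β M B K V c)
    (hab : a < b) {s t : ℝ} (hsT : s ∈ Icc 0 T) (htT : t ∈ Icc 0 T) (x : ℝ) :
    ‖syn a b (c t) x - syn a b (c s) x‖ ≤ (K + sobConst a b * K₁) * |t - s| := by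
  have hst := hs.summable_sub s hsT t htT
  have hd := summable_norm_of_freq hab hst
  have hK := hs.K_nonneg
  have hK' := hc.K_nonneg
  rw [← syn_sub (hc.summable t htT) (hc.summable s hsT)]
  refine (norm_syn_le hd x).trans ((tsum_norm_le_sob hab (by positivity) hst
    (hs.lip s hsT t htT)).trans ?_)
  have h1 := l2_syn_sq hab hd
  have h2 := hc.lip s hsT t htT
  have e : syn a b (fun l => c t l - c s l) = fun x => syn a b (c t) x - syn a b (c s) x :=
    funext (syn_sub (hc.summable t htT) (hc.summable s hsT))
  rw [e] at h1
  have h3 : ‖c t 0 - c s 0‖ ≤ K * |t - s| :=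
    (norm_le_sn (Finset.mem_singleton_self 0) fun l => c t l - c s l).trans
      ((sn_le_of_tsum _ h1.summable (l2_nonneg _ _) h1.tsum_eq.le).trans h2)
  linarith

lemma sn_freq_force_le (hs : SmoothFlow a b T M₁ K₁ c) (hc : FourierFlow a b T β M B K V c)
    (hW : SmoothPotential a b B' KV V W) (hab : a < b) (hN : 0 < N) {t : ℝ} (ht : t ∈ Icc 0 T) :
    sn (modes N) (fun l => (freq a b l : ℂ) * forceCoef a b β V (c t) l) ≤
      2 * (B' * M₁ + M * KV) + |β| * (2 * (3 * M ^ 2 * M₁)) := by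
  have hp0 := avgVol_prob hab
  have hct := hc.summable t ht
  have hM := hc.M_nonneg
  have hi := l2_incr_syn_le hab hct (mesh_pos hab hN).le hs.M_nonneg (hs.summable_one t ht)
    (hs.tsum_one_le t ht)
  have h1 := hW.sn_freq_potential_le hab hN (continuous_syn hct) (periodic_syn hab _) hi
    (hc.norm_syn_le ht)
  have h2 := (isAveraging_avgVol hab N).sn_freq_coef_le_of_incr hab hN
    (continuous_cub.comp (continuous_syn hct)) ((periodic_syn hab (c t)).comp cub)
    (e := 3 * M ^ 2 * M₁) ((l2_incr_comp_le hab (by positivity) (continuous_syn hct)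
      (periodic_syn hab _) fun x y => norm_cub_sub_le (hc.norm_syn_le ht x)
        (hc.norm_syn_le ht y)).trans ((mul_le_mul_of_nonneg_left hi (by positivity)).trans
      (le_of_eq (by ring))))
  have e : ∀ l, (freq a b l : ℂ) * forceCoef a b β V (c t) l =
      (freq a b l : ℂ) * coef a b (avgVol a b) (fun x => (V x : ℂ) * syn a b (c t) x) l +
      β * ((freq a b l : ℂ) * coef a b (avgVol a b) (fun x => cub (syn a b (c t) x)) l) :=
    fun l => by rw [forceCoef_eq hab hc.meas hc.bound hct]; ring
  simp_rw [e]
  refine (sn_add_le _ _ _).trans (add_le_add h1 ?_)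
  rw [sn_const_mul, Complex.norm_real, Real.norm_eq_abs]
  exact mul_le_mul_of_nonneg_left h2 (abs_nonneg β)

lemma sn_freq_force_sub_le (hs : SmoothFlow a b T M₁ K₁ c)
    (hc : FourierFlow a b T β M B K V c) (hW : SmoothPotential a b B' KV V W) (hab : a < b)
    (hN : 0 < N) {s t : ℝ} (hsT : s ∈ Icc 0 T) (htT : t ∈ Icc 0 T) :
    sn (modes N) (fun l => (freq a b l : ℂ) *
      (forceCoef a b β V (c t) l - forceCoef a b β V (c s) l)) ≤
      (2 * (B' * K₁ + (K + sobConst a b * K₁) * KV) + |β| * (2 * (3 * M ^ 2 * K₁ +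
        3 * M * (K + sobConst a b * K₁) * (2 * M₁)))) * |t - s| := by
  have hp0 := avgVol_prob hab
  have hct := hc.summable t htT
  have hcs := hc.summable s hsT
  have hM := hc.M_nonneg
  have hK := hs.K_nonneg
  have hK' := hc.K_nonneg
  have hM₁ := hs.M_nonneg
  have hh := mesh_pos hab hN
  have hσ := sobConst_nonneg a b
  have hst := hs.summable_sub s hsT t htT
  have hd := summable_norm_of_freq hab hst
  have hsup := hs.norm_syn_sub_le hc hab hsT htT
  have e : syn a b (fun l => c t l - c s l) = fun x => syn a b (c t) x - syn a b (c s) x :=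
    funext (syn_sub hct hcs)
  have hi := l2_incr_syn_le hab hd hh.le (by positivity) hst (hs.lip s hsT t htT)
  rw [e] at hi
  have cd := (continuous_syn (a := a) (b := b) hct).sub
    (continuous_syn (a := a) (b := b) hcs)
  have pd := (periodic_syn hab (c t)).sub (periodic_syn hab (c s))
  have h1 := hW.sn_freq_potential_le hab hN cd pd hi hsup
  have it := fun r (hr : r ∈ Icc 0 T) => l2_incr_syn_le hab (hc.summable r hr) hh.le hM₁
    (hs.summable_one r hr) (hs.tsum_one_le r hr)
  have h2 := (isAveraging_avgVol hab N).sn_freq_coef_le_of_incr hab hN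
    ((continuous_cub.comp (continuous_syn hct)).sub (continuous_cub.comp (continuous_syn hcs)))
    (((periodic_syn hab (c t)).comp cub).sub ((periodic_syn hab (c s)).comp cub))
    (e := 3 * M ^ 2 * (K₁ * |t - s|) +
      3 * M * ((K + sobConst a b * K₁) * |t - s|) * (M₁ + M₁))
    ((l2_incr_cub_sub_le hab (continuous_syn hct) (periodic_syn hab _) (continuous_syn hcs)
      (periodic_syn hab _) (hc.norm_syn_le htT) (hc.norm_syn_le hsT) hsup).trans (by
      calc _ ≤ 3 * M ^ 2 * (mesh a b N * (K₁ * |t - s|)) +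
            3 * M * ((K + sobConst a b * K₁) * |t - s|) *
              (mesh a b N * M₁ + mesh a b N * M₁) := by
            gcongr
            · exact it t htT
            · exact it s hsT
        _ = _ := by ring))
  have mV := fun r (hr : r ∈ Icc 0 T) => memLp_potential_mul hc.meas hc.bound
    (memLp_syn (a := a) (b := b) (ν := avgVol a b) (hc.summable r hr))
  have mc : ∀ r ∈ Icc 0 T, MemLp (fun x => cub (syn a b (c r) x)) 2 (avgVol a b) := fun r hr =>
    memLp_cub (continuous_syn (hc.summable r hr)) (hc.norm_syn_le hr)
  have e2 : ∀ l, (freq a b l : ℂ) * (forceCoef a b β V (c t) l - forceCoef a b β V (c s) l) =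
      (freq a b l : ℂ) * coef a b (avgVol a b)
        (fun x => (V x : ℂ) * (syn a b (c t) x - syn a b (c s) x)) l +
      β * ((freq a b l : ℂ) * coef a b (avgVol a b)
        (fun x => cub (syn a b (c t) x) - cub (syn a b (c s) x)) l) := fun l => by
    simp_rw [mul_sub ((V _ : ℝ) : ℂ)]
    rw [forceCoef_eq hab hc.meas hc.bound hct, forceCoef_eq hab hc.meas hc.bound hcs,
      coef_sub (mV t htT) (mV s hsT), coef_sub (mc t htT) (mc s hsT)]
    ring
  simp_rw [e2]
  have h3 : sn (modes N) (fun l => (β : ℂ) * ((freq a b l : ℂ) * coef a b (avgVol a b)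
        (fun x => cub (syn a b (c t) x) - cub (syn a b (c s) x)) l)) ≤ |β| * (2 * (3 * M ^ 2 *
      (K₁ * |t - s|) + 3 * M * ((K + sobConst a b * K₁) * |t - s|) * (M₁ + M₁))) := by
    rw [sn_const_mul, Complex.norm_real, Real.norm_eq_abs]
    exact mul_le_mul_of_nonneg_left h2 (abs_nonneg β)
  refine (sn_add_le _ _ _).trans ((add_le_add h1 h3).trans (le_of_eq ?_))
  ring

/-- Convergence of second order in space and first order in time in the `H¹` seminorm, given the
corresponding `L²` estimate. -/
theorem h1_error (hs : SmoothFlow a b T M₁ K₁ c) (hc : FourierFlow a b T β M B K V c)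
    (hW : SmoothPotential a b B' KV V W) (hab : a < b) (hT : 0 < T)
    (hψ₀ : ∀ x ∈ Icc a b, ψ₀ x = syn a b (c 0) x) {C₀ : ℝ} (hC₀ : 0 < C₀) :
    ∃ C : ℝ, 0 < C ∧ ∀ (N : ℕ) (τ : ℝ), 0 < N → Even N → mesh a b N ≤ 1 → 0 < τ →
      τ ≤ mesh a b N ^ 2 / Real.pi → (∀ n : ℕ, n * τ ≤ T →
        sn (modes N) (fun l => c (n * τ) l - numCoef a b β V ψ₀ τ N n l) ≤
          C₀ * (τ + mesh a b N ^ 2) ∧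
        ∑ l ∈ modes N, ‖numCoef a b β V ψ₀ τ N n l‖ ≤ M + 1) → ∀ n : ℕ, n * τ ≤ T →
        sn (modes N) (fun l => (freq a b l : ℂ) *
          (c (n * τ) l - numCoef a b β V ψ₀ τ N n l)) ≤ C * (τ + mesh a b N ^ 2) := by
  have hM := hc.M_nonneg
  have hK := hs.K_nonneg
  have hK' := hc.K_nonneg
  have hM₁ := hs.M_nonneg
  have hKV := hW.KV_nonneg
  have hσ := sobConst_nonneg a b
  have hA0 := aliasConst_nonneg
  have hB' : 0 ≤ B' := (abs_nonneg _).trans (hW.bound 0)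
  have hpi := Real.pi_pos
  have h0T : (0 : ℝ) ∈ Icc 0 T := ⟨le_rfl, hT.le⟩
  have hVB : ∀ᵐ x ∂vol a b, |V x| ≤ B' := by
    filter_upwards [hW.ae] with x hx
    rw [hx]; exact hW.bound x
  -- An `H¹` bound for the numerical solution: by the inverse inequality its distance to the exact
  -- one is at most `(π/h) C₀ (τ + h²) ≤ 2πC₀h`. Hence no second bootstrap is needed.
  set D := M₁ + Real.pi * (2 * C₀) with hD
  have hD0 : 0 ≤ D := by positivity
  obtain ⟨Q, X, hQ, hX, hdef⟩ := exists_sn_freq_defect_le hab β (M := M + 1) (M₁ := D)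
    (by positivity) hD0 hW hc.meas hVB
  set Mf := 2 * (B' * M₁ + M * KV) + |β| * (2 * (3 * M ^ 2 * M₁)) with hMf
  have hMf0 : 0 ≤ Mf := by positivity
  set Kf := 2 * (B' * K₁ + (K + sobConst a b * K₁) * KV) + |β| * (2 * (3 * M ^ 2 * K₁ +
        3 * M * (K + sobConst a b * K₁) * (2 * M₁))) with hKf
  have hKf0 : 0 ≤ Kf := by positivity
  set C := Real.exp (Q * T) * (aliasConst * M₁ + 2 * Mf + T * ((Kf + X * (C₀ + 1)) +
    X * (C₀ + 1) + 2 * Q * Mf + 2 * Kf)) + 2 * Mf with hC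
  have hC0 : 0 ≤ C := by positivity
  refine ⟨C + 1, by linarith, ?_⟩
  intro N τ hN hNe hmesh hτ hτh hL2 n hn
  have hh := mesh_pos hab hN
  have hτ2 := step_le_mesh_sq hτh
  have hm2 : mesh a b N ^ 2 ≤ 1 := pow_le_one₀ hh.le hmesh
  have hk : ∀ k ≤ n, (k : ℝ) * τ ∈ Icc 0 T := fun k hk => by
    have : (k : ℝ) ≤ n := by exact_mod_cast hk
    exact ⟨by positivity, le_trans (by gcongr) hn⟩
  have hsucc : ∀ k : ℕ, ((k + 1 : ℕ) : ℝ) * τ = k * τ + τ := fun k => by push_cast; ring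
  have hnum : ∀ k ≤ n, sn (modes N) (fun l => (freq a b l : ℂ) * numCoef a b β V ψ₀ τ N k l) ≤
      D := fun k hkn => by
    have h1 := sn_freq_le_inverse hab hN
      (fun l => c (k * τ) l - numCoef a b β V ψ₀ τ N k l)
    have h2 : Real.pi / mesh a b N * sn (modes N) (fun l => c (k * τ) l -
        numCoef a b β V ψ₀ τ N k l) ≤ Real.pi * (2 * C₀) := by
      calc _ ≤ Real.pi / mesh a b N * (C₀ * (mesh a b N ^ 2 + mesh a b N ^ 2)) := by
            gcongr
            exact (hL2 k (hk k hkn).2).1.trans (by gcongr)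
        _ = Real.pi * (2 * C₀) * mesh a b N := by field_simp; ring
        _ ≤ _ := mul_le_of_le_one_right (by positivity) hmesh
    have h3 := sn_le_of_tsum (modes N) (hs.summable_one _ (hk k hkn)) hM₁
      (hs.tsum_one_le _ (hk k hkn))
    have e : ∀ l, (freq a b l : ℂ) * numCoef a b β V ψ₀ τ N k l = (freq a b l : ℂ) * c (k * τ) l -
        (freq a b l : ℂ) * (c (k * τ) l - numCoef a b β V ψ₀ τ N k l) := fun l => by ring
    simp_rw [e]
    exact (sn_sub_le _ _ _).trans (add_le_add h3 (h1.trans h2))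
  have hrec := sn_recursion_le (S := modes N) (κ := fun l => freq a b l ^ 2) (τ := τ)
    (E := fun k l => (freq a b l : ℂ) * (c (k * τ) l - numCoef a b β V ψ₀ τ N k l))
    (F := fun k l => (freq a b l : ℂ) * forceCoef a b β V (c (k * τ)) l)
    (R := fun k l => (freq a b l : ℂ) *
      (Complex.exp (Complex.I * ((τ * freq a b l ^ 2 : ℝ) : ℂ)) * c (k * τ + τ) l -
        c (k * τ) l + Complex.I * osc (freq a b l ^ 2) τ * forceCoef a b β V (c (k * τ)) l) +
      (freq a b l : ℂ) * (-Complex.I * τ * forceCoef a b β V (c (k * τ)) l -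
      (coef a b (avgVol a b) (fun x => Complex.exp (-Complex.I * ((τ * V x : ℝ) : ℂ)) *
        trig a b (modes N) (flowCoef a b τ β N (numCoef a b β V ψ₀ τ N k)) x) l -
          numCoef a b β V ψ₀ τ N k l)))
    (n := n) (M := Mf) (K := Kf) (Q := Q)
    (δ := (Kf + X * (C₀ + 1)) * τ + X * (C₀ + 1) * mesh a b N ^ 2)
    hτ (fun l => sq_nonneg _) (fun l hl => step_mul_freq_sq_le hab hτh hl) hMf0 hKf0 hQ
    (by positivity)
    (fun k _ l hl => by
      rw [hsucc, FourierFlow.error_succ hab hN hNe _ k hl]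
      ring)
    (fun k hkn => hs.sn_freq_force_le hc hW hab hN (hk k hkn))
    (fun k hkn => by
      have h := hs.sn_freq_force_sub_le hc hW hab hN (hk k hkn.le) (hk (k + 1) hkn)
      rw [hsucc, add_sub_cancel_left, abs_of_pos hτ] at h
      simp_rw [← mul_sub]
      rw [hsucc]
      exact h)
    (fun k hkn => by
      have htk := hk k hkn.le
      have htk' := hk (k + 1) hkn
      rw [hsucc] at htk'
      have hMD : M₁ ^ 2 ≤ D ^ 2 :=
        pow_le_pow_left₀ hM₁ (le_add_of_nonneg_right (by positivity)) 2
      obtain ⟨i1, i2⟩ := hL2 k htk.2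
      have h1 := hc.sn_freq_duhamel_le (N := N) htk.1 hτ.le htk'.2 hKf0
        fun s hsT t htT => hs.sn_freq_force_sub_le hc hW hab hN hsT htT
      have h2 := hdef N τ (c (k * τ)) (numCoef a b β V ψ₀ τ N k) hN hNe hτ.le (hτ2.trans hm2)
        (hc.summable _ htk) ((hc.tsum_le _ htk).trans (by linarith)) i2
        (hs.summable_one _ htk) ((hs.tsum_one_le _ htk).trans hMD)
        (hs.summable_three _ htk) ((hs.tsum_three_le _ htk).trans hMD) (hnum k hkn.le)
      refine (sn_add_le _ _ _).trans ((add_le_add h1 h2).trans ?_)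
      have i3 := mul_le_mul_of_nonneg_left (mul_le_mul_of_nonneg_left i1 hX) hτ.le
      linarith)
  have hE0 : sn (modes N) (fun l => (freq a b l : ℂ) *
      (c ((0 : ℕ) * τ) l - numCoef a b β V ψ₀ τ N 0 l)) ≤ aliasConst * M₁ * mesh a b N ^ 2 := by
    have h := sn_freq_alias_le hab hN (hc.summable 0 h0T) 1 hM₁
      (hs.summable_three 0 h0T) (hs.tsum_three_le 0 h0T)
    simp only [pow_one] at h
    simp_rw [numCoef_zero, coef_avgGrid_init hab hN hψ₀, Nat.cast_zero, zero_mul]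
    exact h.trans (le_of_eq (by ring))
  refine hrec.trans ((recursion_bound_le (e0 := aliasConst * M₁) hQ hn hT.le hMf0 hKf0 hτ.le
    (sq_nonneg _) (by positivity) hE0 rfl (by positivity) (by positivity)).trans ?_)
  have : 0 ≤ τ + mesh a b N ^ 2 := by positivity
  refine mul_le_mul_of_nonneg_right ?_ this
  linarith

end SmoothFlow

end GPE

namespace GPE

variable {a b : ℝ}

/-! ## Weak derivatives -/

instance (a b : ℝ) : IsFiniteMeasure (vol a b) := ⟨by simp [vol]⟩

lemma HasWeakDeriv.congr {E : Type} [NormedAddCommGroup E] [NormedSpace ℝ E] {k : ℕ}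
    {u u' v v' : ℝ → E} (h : HasWeakDeriv a b k u v) (hu : u =ᵐ[vol a b] u')
    (hv : v =ᵐ[vol a b] v') : HasWeakDeriv a b k u' v' := fun φ h1 h2 h3 => by
  have e1 : ∫ x in Ioo a b, iteratedDeriv k φ x • u' x = ∫ x in Ioo a b, iteratedDeriv k φ x • u x :=
    integral_congr_ae (hu.mono fun x hx => by simp only [hx])
  have e2 : ∫ x in Ioo a b, φ x • v' x = ∫ x in Ioo a b, φ x • v x :=
    integral_congr_ae (hv.mono fun x hx => by simp only [hx])
  rw [e1, e2]
  exact h φ h1 h2 h3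

lemma integrable_continuous_smul {E : Type} [NormedAddCommGroup E] [NormedSpace ℝ E]
    {φ : ℝ → ℝ} (hφ : Continuous φ) {u : ℝ → E} (hu : Integrable u (vol a b)) :
    Integrable (fun x => φ x • u x) (vol a b) := by
  obtain ⟨C, hC⟩ := (isCompact_Icc (a := a) (b := b)).exists_bound_of_continuousOn hφ.continuousOn
  refine hu.bdd_smul C hφ.aestronglyMeasurable ?_
  filter_upwards [ae_restrict_mem measurableSet_Ioo] with x hx
  exact hC x (Ioo_subset_Icc_self hx)

/-- The fundamental lemma of the calculus of variations. It reconciles the various families of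
derivatives attached to one function. -/
lemma HasWeakDeriv.ae_unique {k : ℕ} {u v v' : ℝ → ℂ} (h : HasWeakDeriv a b k u v)
    (h' : HasWeakDeriv a b k u v') (hv : MemLp v 2 (vol a b)) (hv' : MemLp v' 2 (vol a b)) :
    v =ᵐ[vol a b] v' := by
  have hi := hv.integrable (by norm_num)
  have hi' := hv'.integrable (by norm_num)
  have key := isOpen_Ioo.ae_eq_zero_of_integral_contDiff_smul_eq_zero (μ := vol a b) (U := Ioo a b)
    (f := fun x => v x - v' x) ((hi.sub hi').locallyIntegrable.locallyIntegrableOn _)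
    (fun φ h1 h2 h3 => by
      simp_rw [smul_sub]
      rw [integral_sub (integrable_continuous_smul h1.continuous hi)
        (integrable_continuous_smul h1.continuous hi'), sub_eq_zero]
      have e := (h φ h1 h2 h3).symm.trans (h' φ h1 h2 h3)
      exact smul_right_injective ℂ (pow_ne_zero k (by norm_num : (-1 : ℝ) ≠ 0)) e)
  filter_upwards [key, ae_restrict_mem measurableSet_Ioo] with x hx hm
  exact sub_eq_zero.1 (hx hm)

/-- The order `k` identity is tested with `φ'`, which is again admissible. -/
lemma HasWeakDeriv.succ {E : Type} [NormedAddCommGroup E] [NormedSpace ℝ E] {k : ℕ}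
    {u v w : ℝ → E} (h : HasWeakDeriv a b k u v) (h' : HasWeakDeriv a b (k + 1) u w) :
    HasWeakDeriv a b 1 v w := fun φ h1 h2 h3 => by
  have hd : ContDiff ℝ ∞ (deriv φ) := h1.iterate_deriv 1
  have hs : tsupport (deriv φ) ⊆ Ioo a b := (tsupport_deriv_subset (𝕜 := ℝ)).trans h3
  have e1 := h (deriv φ) hd h2.deriv hs
  have e2 := h' φ h1 h2 h3
  rw [iteratedDeriv_succ', e1, pow_succ, mul_smul] at e2
  rw [iteratedDeriv_one, pow_one]
  exact smul_right_injective E (pow_ne_zero k (by norm_num : (-1 : ℝ) ≠ 0)) e2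

lemma HasWeakDeriv.ofReal {k : ℕ} {u v : ℝ → ℝ} (h : HasWeakDeriv a b k u v) :
    HasWeakDeriv a b k (fun x => (u x : ℂ)) (fun x => (v x : ℂ)) := fun φ h1 h2 h3 => by
  have e : ∀ (f g : ℝ → ℝ), ∫ x in Ioo a b, f x • (g x : ℂ) =
      ((∫ x in Ioo a b, f x • g x : ℝ) : ℂ) := fun f g => by
    rw [← integral_complex_ofReal]
    refine integral_congr_ae (Eventually.of_forall fun x => ?_)
    simp
  rw [e, e, h φ h1 h2 h3]
  simp

/-! ### Cut-off functions -/

/-- A smooth function equal to `1` on `[a + 2/n, b - 2/n]` and to `0` off `(a + 1/n, b - 1/n)`. -/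
noncomputable def cutoff (a b : ℝ) (n : ℕ) (x : ℝ) : ℝ :=
  Real.smoothTransition (n * (x - a) - 1) * Real.smoothTransition (n * (b - x) - 1)

lemma contDiff_cutoff (a b : ℝ) (n : ℕ) : ContDiff ℝ ∞ (cutoff a b n) := by
  unfold cutoff
  exact (Real.smoothTransition.contDiff.comp (by fun_prop)).mul
    (Real.smoothTransition.contDiff.comp (by fun_prop))

lemma abs_cutoff_le (n : ℕ) (x : ℝ) : |cutoff a b n x| ≤ 1 := by
  unfold cutoff
  rw [abs_mul, abs_of_nonneg (Real.smoothTransition.nonneg _),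
    abs_of_nonneg (Real.smoothTransition.nonneg _)]
  exact mul_le_one₀ (Real.smoothTransition.le_one _) (Real.smoothTransition.nonneg _)
    (Real.smoothTransition.le_one _)

lemma tsupport_cutoff_subset {n : ℕ} (hn : 0 < n) : tsupport (cutoff a b n) ⊆
    Icc (a + 1 / n) (b - 1 / n) := by
  have hn' : (0 : ℝ) < n := by exact_mod_cast hn
  refine closure_minimal (fun x hx => ?_) isClosed_Icc
  rw [Function.mem_support] at hx
  unfold cutoff at hx
  obtain ⟨h1, h2⟩ := mul_ne_zero_iff.1 hx
  rw [Ne, Real.smoothTransition.zero_iff_nonpos, not_le] at h1 h2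
  have e1 : 1 / (n : ℝ) ≤ x - a := by rw [div_le_iff₀ hn']; linarith
  have e2 : 1 / (n : ℝ) ≤ b - x := by rw [div_le_iff₀ hn']; linarith
  exact ⟨by linarith, by linarith⟩

lemma tendsto_cutoff {x : ℝ} (hx : x ∈ Ioo a b) :
    Tendsto (fun n : ℕ => cutoff a b n x) atTop (𝓝 1) := by
  have h : ∀ {r : ℝ}, 0 < r → ∀ᶠ n : ℕ in atTop, Real.smoothTransition (n * r - 1) = 1 :=
    fun {r} hr => by
    filter_upwards [tendsto_natCast_atTop_atTop.eventually_ge_atTop (2 / r)] with n hn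
    refine Real.smoothTransition.one_of_one_le ?_
    rw [div_le_iff₀ hr] at hn
    linarith
  refine tendsto_const_nhds.congr' ?_
  filter_upwards [h (sub_pos.2 hx.1), h (sub_pos.2 hx.2)] with n h1 h2
  rw [cutoff, h1, h2, one_mul]

lemma deriv_smoothTransition_eq_zero {x : ℝ} (hx : x ∉ Icc (0 : ℝ) 1) :
    deriv Real.smoothTransition x = 0 := by
  rw [mem_Icc, not_and_or, not_le, not_le] at hx
  rcases hx with hx | hx
  · have : Real.smoothTransition =ᶠ[𝓝 x] fun _ => 0 := by
      filter_upwards [Iio_mem_nhds hx] with y hy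
      exact Real.smoothTransition.zero_of_nonpos (le_of_lt hy)
    rw [this.deriv_eq, deriv_const]
  · have : Real.smoothTransition =ᶠ[𝓝 x] fun _ => 1 := by
      filter_upwards [Ioi_mem_nhds hx] with y hy
      exact Real.smoothTransition.one_of_one_le (le_of_lt hy)
    rw [this.deriv_eq, deriv_const]

lemma exists_abs_deriv_smoothTransition_le :
    ∃ C : ℝ, 0 < C ∧ ∀ x, |deriv Real.smoothTransition x| ≤ C := by
  have hc : Continuous (deriv Real.smoothTransition) :=
    (Real.smoothTransition.contDiff (n := 1)).continuous_deriv le_rfl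
  obtain ⟨C, hC⟩ := (isCompact_Icc (a := (0 : ℝ)) (b := 1)).exists_bound_of_continuousOn
    hc.continuousOn
  have hC0 : 0 ≤ C := (norm_nonneg _).trans (hC 0 ⟨le_rfl, zero_le_one⟩)
  refine ⟨C + 1, by linarith, fun x => ?_⟩
  by_cases hx : x ∈ Icc (0 : ℝ) 1
  · have := hC x hx
    rw [Real.norm_eq_abs] at this
    linarith
  · rw [deriv_smoothTransition_eq_zero hx, abs_zero]
    linarith

lemma hasDerivAt_cutoff (a b : ℝ) (n : ℕ) (x : ℝ) : HasDerivAt (cutoff a b n)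
    (n * (deriv Real.smoothTransition (n * (x - a) - 1) *
        Real.smoothTransition (n * (b - x) - 1) -
      Real.smoothTransition (n * (x - a) - 1) *
        deriv Real.smoothTransition (n * (b - x) - 1))) x := by
  have hd : ∀ y, HasDerivAt Real.smoothTransition (deriv Real.smoothTransition y) y := fun y =>
    ((Real.smoothTransition.contDiff (n := 1)).differentiable one_ne_zero y).hasDerivAt
  have h1 : HasDerivAt (fun x : ℝ => n * (x - a) - 1) n x := by
    simpa using (((hasDerivAt_id x).sub_const a).const_mul (n : ℝ)).sub_const 1
  have h2 : HasDerivAt (fun x : ℝ => n * (b - x) - 1) (-n) x := by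
    simpa using (((hasDerivAt_id x).const_sub b).const_mul (n : ℝ)).sub_const 1
  have h := ((hd _).comp x h1).mul ((hd _).comp x h2)
  refine h.congr_deriv ?_
  simp only [Function.comp_apply]
  ring

/-- The derivative of the cut-off is of size `n` but lives on two intervals of length `O(1/n)` at
the end points, where `w` tends to zero. -/
lemma tendsto_integral_deriv_cutoff {v w : ℝ → ℂ} (hab : a < b) (hw : ContinuousOn w (Icc a b))
    (ha : w a = 0) (hb : w b = 0) (hv : v =ᵐ[vol a b] w) {E : ℝ → ℝ} (hE : ∀ x, |E x| ≤ 1) :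
    Tendsto (fun n : ℕ => ∫ x in Ioo a b, (deriv (cutoff a b n) x * E x) • v x) atTop (𝓝 0) := by
  obtain ⟨C, hC, hCb⟩ := exists_abs_deriv_smoothTransition_le
  rw [Metric.tendsto_atTop]
  intro ε hε
  -- Two intervals of length `3/n`, with height `nC`, give `6Cε' = (6/8) ε < ε`.
  set ε' := ε / (8 * C) with hε'
  have hε'0 : 0 < ε' := by positivity
  obtain ⟨δ₁, hδ₁, h₁⟩ := Metric.continuousWithinAt_iff.1 (hw a ⟨le_rfl, hab.le⟩) ε' hε'0
  obtain ⟨δ₂, hδ₂, h₂⟩ := Metric.continuousWithinAt_iff.1 (hw b ⟨hab.le, le_rfl⟩) ε' hε'0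
  obtain ⟨n₀, hn₀⟩ := exists_nat_gt (3 / min δ₁ δ₂)
  have hδ : 0 < min δ₁ δ₂ := lt_min hδ₁ hδ₂
  refine ⟨n₀, fun n hn => ?_⟩
  have hnn : 3 / min δ₁ δ₂ < n := hn₀.trans_le (by exact_mod_cast hn)
  have hn0 : (0 : ℝ) < n := lt_trans (by positivity) hnn
  have h3 : 3 / (n : ℝ) < min δ₁ δ₂ := by
    rw [div_lt_iff₀ hδ] at hnn
    rw [div_lt_iff₀ hn0, mul_comm]
    exact hnn
  rw [dist_zero_right]
  have hI : ∀ y : ℝ, ∫ x in Ioo a b, (Ioo y (y + 3 / n)).indicator (fun _ => (1 : ℝ)) x ≤ 3 / n :=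
    fun y => by
    rw [integral_indicator measurableSet_Ioo, setIntegral_const, smul_eq_mul, mul_one,
      measureReal_restrict_apply measurableSet_Ioo]
    refine (measureReal_mono inter_subset_left measure_Ioo_lt_top.ne).trans ?_
    rw [Real.volume_real_Ioo_of_le (by linarith [show 0 < 3 / (n : ℝ) by positivity]),
      add_sub_cancel_left]
  have hint : ∀ y : ℝ, Integrable ((Ioo y (y + 3 / n)).indicator (fun _ => (1 : ℝ))) (vol a b) :=
    fun y => (integrable_const (1 : ℝ)).indicator measurableSet_Ioo
  have hbd : ∀ᵐ x ∂vol a b, ‖(deriv (cutoff a b n) x * E x) • v x‖ ≤ n * C * ε' *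
      ((Ioo a (a + 3 / n)).indicator (fun _ => (1 : ℝ)) x +
        (Ioo (b - 3 / n) (b - 3 / n + 3 / n)).indicator (fun _ => (1 : ℝ)) x) := by
    filter_upwards [hv, ae_restrict_mem measurableSet_Ioo] with x hx hm
    rw [hx, (hasDerivAt_cutoff a b n x).deriv, norm_smul, Real.norm_eq_abs, abs_mul, abs_mul,
      abs_of_pos hn0]
    have k1 : |deriv Real.smoothTransition (n * (x - a) - 1)| * ‖w x‖ ≤
        C * ε' * (Ioo a (a + 3 / n)).indicator (fun _ => (1 : ℝ)) x := by
      by_cases hp : (n : ℝ) * (x - a) - 1 ∈ Icc (0 : ℝ) 1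
      · have e : x - a < 3 / n := by rw [lt_div_iff₀ hn0]; linarith [hp.2]
        rw [indicator_of_mem (show x ∈ Ioo a (a + 3 / n) from ⟨hm.1, by linarith⟩), mul_one]
        have := h₁ (Ioo_subset_Icc_self hm) (by
          rw [Real.dist_eq, abs_of_pos (sub_pos.2 hm.1)]
          exact e.trans (h3.trans_le (min_le_left _ _)))
        rw [ha, dist_zero_right] at this
        exact mul_le_mul (hCb _) this.le (norm_nonneg _) hC.le
      · rw [deriv_smoothTransition_eq_zero hp, abs_zero, zero_mul]
        exact mul_nonneg (by positivity) (indicator_nonneg (fun _ _ => zero_le_one) _)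
    have k2 : |deriv Real.smoothTransition (n * (b - x) - 1)| * ‖w x‖ ≤
        C * ε' * (Ioo (b - 3 / n) (b - 3 / n + 3 / n)).indicator (fun _ => (1 : ℝ)) x := by
      by_cases hp : (n : ℝ) * (b - x) - 1 ∈ Icc (0 : ℝ) 1
      · have e : b - x < 3 / n := by rw [lt_div_iff₀ hn0]; linarith [hp.2]
        rw [indicator_of_mem (show x ∈ Ioo (b - 3 / n) (b - 3 / n + 3 / n) from
          ⟨by linarith, by linarith [hm.2]⟩), mul_one]
        have := h₂ (Ioo_subset_Icc_self hm) (by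
          rw [Real.dist_eq, abs_sub_comm, abs_of_pos (sub_pos.2 hm.2)]
          exact e.trans (h3.trans_le (min_le_right _ _)))
        rw [hb, dist_zero_right] at this
        exact mul_le_mul (hCb _) this.le (norm_nonneg _) hC.le
      · rw [deriv_smoothTransition_eq_zero hp, abs_zero, zero_mul]
        exact mul_nonneg (by positivity) (indicator_nonneg (fun _ _ => zero_le_one) _)
    have k3 : |deriv Real.smoothTransition (n * (x - a) - 1) *
          Real.smoothTransition (n * (b - x) - 1) -
        Real.smoothTransition (n * (x - a) - 1) *
          deriv Real.smoothTransition (n * (b - x) - 1)| ≤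
        |deriv Real.smoothTransition (n * (x - a) - 1)| +
          |deriv Real.smoothTransition (n * (b - x) - 1)| := by
      refine (abs_sub _ _).trans (add_le_add ?_ ?_)
      · rw [abs_mul, abs_of_nonneg (Real.smoothTransition.nonneg _)]
        exact mul_le_of_le_one_right (abs_nonneg _) (Real.smoothTransition.le_one _)
      · rw [abs_mul, abs_of_nonneg (Real.smoothTransition.nonneg _)]
        exact mul_le_of_le_one_left (abs_nonneg _) (Real.smoothTransition.le_one _)
    calc _ ≤ n * (|deriv Real.smoothTransition (n * (x - a) - 1)| +
          |deriv Real.smoothTransition (n * (b - x) - 1)|) * 1 * ‖w x‖ := by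
          gcongr
          exact hE x
      _ = n * (|deriv Real.smoothTransition (n * (x - a) - 1)| * ‖w x‖ +
          |deriv Real.smoothTransition (n * (b - x) - 1)| * ‖w x‖) := by ring
      _ ≤ n * (C * ε' * (Ioo a (a + 3 / n)).indicator (fun _ => (1 : ℝ)) x + C * ε' *
          (Ioo (b - 3 / n) (b - 3 / n + 3 / n)).indicator (fun _ => (1 : ℝ)) x) := by gcongr
      _ = _ := by ring
  refine (norm_integral_le_of_norm_le (((hint a).add (hint (b - 3 / n))).const_mul _)
    hbd).trans_lt ?_
  simp only [Pi.add_apply]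
  rw [integral_const_mul, integral_add (hint _) (hint _)]
  calc _ ≤ n * C * ε' * (3 / n + 3 / n) := by
        gcongr
        · exact hI a
        · exact hI _
    _ = ε * (6 / 8) := by rw [hε']; field_simp; ring
    _ < ε := by linarith

/-- Integration by parts against a smooth function with equal values at the end points. -/
lemma HasWeakDeriv.integral_deriv_smul {u g w : ℝ → ℂ} (h : HasWeakDeriv a b 1 u g) (hab : a < b)
    (hu : MemLp u 2 (vol a b)) (hg : MemLp g 2 (vol a b)) (hw : ContinuousOn w (Icc a b))
    (hwab : w a = w b) (huw : u =ᵐ[vol a b] w) {E : ℝ → ℝ} (hE : ContDiff ℝ ∞ E)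
    (hE1 : ∀ x, |E x| ≤ 1) (hEab : E a = E b) :
    ∫ x in Ioo a b, deriv E x • u x = -∫ x in Ioo a b, E x • g x := by
  have hui := hu.integrable (by norm_num)
  have hgi := hg.integrable (by norm_num)
  have hE' : Continuous (deriv E) := hE.continuous_deriv (by norm_num)
  -- Subtracting the common boundary value makes the function vanish at both ends, which removes the
  -- boundary terms; `hdE` and `hsub` show that the constant does not affect the integral.
  have hvi : Integrable (fun x => u x - w a) (vol a b) := hui.sub (integrable_const _)
  have hdE : ∀ φ : ℝ → ℝ, ContDiff ℝ ∞ φ → φ a = φ b →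
      ∫ x in Ioo a b, deriv φ x • w a = 0 := fun φ hφ hab' => by
    rw [integral_smul_const, ← integral_Ioc_eq_integral_Ioo,
      ← intervalIntegral.integral_of_le hab.le, intervalIntegral.integral_deriv_eq_sub, hab',
      sub_self, zero_smul]
    · exact fun x _ => hφ.differentiable (by norm_num) x
    · exact (hφ.continuous_deriv (by norm_num)).intervalIntegrable _ _
  have hsub : ∀ φ : ℝ → ℝ, ContDiff ℝ ∞ φ → φ a = φ b →
      ∫ x in Ioo a b, deriv φ x • (u x - w a) = ∫ x in Ioo a b, deriv φ x • u x :=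
    fun φ hφ hab' => by
    have hc := hφ.continuous_deriv (n := ∞) (by norm_num)
    simp_rw [smul_sub]
    rw [integral_sub (integrable_continuous_smul hc hui)
      (integrable_continuous_smul hc (integrable_const _)), hdE φ hφ hab', sub_zero]
  -- The weak derivative is tested with `cutoff · E`, which has compact support in the open
  -- interval; then `n → ∞`.
  have key : ∀ n : ℕ, 0 < n → ∫ x in Ioo a b, (deriv (cutoff a b n) x * E x) • (u x - w a) =
      -(∫ x in Ioo a b, cutoff a b n x • (E x • g x)) -
        ∫ x in Ioo a b, cutoff a b n x • (deriv E x • (u x - w a)) := fun n hn => by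
    have hn' : (0 : ℝ) < 1 / n := by positivity
    have hφ : ContDiff ℝ ∞ (fun x => cutoff a b n x * E x) := (contDiff_cutoff a b n).mul hE
    have hts : tsupport (fun x => cutoff a b n x * E x) ⊆ Icc (a + 1 / n) (b - 1 / n) :=
      (tsupport_mul_subset_left).trans (tsupport_cutoff_subset hn)
    have hts' : tsupport (fun x => cutoff a b n x * E x) ⊆ Ioo a b :=
      hts.trans (Icc_subset_Ioo (by linarith) (by linarith))
    have hz : ∀ x ∉ Ioo a b, cutoff a b n x * E x = 0 := fun x hx =>
      image_eq_zero_of_notMem_tsupport (f := fun x => cutoff a b n x * E x) fun h' => hx (hts' h')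
    have e := h _ hφ (isCompact_Icc.of_isClosed_subset (isClosed_tsupport _) hts) hts'
    rw [iteratedDeriv_one, ← hsub _ hφ (by rw [hz a (by simp), hz b (by simp)])] at e
    have hd : ∀ x, deriv (fun x => cutoff a b n x * E x) x =
        deriv (cutoff a b n) x * E x + cutoff a b n x * deriv E x := fun x =>
      deriv_fun_mul ((contDiff_cutoff a b n).differentiable (by norm_num) x)
        (hE.differentiable (by norm_num) x)
    simp_rw [hd, add_smul] at e
    have j1 := integrable_continuous_smul (φ := fun x => deriv (cutoff a b n) x * E x)
      (((contDiff_cutoff a b n).continuous_deriv (by norm_num)).mul hE.continuous) hvi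
    have j2 := integrable_continuous_smul (φ := fun x => cutoff a b n x * deriv E x)
      ((contDiff_cutoff a b n).continuous.mul hE') hvi
    rw [integral_add j1 j2] at e
    simp_rw [mul_smul (cutoff a b n _)] at e
    rw [pow_one, neg_one_smul] at e
    rw [← e, add_sub_cancel_right]
  have lim : ∀ f : ℝ → ℂ, Integrable f (vol a b) →
      Tendsto (fun n : ℕ => ∫ x in Ioo a b, cutoff a b n x • f x) atTop
        (𝓝 (∫ x in Ioo a b, f x)) := fun f hf => by
    refine tendsto_integral_of_dominated_convergence (fun x => ‖f x‖) (fun n => ?_) hf.norm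
      (fun n => Eventually.of_forall fun x => ?_) ?_
    · exact (contDiff_cutoff a b n).continuous.aestronglyMeasurable.smul hf.aestronglyMeasurable
    · rw [norm_smul]
      exact mul_le_of_le_one_left (norm_nonneg _) (abs_cutoff_le n x)
    · filter_upwards [ae_restrict_mem measurableSet_Ioo] with x hx
      simpa using (tendsto_cutoff hx).smul_const (f x)
  have l1 := tendsto_integral_deriv_cutoff (v := fun x => u x - w a) (w := fun x => w x - w a) hab
    (hw.sub continuousOn_const) (sub_self _) (by rw [hwab, sub_self])
    (huw.mono fun x hx => by simp only [hx]) hE1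
  have l2 := ((lim _ (integrable_continuous_smul hE.continuous hgi)).neg).sub
    (lim _ (integrable_continuous_smul hE' hvi))
  have l3 := tendsto_nhds_unique (l1.congr' (by
    filter_upwards [eventually_gt_atTop 0] with n hn
    exact key n hn)) l2
  rw [hsub E hE hEab] at l3
  rw [← sub_eq_zero.1 l3.symm]

/-- The Fourier coefficients of the weak derivative of a periodic function. -/
lemma HasWeakDeriv.coef_eq {u g w : ℝ → ℂ} (h : HasWeakDeriv a b 1 u g) (hab : a < b)
    (hu : MemLp u 2 (vol a b)) (hg : MemLp g 2 (vol a b)) (hw : ContinuousOn w (Icc a b))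
    (hwab : w a = w b) (huw : u =ᵐ[vol a b] w) (l : ℤ) :
    coef a b (avgVol a b) g l = Complex.I * freq a b l * coef a b (avgVol a b) u l := by
  have hfl : freq a b l * (b - a) = l * (2 * Real.pi) := by
    unfold freq
    have := (sub_pos.2 hab).ne'
    field_simp
  -- Test functions are real valued, so the exponential is split into cosine and sine, each with
  -- equal end values.
  set C : ℝ → ℝ := fun x => Real.cos (freq a b l * (x - a)) with hC
  set S : ℝ → ℝ := fun x => Real.sin (freq a b l * (x - a)) with hS
  have hCd : ∀ x, deriv C x = -freq a b l * S x := fun x => by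
    have := (((hasDerivAt_id' x).sub_const a).const_mul (freq a b l)).cos
    rw [hC, this.deriv]
    simp [hS, mul_comm]
  have hSd : ∀ x, deriv S x = freq a b l * C x := fun x => by
    have := (((hasDerivAt_id' x).sub_const a).const_mul (freq a b l)).sin
    rw [hS, this.deriv]
    simp [hC, mul_comm]
  have hCc : ContDiff ℝ ∞ C := by unfold C; fun_prop
  have hSc : ContDiff ℝ ∞ S := by unfold S; fun_prop
  have i1 := h.integral_deriv_smul hab hu hg hw hwab huw hCc (fun x => Real.abs_cos_le_one _)
    (by simp [hC, hfl])
  have i2 := h.integral_deriv_smul hab hu hg hw hwab huw hSc (fun x => Real.abs_sin_le_one _)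
    (by
      simpa [hS, hfl] using (Real.sin_add_int_mul_two_pi 0 l).symm)
  simp_rw [hCd, mul_smul] at i1
  simp_rw [hSd, mul_smul] at i2
  rw [integral_smul] at i1 i2
  have hm : ∀ f : ℝ → ℂ, MemLp f 2 (vol a b) → coef a b (avgVol a b) f l =
      ((b - a : ℝ) : ℂ)⁻¹ * ((∫ x in Ioo a b, C x • f x) -
        Complex.I * ∫ x in Ioo a b, S x • f x) := fun f hf => by
    have hfi := hf.integrable (by norm_num)
    rw [coef, integral_avgVol hab, intervalIntegral.integral_of_le hab.le,
      integral_Ioc_eq_integral_Ioo]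
    congr 1
    rw [← integral_const_mul, ← integral_sub (integrable_continuous_smul hCc.continuous hfi)
        ((integrable_continuous_smul hSc.continuous hfi).const_mul _)]
    refine integral_congr_ae (Eventually.of_forall fun x => ?_)
    simp only [mode, freq_neg, hC, hS, Complex.real_smul]
    rw [mul_comm Complex.I, Complex.exp_mul_I, ← Complex.ofReal_cos, ← Complex.ofReal_sin,
      neg_mul, Real.cos_neg, Real.sin_neg]
    push_cast
    ring
  rw [hm u hu, hm g hg]
  simp only [Complex.real_smul] at i1 i2 ⊢
  push_cast at i1
  linear_combination ((b - a : ℝ) : ℂ)⁻¹ * i1 - ((b - a : ℝ) : ℂ)⁻¹ * Complex.I * i2 +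
    ((b - a : ℝ) : ℂ)⁻¹ * freq a b l * (∫ x in Ioo a b, ((S x : ℝ) : ℂ) * u x) * Complex.I_sq

end GPE

namespace GPE

variable {a b T β : ℝ} {m : ℕ}

/-! ## Fourier coefficients of Sobolev functions -/

lemma norm_eq_l2 (hab : a < b) (f : L2 a b) :
    ‖f‖ = Real.sqrt (b - a) * l2 (avgVol a b) f := by
  have hL : 0 < b - a := sub_pos.2 hab
  have h0 : ENNReal.ofReal (b - a) ≠ 0 := by simpa using hab
  rw [Lp.norm_def, l2, avgVol, eLpNorm_smul_measure_of_ne_top (by norm_num), smul_eq_mul,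
    ENNReal.toReal_mul, ← mul_assoc]
  convert (one_mul _).symm
  rw [← ENNReal.toReal_rpow, ENNReal.toReal_inv, ENNReal.toReal_ofReal hL.le, Real.sqrt_eq_rpow]
  norm_num
  rw [← Real.mul_rpow hL.le (inv_nonneg.2 hL.le), mul_inv_cancel₀ hL.ne', Real.one_rpow]

lemma l2_le_norm (hab : a < b) (f : L2 a b) :
    l2 (avgVol a b) f = (Real.sqrt (b - a))⁻¹ * ‖f‖ := by
  have := (Real.sqrt_pos.2 (sub_pos.2 hab)).ne'
  rw [norm_eq_l2 hab]
  field_simp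

lemma parseval_L2 (hab : a < b) (f : L2 a b) :
    HasSum (fun l => ‖coef a b (avgVol a b) f l‖ ^ 2) (((Real.sqrt (b - a))⁻¹ * ‖f‖) ^ 2) := by
  rw [← l2_le_norm hab]
  exact parseval hab (Lp.memLp f)

lemma norm_coef_le (hab : a < b) (f : L2 a b) (l : ℤ) :
    ‖coef a b (avgVol a b) f l‖ ≤ (Real.sqrt (b - a))⁻¹ * ‖f‖ := by
  have h := parseval_L2 hab f
  exact (norm_le_sn (Finset.mem_singleton_self l) _).trans
    (sn_le_of_tsum _ h.summable (by positivity) h.tsum_eq.le)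

lemma coef_L2_sub (hab : a < b) (f g : L2 a b) (l : ℤ) : coef a b (avgVol a b) ⇑(f - g) l =
    coef a b (avgVol a b) f l - coef a b (avgVol a b) g l := by
  have := avgVol_prob hab
  rw [← coef_sub (memLp_avgVol hab (Lp.memLp f)) (memLp_avgVol hab (Lp.memLp g))]
  exact coef_congr_ae (ae_avgVol_iff.2 (Lp.coeFn_sub f g)) l

/-- The Fourier coefficient as a continuous linear functional. -/
noncomputable def coefL (hab : a < b) (l : ℤ) : L2 a b →L[ℝ] ℂ :=
  LinearMap.mkContinuous
    { toFun := fun f => coef a b (avgVol a b) f l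
      map_add' := fun f g => by
        have := avgVol_prob hab
        rw [← coef_add (memLp_avgVol hab (Lp.memLp f)) (memLp_avgVol hab (Lp.memLp g))]
        exact coef_congr_ae (ae_avgVol_iff.2 (Lp.coeFn_add f g)) l
      map_smul' := fun r f => by
        rw [RingHom.id_apply, Complex.real_smul, ← coef_const_mul]
        refine coef_congr_ae (ae_avgVol_iff.2 ?_) l
        filter_upwards [Lp.coeFn_smul r f] with x hx
        rw [hx, Pi.smul_apply, Complex.real_smul] }
    (Real.sqrt (b - a))⁻¹ (norm_coef_le hab · l)

/-- Periodicity of each lower derivative permits one more integration by parts. The family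
witnessing periodicity may differ from that stored in `e`, but only on null sets. -/
lemma coef_component (hab : a < b) (e : H a b m) (he : MemHper a b m (toL2 e)) (k : Fin (m + 1))
    (l : ℤ) : coef a b (avgVol a b) (e.1 k) l =
      (Complex.I * freq a b l) ^ (k : ℕ) * coef a b (avgVol a b) (toL2 e) l := by
  obtain ⟨g, hg0, hg, hw⟩ := he
  have h1 : ∀ k ≤ m, coef a b (avgVol a b) (g k) l =
      (Complex.I * freq a b l) ^ k * coef a b (avgVol a b) (g 0) l := fun k => by
    induction k with
    | zero => simp
    | succ k ih =>
      intro hk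
      obtain ⟨w, hw1, hw2, hw3⟩ := hw k hk
      obtain ⟨h1, h2⟩ := hg k (Nat.le_of_succ_le hk)
      obtain ⟨h3, h4⟩ := hg (k + 1) hk
      rw [(h2.succ h4).coef_eq hab h1 h3 hw1 hw2 hw3 l, ih (Nat.le_of_succ_le hk)]
      ring
  have hk : (k : ℕ) ≤ m := Nat.lt_succ_iff.1 k.2
  have h2 : ⇑(e.1 k) =ᵐ[vol a b] g k := (e.2 k).ae_unique (hg k hk).2 (Lp.memLp _) (hg k hk).1
  rw [coef_congr_ae (ae_avgVol_iff.2 h2), h1 k hk, hg0]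

lemma norm_I_freq_pow_mul (k : ℕ) (l : ℤ) (z : ℂ) :
    ‖(Complex.I * freq a b l) ^ k * z‖ = ‖(freq a b l : ℂ) ^ k * z‖ := by
  rw [norm_mul, norm_mul, norm_pow, norm_pow, norm_mul, Complex.norm_I, one_mul]

lemma component_norm_le (e : H a b m) (k : Fin (m + 1)) : ‖e.1 k‖ ≤ ‖e‖ :=
  PiLp.norm_apply_le e.1 k

lemma hasSum_freq_pow (hab : a < b) (e : H a b m) (he : MemHper a b m (toL2 e))
    (k : Fin (m + 1)) :
    HasSum (fun l => ‖(freq a b l : ℂ) ^ (k : ℕ) * coef a b (avgVol a b) (toL2 e) l‖ ^ 2)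
      (((Real.sqrt (b - a))⁻¹ * ‖e.1 k‖) ^ 2) := by
  have h := parseval_L2 hab (e.1 k)
  simp_rw [coef_component hab e he, norm_I_freq_pow_mul] at h
  exact h

lemma tsum_freq_pow_le (hab : a < b) (e : H a b m) (he : MemHper a b m (toL2 e))
    (k : Fin (m + 1)) {R : ℝ} (hR : (Real.sqrt (b - a))⁻¹ * ‖e‖ ≤ R) :
    ∑' l, ‖(freq a b l : ℂ) ^ (k : ℕ) * coef a b (avgVol a b) (toL2 e) l‖ ^ 2 ≤ R ^ 2 := by
  rw [(hasSum_freq_pow hab e he k).tsum_eq]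
  refine pow_le_pow_left₀ (by positivity) (le_trans ?_ hR) 2
  have := component_norm_le e k
  gcongr

lemma MemHper.mono {E : Type} [NormedAddCommGroup E] [NormedSpace ℝ E] {u : ℝ → E} {n : ℕ}
    (h : MemHper a b m u) (hn : n ≤ m) : MemHper a b n u := by
  obtain ⟨g, h0, h1, h2⟩ := h
  exact ⟨g, h0, fun k hk => h1 k (hk.trans hn), fun k hk => h2 k (hk.trans_le hn)⟩

/-! ## Curves -/

lemma exists_lipschitz {F : Type*} [NormedAddCommGroup F] [NormedSpace ℝ F] {f : ℝ → F}
    (hT : 0 < T) (hf : ContDiffOn ℝ 1 f (Icc 0 T)) :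
    ∃ K : ℝ, 0 ≤ K ∧ ∀ s ∈ Icc 0 T, ∀ t ∈ Icc 0 T, ‖f t - f s‖ ≤ K * |t - s| := by
  have hc := hf.continuousOn_derivWithin (uniqueDiffOn_Icc hT) le_rfl
  obtain ⟨K, hK⟩ := isCompact_Icc.exists_bound_of_continuousOn hc
  refine ⟨K, (norm_nonneg _).trans (hK 0 ⟨le_rfl, hT.le⟩), fun s hs t ht => ?_⟩
  exact (convex_Icc 0 T).norm_image_sub_le_of_norm_derivWithin_le
    (hf.differentiableOn one_ne_zero) hK hs ht

/-- The Fourier coefficients of a curve in `L²`. -/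
noncomputable def curveCoef (a b : ℝ) (ψ : ℝ → L2 a b) (t : ℝ) (l : ℤ) : ℂ :=
  coef a b (avgVol a b) (ψ t) l

lemma exists_tsum_le (hab : a < b) {ψ : ℝ → L2 a b} (h : ContHper a b T m ψ) :
    ∃ R : ℝ, 0 ≤ R ∧ ∀ k ≤ m, ∀ t ∈ Icc 0 T,
      (Summable fun l => ‖(freq a b l : ℂ) ^ k * curveCoef a b ψ t l‖ ^ 2) ∧
      ∑' l, ‖(freq a b l : ℂ) ^ k * curveCoef a b ψ t l‖ ^ 2 ≤ R ^ 2 := by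
  obtain ⟨u, hu, hψ⟩ := h
  obtain ⟨R, hR⟩ := isCompact_Icc.exists_bound_of_continuousOn hu
  have hs : 0 ≤ (Real.sqrt (b - a))⁻¹ := by positivity
  refine ⟨(Real.sqrt (b - a))⁻¹ * |R|, by positivity, fun k hk t ht => ?_⟩
  obtain ⟨h1, h2⟩ := hψ t ht
  rw [← h1] at h2
  have e : ∀ l, curveCoef a b ψ t l = coef a b (avgVol a b) (toL2 (u t)) l := fun l => by
    rw [h1, curveCoef]
  simp_rw [e]
  have hk' : k < m + 1 := Nat.lt_succ_of_le hk
  exact ⟨(hasSum_freq_pow hab (u t) h2 ⟨k, hk'⟩).summable,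
    tsum_freq_pow_le hab (u t) h2 ⟨k, hk'⟩
      (mul_le_mul_of_nonneg_left ((hR t ht).trans (le_abs_self R)) hs)⟩

lemma summable_curveCoef (hab : a < b) {ψ : ℝ → L2 a b} (h : ContHper a b T 2 ψ) {t : ℝ}
    (ht : t ∈ Icc 0 T) : Summable fun l => ‖curveCoef a b ψ t l‖ := by
  obtain ⟨R, -, hR⟩ := exists_tsum_le hab h
  refine summable_norm_of_freq hab ?_
  simpa using (hR 1 (by norm_num) t ht).1

lemma ae_eq_syn_curveCoef (hab : a < b) {ψ : ℝ → L2 a b} (h : ContHper a b T 2 ψ) {t : ℝ}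
    (ht : t ∈ Icc 0 T) : ψ t =ᵐ[vol a b] syn a b (curveCoef a b ψ t) :=
  ae_eq_syn hab (Lp.memLp (ψ t)) (summable_curveCoef hab h ht)

lemma l2_syn_curveCoef_sub (hab : a < b) {ψ : ℝ → L2 a b} (h : ContHper a b T 2 ψ) {s t : ℝ}
    (hs : s ∈ Icc 0 T) (ht : t ∈ Icc 0 T) :
    l2 (avgVol a b) (fun x => syn a b (curveCoef a b ψ t) x - syn a b (curveCoef a b ψ s) x) =
      (Real.sqrt (b - a))⁻¹ * ‖ψ t - ψ s‖ := by
  rw [← l2_le_norm hab, l2, l2]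
  congr 1
  refine eLpNorm_congr_ae (ae_avgVol_iff.2 ?_)
  filter_upwards [ae_eq_syn_curveCoef hab h hs, ae_eq_syn_curveCoef hab h ht,
    Lp.coeFn_sub (ψ t) (ψ s)] with x h1 h2 h3
  rw [h3, Pi.sub_apply, h1, h2]

lemma exists_fourierCurve (hab : a < b) (hT : 0 < T) {V : ℝ → ℝ} (hV : MemLp V ⊤ (vol a b))
    {ψ : ℝ → L2 a b} (hH2 : ContHper a b T 2 ψ) (hC1 : ContDiffOn ℝ 1 ψ (Icc 0 T)) :
    ∃ M B K : ℝ, FourierCurve a b T M B K V (curveCoef a b ψ) := by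
  obtain ⟨R, hR0, hR⟩ := exists_tsum_le hab hH2
  obtain ⟨K, hK0, hK⟩ := exists_lipschitz hT hC1
  have hσ := sobConst_nonneg a b
  -- One constant for both requirements on `M`: the `ℓ¹` bound from the Sobolev inequality, and `R`
  -- for the second derivative.
  refine ⟨R + sobConst a b * R, (eLpNorm V ⊤ (vol a b)).toReal, (Real.sqrt (b - a))⁻¹ * K,
    by positivity, ENNReal.toReal_nonneg, by positivity, hV.aestronglyMeasurable, ?_,
    fun t ht => summable_curveCoef hab hH2 ht, fun t ht => ?_,
    fun t ht => (hR 2 le_rfl t ht).1, fun t ht => ?_, fun s hs t ht => ?_⟩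
  · have hfin : eLpNorm V ⊤ (vol a b) ≠ ⊤ := hV.eLpNorm_ne_top
    filter_upwards [ae_le_eLpNormEssSup (f := V) (μ := vol a b)] with x hx
    rw [← eLpNorm_exponent_top] at hx
    have := ENNReal.toReal_mono hfin hx
    simpa using this
  · obtain ⟨h1, h2⟩ := hR 1 (by norm_num) t ht
    obtain ⟨h3, h4⟩ := hR 0 (by norm_num) t ht
    simp only [pow_one, pow_zero, one_mul] at h1 h2 h3 h4
    refine (tsum_norm_le_sob hab hR0 h1 h2).trans (add_le_add ?_ le_rfl)
    exact (norm_le_sn (Finset.mem_singleton_self 0) _).trans (sn_le_of_tsum _ h3 hR0 h4)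
  · exact (hR 2 le_rfl t ht).2.trans
      (pow_le_pow_left₀ hR0 (le_add_of_nonneg_right (by positivity)) 2)
  · rw [l2_syn_curveCoef_sub hab hH2 hs ht, mul_assoc]
    exact mul_le_mul_of_nonneg_left (hK s hs t ht) (by positivity)

/-- Two continuous functions equal almost everywhere agree on all of `[a, b]`; hence the nodal
values of `ψ₀` are those of the Fourier series. -/
lemma eq_syn_of_init (hab : a < b) (hT : 0 < T) {ψ : ℝ → L2 a b} {ψ₀ : ℝ → ℂ}
    (hH2 : ContHper a b T 2 ψ) (hψ₀ : ContinuousOn ψ₀ (Icc a b)) (hinit : ψ 0 =ᵐ[vol a b] ψ₀) :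
    ∀ x ∈ Icc a b, ψ₀ x = syn a b (curveCoef a b ψ 0) x := by
  have h0 : (0 : ℝ) ∈ Icc 0 T := ⟨le_rfl, hT.le⟩
  have h : ψ₀ =ᵐ[volume.restrict (Icc a b)] syn a b (curveCoef a b ψ 0) := by
    rw [← restrict_Ioo_eq_restrict_Icc]
    exact hinit.symm.trans (ae_eq_syn_curveCoef hab hH2 h0)
  exact Measure.eqOn_Icc_of_ae_eq volume hab.ne h hψ₀
    (continuous_syn (summable_curveCoef hab hH2 h0)).continuousOn

lemma FourierCurve.continuousOn_forceCoef {M B K : ℝ} {V : ℝ → ℝ} {c : ℝ → ℤ → ℂ}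
    (hc : FourierCurve a b T M B K V c) (hab : a < b) (l : ℤ) :
    ContinuousOn (fun t => forceCoef a b β V (c t) l) (Icc 0 T) := by
  -- Any single frequency is a mode for a large enough even parameter, so the Lipschitz bound over
  -- modes applies to it.
  have hl : l ∈ modes (2 * (l.natAbs + 1)) := by
    unfold modes
    rw [Finset.mem_Ico]
    omega
  have hK : 0 ≤ (B + 3 * |β| * M ^ 2) * K := by
    have := hc.B_nonneg; have := hc.K_nonneg; positivity
  refine (LipschitzOnWith.of_dist_le_mul (K := ⟨_, hK⟩) fun t ht s hs => ?_).continuousOn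
  rw [dist_eq_norm, Real.dist_eq]
  exact (norm_le_sn hl fun l => forceCoef a b β V (c t) l - forceCoef a b β V (c s) l).trans
    (hc.sn_force_sub_le hab hs ht)

/-- The coefficient functional is continuous on `L²`, so it commutes with the time derivative, while
periodicity turns `∂ₓₓ` into `-μ²`. -/
lemma exists_fourierFlow (hab : a < b) (hT : 0 < T) {V : ℝ → ℝ} (hV : MemLp V ⊤ (vol a b))
    {ψ : ℝ → L2 a b} (hsol : SolvesGPE a b T β V ψ) (hH2 : ContHper a b T 2 ψ)
    (hC1 : ContDiffOn ℝ 1 ψ (Icc 0 T)) :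
    ∃ M B K : ℝ, FourierFlow a b T β M B K V (curveCoef a b ψ) := by
  obtain ⟨M, B, K, hc⟩ := exists_fourierCurve hab hT hV hH2 hC1
  have hp := avgVol_prob hab
  refine ⟨M, B, K, hc, fun t ht l => ?_⟩
  have hd : ∀ t ∈ Icc 0 T, HasDerivWithinAt (fun s => curveCoef a b ψ s l)
      (coefL hab l (derivWithin ψ (Icc 0 T) t)) (Icc 0 T) t := fun t ht =>
    (coefL hab l).hasFDerivAt.comp_hasDerivWithinAt t
      (hC1.differentiableOn one_ne_zero t ht).hasDerivWithinAt
  have heq : EqOn (fun t => coefL hab l (derivWithin ψ (Icc 0 T) t))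
      (fun t => -Complex.I * (((freq a b l ^ 2 : ℝ) : ℂ) * curveCoef a b ψ t l +
        forceCoef a b β V (curveCoef a b ψ t) l)) (Ioc 0 T) := fun t ht => by
    have ht' := Ioc_subset_Icc_self ht
    obtain ⟨w, hw, hae⟩ := hsol t ht
    have hsyn := ae_eq_syn_curveCoef hab hH2 ht'
    obtain ⟨u, -, hu⟩ := hH2
    obtain ⟨h1, h2⟩ := hu t ht'
    have hwu : w =ᵐ[vol a b] (u t).1 2 := by
      have h3 := (u t).2 2
      change HasWeakDeriv a b 2 (toL2 (u t)) ((u t).1 2) at h3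
      rw [h1] at h3
      exact hw.ae_unique h3 (Lp.memLp w) (Lp.memLp _)
    have hwc : coef a b (avgVol a b) w l = -((freq a b l ^ 2 : ℝ) : ℂ) * curveCoef a b ψ t l := by
      rw [coef_congr_ae (ae_avgVol_iff.2 hwu), coef_component hab (u t) (by rwa [h1]) 2, h1,
        curveCoef]
      have : ((2 : Fin 3) : ℕ) = 2 := rfl
      rw [this, mul_pow, Complex.I_sq]
      push_cast
      ring
    have hs := hc.summable t ht'
    have hae' : (fun x => Complex.I * (derivWithin ψ (Icc 0 T) t : L2 a b) x) =ᵐ[avgVol a b]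
        fun x => ((V x : ℂ) * syn a b (curveCoef a b ψ t) x +
          β * cub (syn a b (curveCoef a b ψ t) x)) - w x := by
      refine ae_avgVol_iff.2 ?_
      filter_upwards [hae, hsyn] with x hx hx'
      rw [hx, hx', cub]
      ring
    have h4 := coef_congr_ae (a := a) (b := b) hae' l
    have m1 : MemLp (fun x => (V x : ℂ) * syn a b (curveCoef a b ψ t) x +
        β * cub (syn a b (curveCoef a b ψ t) x)) 2 (avgVol a b) :=
      (memLp_potential_mul hc.meas hc.bound (memLp_syn hs)).add
        ((memLp_cub (continuous_syn hs) (norm_syn_le hs)).const_mul (β : ℂ))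
    rw [coef_const_mul, coef_sub m1 (memLp_avgVol hab (Lp.memLp w)), hwc] at h4
    change coef a b (avgVol a b) _ l = _
    change _ = forceCoef a b β V (curveCoef a b ψ t) l - _ at h4
    linear_combination (-Complex.I) * h4 + coef a b (avgVol a b)
      (derivWithin ψ (Icc 0 T) t : L2 a b) l * Complex.I_sq
  have hcont : ContinuousOn (fun t => curveCoef a b ψ t l) (Icc 0 T) := fun t ht =>
    (hd t ht).continuousWithinAt
  -- The equation is given only for `t > 0`; both sides are continuous on `[0, T]`, so it extends to
  -- `t = 0`.
  have heq' := heq.of_subset_closure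
    ((coefL hab l).continuous.comp_continuousOn
      (hC1.continuousOn_derivWithin (uniqueDiffOn_Icc hT) le_rfl))
    (continuousOn_const.mul ((continuousOn_const.mul hcont).add
      (hc.continuousOn_forceCoef hab l))) Ioc_subset_Icc_self (closure_Ioc hT.ne).ge
  exact (hd t ht).congr_deriv (heq' ht)

lemma exists_smoothFlow (hab : a < b) (hT : 0 < T) {ψ : ℝ → L2 a b}
    (hH3 : ContHper a b T 3 ψ) (hC1 : ContDiffH a b T 1 ψ) :
    ∃ M₁ K₁ : ℝ, SmoothFlow a b T M₁ K₁ (curveCoef a b ψ) := by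
  obtain ⟨R, hR0, hR⟩ := exists_tsum_le hab hH3
  obtain ⟨v, hv, hψ⟩ := hC1
  obtain ⟨K, hK0, hK⟩ := exists_lipschitz hT hv
  have hs : ∀ s ∈ Icc 0 T, ∀ t ∈ Icc 0 T, HasSum (fun l => ‖(freq a b l : ℂ) *
      (curveCoef a b ψ t l - curveCoef a b ψ s l)‖ ^ 2)
      (((Real.sqrt (b - a))⁻¹ * ‖(v t - v s).1 1‖) ^ 2) := fun s hs t ht => by
    have hc : ∀ t ∈ Icc 0 T, ∀ l, coef a b (avgVol a b) ((v t).1 1) l =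
        (Complex.I * freq a b l) * curveCoef a b ψ t l := fun t ht l => by
      obtain ⟨u, -, hu⟩ := hH3
      have h := coef_component hab (v t) (by
        rw [hψ t ht]; exact (hu t ht).2.mono (by norm_num)) 1 l
      rw [hψ t ht] at h
      simpa [curveCoef] using h
    have h := parseval_L2 hab ((v t - v s).1 1)
    have e : ∀ l, ‖coef a b (avgVol a b) ((v t - v s).1 1) l‖ =
        ‖(freq a b l : ℂ) * (curveCoef a b ψ t l - curveCoef a b ψ s l)‖ := fun l => by
      have e1 : (v t - v s).1 1 = (v t).1 1 - (v s).1 1 := rfl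
      rw [e1, coef_L2_sub hab, hc t ht, hc s hs, ← mul_sub, norm_mul, norm_mul, norm_mul,
        Complex.norm_I, one_mul]
    simp_rw [e] at h
    exact h
  refine ⟨R, (Real.sqrt (b - a))⁻¹ * K, hR0, by positivity,
    fun t ht => by simpa using (hR 1 (by norm_num) t ht).1,
    fun t ht => by simpa using (hR 1 (by norm_num) t ht).2,
    fun t ht => (hR 3 le_rfl t ht).1, fun t ht => (hR 3 le_rfl t ht).2,
    fun s hsT t ht => (hs s hsT t ht).summable, fun s hsT t ht => ?_⟩
  rw [(hs s hsT t ht).tsum_eq, mul_assoc]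
  refine pow_le_pow_left₀ (by positivity) (mul_le_mul_of_nonneg_left ?_ (by positivity)) 2
  exact (component_norm_le _ _).trans (hK s hsT t ht)

/-- The Fourier series of `V` converges absolutely by the Sobolev inequality; its real part is the
continuous periodic representative. -/
lemma exists_smoothPotential (hab : a < b) {V : ℝ → ℝ} (hV : MemHper a b 1 V) :
    ∃ (B KV : ℝ) (W : ℝ → ℝ), SmoothPotential a b B KV V W := by
  have hp := avgVol_prob hab
  obtain ⟨g, h0, h1, h2⟩ := hV
  obtain ⟨w, hw1, hw2, hw3⟩ := h2 0 one_pos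
  obtain ⟨hL0, hD0⟩ := h1 0 zero_le_one
  obtain ⟨hL1, hD1⟩ := h1 1 le_rfl
  rw [h0] at hw3 hL0
  set v := coef a b (avgVol a b) (fun x => (V x : ℂ)) with hv
  have hVc : MemLp (fun x => (V x : ℂ)) 2 (vol a b) := hL0.ofReal
  have hgc : MemLp (fun x => (g 1 x : ℂ)) 2 (vol a b) := hL1.ofReal
  have hcoef : ∀ l, coef a b (avgVol a b) (fun x => (g 1 x : ℂ)) l =
      Complex.I * freq a b l * v l := hD1.ofReal.coef_eq hab hVc hgc
    (Complex.continuous_ofReal.comp_continuousOn hw1) (by simp [hw2])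
    (hw3.mono fun x hx => by simp [hx])
  have hs := parseval hab hgc
  have e : ∀ l, ‖coef a b (avgVol a b) (fun x => (g 1 x : ℂ)) l‖ = ‖(freq a b l : ℂ) * v l‖ :=
    fun l => by rw [hcoef, mul_assoc, norm_mul, Complex.norm_I, one_mul]
  simp_rw [e] at hs
  have hsum := summable_norm_of_freq hab hs.summable
  have hcs := continuous_syn (a := a) (b := b) hsum
  have hps := periodic_syn (a := a) (b := b) hab v
  refine ⟨∑' l, ‖v l‖, l2 (avgVol a b) (fun x => (g 1 x : ℂ)), fun x => (syn a b v x).re,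
    Complex.continuous_re.comp hcs, hps.comp Complex.re, ?_,
    fun x => (Complex.abs_re_le_norm _).trans (norm_syn_le hsum x), l2_nonneg _ _,
    fun h hh => ?_⟩
  · filter_upwards [ae_eq_syn hab hVc hsum] with x hx
    rw [← hx, Complex.ofReal_re]
  · have h3 := l2_incr_syn_le hab hsum hh (l2_nonneg _ _) hs.summable hs.tsum_eq.le
    refine le_trans ?_ h3
    have := l2_mono (ν := avgVol a b) (g := incr h fun x => (((syn a b v x).re : ℝ) : ℂ))
      zero_le_one (memLp_incr (h := h) hab hcs hps) (Eventually.of_forall fun x => ?_)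
    · simpa using this
    · unfold incr
      rw [one_mul, ← Complex.ofReal_sub, ← Complex.sub_re, Complex.norm_real]
      exact Complex.abs_re_le_norm _

end GPE

namespace GPE

variable {a b T β τ : ℝ} {N n : ℕ} {V : ℝ → ℝ} {ψ : ℝ → L2 a b} {ψ₀ : ℝ → ℂ}

/-! ## Sobolev norms of the error -/

/-- By Parseval the squared error is the coefficient error on `S` plus the tail off `S`, and `A² +
(κR)² ≤ (A + κR)²`. -/
lemma l2_sub_trig_le (hab : a < b) {g : ℝ → ℂ} (hg : MemLp g 2 (vol a b)) (S : Finset ℤ)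
    {D r : ℤ → ℂ} {A κ R : ℝ} (hκ : 0 ≤ κ) (hR : 0 ≤ R)
    (hA : sn S (fun l => coef a b (avgVol a b) g l - D l) ≤ A)
    (hr : ∀ l ∉ S, ‖coef a b (avgVol a b) g l‖ ≤ κ * ‖r l‖)
    (hs : Summable fun l => ‖r l‖ ^ 2) (hsR : ∑' l, ‖r l‖ ^ 2 ≤ R ^ 2) :
    l2 (avgVol a b) (fun x => g x - trig a b S D x) ≤ A + κ * R := by
  have hp := avgVol_prob hab
  have hA0 : 0 ≤ A := (sn_nonneg _ _).trans hA
  have h := parseval hab (hg.sub (memLp_trig (a := a) (b := b) S D))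
  have hc : ∀ l, coef a b (avgVol a b) (fun x => g x - trig a b S D x) l =
      coef a b (avgVol a b) g l - if l ∈ S then D l else 0 := fun l => by
    rw [coef_sub (memLp_avgVol hab hg) (memLp_trig S D), funext (trig_eq_syn S D),
      coef_syn hab (summable_ite_mem S D)]
  change HasSum (fun l => ‖coef a b (avgVol a b) (fun x => g x - trig a b S D x) l‖ ^ 2)
    (l2 (avgVol a b) (fun x => g x - trig a b S D x) ^ 2) at h
  simp_rw [hc] at h
  have h1 : HasSum (fun l => if l ∈ S then ‖coef a b (avgVol a b) g l - D l‖ ^ 2 else 0)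
      (∑ l ∈ S, ‖coef a b (avgVol a b) g l - D l‖ ^ 2) := by
    rw [← Finset.sum_congr rfl fun l hl => if_pos hl]
    exact hasSum_sum_of_ne_finset_zero fun l hl => if_neg hl
  have h2 := hasSum_le (fun l => ?_) h (h1.add (hs.hasSum.mul_left (κ ^ 2)))
  · rw [← sn_sq] at h2
    have h3 := pow_le_pow_left₀ (sn_nonneg _ _) hA 2
    have h4 := mul_le_mul_of_nonneg_left hsR (sq_nonneg κ)
    refine (abs_le_of_sq_le_sq' ?_ (by positivity)).2
    nlinarith [mul_nonneg hA0 (mul_nonneg hκ hR)]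
  · by_cases hl : l ∈ S
    · simp only [hl, if_true]
      exact le_add_of_nonneg_right (by positivity)
    · simp only [hl, if_false, sub_zero, zero_add]
      rw [← mul_pow]
      exact pow_le_pow_left₀ (norm_nonneg _) (hr l hl) 2

lemma hasWeakDeriv_zero (u : ℝ → ℂ) : HasWeakDeriv a b 0 u u := fun φ _ _ _ => by
  simp

lemma hasWeakDeriv_of_hasDerivAt (hab : a < b) {p p' : ℝ → ℂ} (hp : ∀ x, HasDerivAt p (p' x) x)
    (hp' : Continuous p') : HasWeakDeriv a b 1 p p' := fun φ h1 h2 h3 => by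
  have hpc : Continuous p := continuous_iff_continuousAt.2 fun x => (hp x).continuousAt
  have hz : ∀ x ∉ Ioo a b, φ x = 0 := fun x hx =>
    image_eq_zero_of_notMem_tsupport fun h => hx (h3 h)
  have hφ' := h1.continuous_deriv (by norm_num)
  have hd : ∀ x, HasDerivAt (fun x => φ x • p x) (φ x • p' x + deriv φ x • p x) x := fun x =>
    ((h1.differentiable (by norm_num) x).hasDerivAt).smul (hp x)
  have hI := intervalIntegral.integral_eq_sub_of_hasDerivAt (a := a) (b := b)
    (fun x _ => hd x) (((h1.continuous.smul hp').add (hφ'.smul hpc)).intervalIntegrable _ _)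
  have i1 : IntervalIntegrable (fun x => φ x • p' x) volume a b :=
    (h1.continuous.smul hp').intervalIntegrable _ _
  have i2 : IntervalIntegrable (fun x => deriv φ x • p x) volume a b :=
    (hφ'.smul hpc).intervalIntegrable _ _
  rw [hz a (by simp), hz b (by simp), zero_smul, zero_smul, sub_zero,
    intervalIntegral.integral_add i1 i2, intervalIntegral.integral_of_le hab.le,
    intervalIntegral.integral_of_le hab.le, integral_Ioc_eq_integral_Ioo,
    integral_Ioc_eq_integral_Ioo] at hI
  rw [iteratedDeriv_one, pow_one, neg_one_smul]
  exact eq_neg_of_add_eq_zero_right hI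

lemma hasDerivAt_trig (S : Finset ℤ) (d : ℤ → ℂ) (x : ℝ) : HasDerivAt (trig a b S d)
    (trig a b S (fun l => Complex.I * freq a b l * d l) x) x := by
  have h := HasDerivAt.fun_sum (u := S) (x := x) fun l _ => (hasDerivAt_mode a b l x).const_mul (d l)
  refine h.congr_deriv (Finset.sum_congr rfl fun l _ => ?_)
  ring

/-- An `H¹` function from its weak derivative. -/
noncomputable def mkH1 (f f' : L2 a b) (h : HasWeakDeriv a b 1 f f') : H a b 1 :=
  ⟨WithLp.toLp 2 ![f, f'], by
    change ∀ k : Fin 2, HasWeakDeriv a b k _ _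
    rw [Fin.forall_fin_two]
    exact ⟨hasWeakDeriv_zero _, h⟩⟩

lemma norm_H1_le (e : H a b 1) : ‖e‖ ≤ ‖e.1 0‖ + ‖e.1 1‖ := by
  have : ‖e‖ = Real.sqrt (‖e.1 0‖ ^ 2 + ‖e.1 1‖ ^ 2) := by
    change ‖e.1‖ = _
    rw [PiLp.norm_eq_of_L2]
    exact congrArg Real.sqrt (Fin.sum_univ_two fun k : Fin 2 => ‖e.1 k‖ ^ 2)
  rw [this]
  refine Real.sqrt_le_iff.2 ⟨by positivity, ?_⟩
  nlinarith [norm_nonneg (e.1 0), norm_nonneg (e.1 1)]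

lemma norm_L2_sub_trig_le (hab : a < b) (f : L2 a b) {S : Finset ℤ} {D r : ℤ → ℂ} {A κ R : ℝ}
    (hκ : 0 ≤ κ) (hR : 0 ≤ R) (hA : sn S (fun l => coef a b (avgVol a b) f l - D l) ≤ A)
    (hr : ∀ l ∉ S, ‖coef a b (avgVol a b) f l‖ ≤ κ * ‖r l‖)
    (hs : Summable fun l => ‖r l‖ ^ 2) (hsR : ∑' l, ‖r l‖ ^ 2 ≤ R ^ 2) :
    ‖f - (memLp_trig (a := a) (b := b) (ν := vol a b) S D).toLp‖ ≤
      Real.sqrt (b - a) * (A + κ * R) := by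
  rw [norm_eq_l2 hab]
  refine mul_le_mul_of_nonneg_left (le_trans (le_of_eq ?_)
    (l2_sub_trig_le hab (Lp.memLp f) S hκ hR hA hr hs hsR)) (Real.sqrt_nonneg _)
  rw [l2, l2]
  congr 1
  refine eLpNorm_congr_ae (ae_avgVol_iff.2 ?_)
  filter_upwards [Lp.coeFn_sub f (memLp_trig (a := a) (b := b) (ν := vol a b) S D).toLp,
    (memLp_trig (a := a) (b := b) (ν := vol a b) S D).coeFn_toLp] with x h1 h2
  rw [h1, Pi.sub_apply, h2]

lemma interpL2_numSol : interpL2 a b N (numSol a b β V ψ₀ τ N n) =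
    (memLp_trig (a := a) (b := b) (ν := vol a b) (modes N) (numCoef a b β V ψ₀ τ N n)).toLp := rfl

lemma norm_err_le (hab : a < b) (hN : 0 < N) (hNe : Even N) {A R : ℝ} (hR : 0 ≤ R)
    (hA : sn (modes N) (fun l => curveCoef a b ψ (n * τ) l - numCoef a b β V ψ₀ τ N n l) ≤ A)
    (hs : Summable fun l => ‖(freq a b l : ℂ) ^ 2 * curveCoef a b ψ (n * τ) l‖ ^ 2)
    (hsR : ∑' l, ‖(freq a b l : ℂ) ^ 2 * curveCoef a b ψ (n * τ) l‖ ^ 2 ≤ R ^ 2) :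
    ‖err a b β V ψ ψ₀ τ N n‖ ≤ Real.sqrt (b - a) * (A + mesh a b N ^ 2 * R) := by
  rw [err, interpL2_numSol]
  refine norm_L2_sub_trig_le hab _ (sq_nonneg _) hR hA (fun l hl => ?_) hs hsR
  have := norm_tail_le (c := curveCoef a b ψ (n * τ)) (mesh_pos hab hN)
    (fun l hl => le_abs_freq_of_not_mem_modes hab hN hNe hl) 2 l
  rwa [if_neg hl] at this

/-- The exponent `p` counts the derivatives available beyond the first: `p = 1` for `H²` solutions
and `p = 2` for `H³` solutions, the tail being `O(h^p)`. -/
lemma hNormLE_err (hab : a < b) (hN : 0 < N) (hNe : Even N) (hH2 : ContHper a b T 2 ψ)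
    (ht : n * τ ∈ Icc 0 T) {E A R : ℝ} (p : ℕ) (hR : 0 ≤ R)
    (hE : ‖err a b β V ψ ψ₀ τ N n‖ ≤ E)
    (hA : sn (modes N) (fun l => (freq a b l : ℂ) *
      (curveCoef a b ψ (n * τ) l - numCoef a b β V ψ₀ τ N n l)) ≤ A)
    (hs : Summable fun l => ‖(freq a b l : ℂ) ^ (p + 1) * curveCoef a b ψ (n * τ) l‖ ^ 2)
    (hsR : ∑' l, ‖(freq a b l : ℂ) ^ (p + 1) * curveCoef a b ψ (n * τ) l‖ ^ 2 ≤ R ^ 2) :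
    HNormLE a b 1 (err a b β V ψ ψ₀ τ N n)
      (E + Real.sqrt (b - a) * (A + mesh a b N ^ p * R)) := by
  obtain ⟨u, -, hu⟩ := hH2
  obtain ⟨h1, h2⟩ := hu _ ht
  set S := modes N with hS
  set d := numCoef a b β V ψ₀ τ N n with hd
  set D : ℤ → ℂ := fun l => Complex.I * freq a b l * d l with hD
  have hw : HasWeakDeriv a b 1 (ψ (n * τ)) ((u (n * τ)).1 1) := by
    have h3 := (u (n * τ)).2 1
    change HasWeakDeriv a b 1 (toL2 (u (n * τ))) _ at h3
    rwa [h1] at h3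
  have hwi : HasWeakDeriv a b 1
      (memLp_trig (a := a) (b := b) (ν := vol a b) S d).toLp
      (memLp_trig (a := a) (b := b) (ν := vol a b) S D).toLp :=
    (hasWeakDeriv_of_hasDerivAt hab (hasDerivAt_trig S d) (continuous_trig a b S _)).congr
      (MemLp.coeFn_toLp _).symm (MemLp.coeFn_toLp _).symm
  have hc : ∀ l, coef a b (avgVol a b) ((u (n * τ)).1 1) l =
      Complex.I * freq a b l * curveCoef a b ψ (n * τ) l := fun l => by
    have := coef_component hab (u (n * τ)) (by rwa [h1]) 1 l
    rw [h1] at this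
    simpa [curveCoef] using this
  refine ⟨mkH1 _ _ hw - mkH1 _ _ hwi, ?_, (norm_H1_le _).trans (add_le_add hE ?_)⟩
  · rfl
  · refine norm_L2_sub_trig_le hab ((u (n * τ)).1 1) (r := fun l => (freq a b l : ℂ) ^ (p + 1) *
      curveCoef a b ψ (n * τ) l) (pow_nonneg (mesh_pos hab hN).le p) hR ?_ (fun l hl => ?_) hs hsR
    · refine (sn_congr_norm fun l _ => ?_).trans_le hA
      rw [hc, hD, ← mul_sub, mul_assoc, norm_mul, Complex.norm_I, one_mul]
    · have := norm_tail_le (c := fun l => (freq a b l : ℂ) * curveCoef a b ψ (n * τ) l)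
        (mesh_pos hab hN) (fun l hl => le_abs_freq_of_not_mem_modes hab hN hNe hl) p l
      rw [if_neg hl, ← mul_assoc, ← pow_succ] at this
      rwa [hc, mul_assoc, norm_mul, Complex.norm_I, one_mul]

lemma HNormLE.mono {m : ℕ} {f : L2 a b} {r s : ℝ} (h : HNormLE a b m f r) (hrs : r ≤ s) :
    HNormLE a b m f s :=
  let ⟨e, h1, h2⟩ := h
  ⟨e, h1, h2.trans hrs⟩

lemma div_mesh_le_sqrt (hab : a < b) (hN : 0 < N) (hτ : 0 ≤ τ) (hτh : τ ≤ mesh a b N ^ 2) :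
    τ / mesh a b N ≤ Real.sqrt τ := by
  have hh := mesh_pos hab hN
  rw [div_le_iff₀ hh]
  calc τ = Real.sqrt τ * Real.sqrt τ := (Real.mul_self_sqrt hτ).symm
    _ ≤ _ := mul_le_mul_of_nonneg_left (Real.sqrt_le_iff.2 ⟨hh.le, hτh⟩) (Real.sqrt_nonneg _)

end GPE

/-! ### The convergence theorem, from coefficient errors on the modes and tails off them. -/

theorem theorem3p1 (a b T β : ℝ) (hab : a < b) (hT : 0 < T) (V : ℝ → ℝ)
    (hV : MemLp V ⊤ (GPE.vol a b))
    (ψ : ℝ → GPE.L2 a b) (ψ₀ : ℝ → ℂ)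
    (hψ₀ : ContinuousOn ψ₀ (Icc a b)) (hinit : ψ 0 =ᵐ[GPE.vol a b] ψ₀)
    (hsol : GPE.SolvesGPE a b T β V ψ)
    (hH2 : GPE.ContHper a b T 2 ψ) (hC1 : ContDiffOn ℝ 1 ψ (Icc 0 T)) :
    ∃ h₀ : ℝ, 0 < h₀ ∧
      (∃ C : ℝ, 0 < C ∧ ∀ (N : ℕ) (τ : ℝ), 0 < N → Even N → GPE.mesh a b N < h₀ →
        0 < τ → τ ≤ GPE.mesh a b N ^ 2 / Real.pi → ∀ n : ℕ, (n : ℝ) ≤ T / τ →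
          ‖GPE.err a b β V ψ ψ₀ τ N n‖ ≤ C * (τ + GPE.mesh a b N ^ 2) ∧
          GPE.HNormLE a b 1 (GPE.err a b β V ψ ψ₀ τ N n)
            (C * (Real.sqrt τ + GPE.mesh a b N))) ∧
      (GPE.MemW a b 1 4 V → GPE.MemHper a b 1 V →
        GPE.ContHper a b T 3 ψ → GPE.ContDiffH a b T 1 ψ →
        ∃ C : ℝ, 0 < C ∧ ∀ (N : ℕ) (τ : ℝ), 0 < N → Even N → GPE.mesh a b N < h₀ →
          0 < τ → τ ≤ GPE.mesh a b N ^ 2 / Real.pi → ∀ n : ℕ, (n : ℝ) ≤ T / τ →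
            GPE.HNormLE a b 1 (GPE.err a b β V ψ ψ₀ τ N n)
              (C * (τ + GPE.mesh a b N ^ 2))) := by
  obtain ⟨M, B, K, hc⟩ := GPE.exists_fourierFlow hab hT hV hsol hH2 hC1
  have hψ₀' := GPE.eq_syn_of_init hab hT hH2 hψ₀ hinit
  obtain ⟨h₀, hh₀, hh₁, C, hC, hL2⟩ := hc.l2_error hab hT hψ₀'
  have hM := hc.M_nonneg
  have hω := Real.sqrt_nonneg (b - a)
  have hpi := Real.pi_pos
  have herr : ∀ (N : ℕ) (τ : ℝ), 0 < N → Even N → GPE.mesh a b N < h₀ → 0 < τ →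
      τ ≤ GPE.mesh a b N ^ 2 / Real.pi → ∀ n : ℕ, n * τ ≤ T →
      ‖GPE.err a b β V ψ ψ₀ τ N n‖ ≤
        Real.sqrt (b - a) * (C + M) * (τ + GPE.mesh a b N ^ 2) := fun N τ hN hNe hm hτ hτh n hn => by
    have ht : (n : ℝ) * τ ∈ Icc 0 T := ⟨by positivity, hn⟩
    refine (GPE.norm_err_le hab hN hNe hM (hL2 N τ hN hNe hm hτ hτh n hn).1
      (hc.summable_sq _ ht) (hc.tsum_sq_le _ ht)).trans ?_
    rw [mul_assoc]
    refine mul_le_mul_of_nonneg_left ?_ hω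
    nlinarith
  refine ⟨h₀, hh₀, ⟨Real.sqrt (b - a) * (C + M) + Real.sqrt (b - a) * (Real.pi * C + M) + 1,
    by positivity, fun N τ hN hNe hm hτ hτh n hnT => ?_⟩, fun _ hVper hH3 hCH1 => ?_⟩
  · have hn : n * τ ≤ T := (le_div_iff₀ hτ).1 hnT
    have ht : (n : ℝ) * τ ∈ Icc 0 T := ⟨by positivity, hn⟩
    have hh := GPE.mesh_pos hab hN
    have hh1 := hm.le.trans hh₁
    have hτ2 := GPE.step_le_mesh_sq hτh
    have he := herr N τ hN hNe hm hτ hτh n hn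
    have hL := (hL2 N τ hN hNe hm hτ hτh n hn).1
    constructor
    · refine he.trans ?_
      gcongr
      rw [add_assoc]
      exact le_add_of_nonneg_right (by positivity)
    -- The inverse inequality divides the `L²` bound by `h`; with `τ/h ≤ √τ` this leaves `√τ + h`.
    · have hA := (GPE.sn_freq_le_inverse hab hN _).trans
        (mul_le_mul_of_nonneg_left hL (by positivity : 0 ≤ Real.pi / GPE.mesh a b N))
      refine (GPE.hNormLE_err hab hN hNe hH2 ht 1 hM he hA (hc.summable_sq _ ht)
        (hc.tsum_sq_le _ ht)).mono ?_
      have k1 := GPE.div_mesh_le_sqrt hab hN hτ.le hτ2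
      have k2 : τ ≤ Real.sqrt τ := by
        have h1 : Real.sqrt τ ≤ 1 := Real.sqrt_le_one.2 (hτ2.trans (pow_le_one₀ hh.le hh1))
        nlinarith [Real.mul_self_sqrt hτ.le, Real.sqrt_nonneg τ]
      have k3 : GPE.mesh a b N ^ 2 ≤ GPE.mesh a b N := by nlinarith
      have k4 : Real.pi / GPE.mesh a b N * (C * (τ + GPE.mesh a b N ^ 2)) ≤
          Real.pi * C * (Real.sqrt τ + GPE.mesh a b N) := by
        calc _ = Real.pi * C * (τ / GPE.mesh a b N + GPE.mesh a b N) := by field_simp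
          _ ≤ _ := by gcongr
      have k5 : GPE.mesh a b N ^ 1 * M ≤ M * (Real.sqrt τ + GPE.mesh a b N) := by
        nlinarith [mul_nonneg hM (Real.sqrt_nonneg τ)]
      calc _ ≤ Real.sqrt (b - a) * (C + M) * (Real.sqrt τ + GPE.mesh a b N) +
            Real.sqrt (b - a) * (Real.pi * C * (Real.sqrt τ + GPE.mesh a b N) +
              M * (Real.sqrt τ + GPE.mesh a b N)) := by gcongr
        _ ≤ _ := by nlinarith [Real.sqrt_nonneg τ]
  · obtain ⟨M₁, K₁, hs⟩ := GPE.exists_smoothFlow hab hT hH3 hCH1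
    obtain ⟨B', KV, W, hW⟩ := GPE.exists_smoothPotential hab hVper
    obtain ⟨C₁, hC₁, hH1⟩ := hs.h1_error hc hW hab hT hψ₀' hC
    have hM₁ := hs.M_nonneg
    refine ⟨Real.sqrt (b - a) * (C + M) + Real.sqrt (b - a) * (C₁ + M₁) + 1, by positivity,
      fun N τ hN hNe hm hτ hτh n hnT => ?_⟩
    have hn : n * τ ≤ T := (le_div_iff₀ hτ).1 hnT
    have ht : (n : ℝ) * τ ∈ Icc 0 T := ⟨by positivity, hn⟩
    have hh := GPE.mesh_pos hab hN
    refine (GPE.hNormLE_err hab hN hNe hH2 ht 2 hM₁ (herr N τ hN hNe hm hτ hτh n hn)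
      (hH1 N τ hN hNe (hm.le.trans hh₁) hτ hτh (hL2 N τ hN hNe hm hτ hτh) n hn)
      (hs.summable_three _ ht) (hs.tsum_three_le _ ht)).mono ?_
    have k5 : GPE.mesh a b N ^ 2 * M₁ ≤ M₁ * (τ + GPE.mesh a b N ^ 2) := by
      nlinarith [mul_nonneg hM₁ hτ.le]
    calc _ ≤ Real.sqrt (b - a) * (C + M) * (τ + GPE.mesh a b N ^ 2) +
          Real.sqrt (b - a) * (C₁ * (τ + GPE.mesh a b N ^ 2) +
            M₁ * (τ + GPE.mesh a b N ^ 2)) := by gcongr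
      _ ≤ _ := by nlinarith [sq_nonneg (GPE.mesh a b N)]
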